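/- Let $G$ be a Lie group with Lie algebra $\mathfrak g=T_1G$ and Maurer–Cartan form $\theta\in\Omega^1(G;\mathfrak g)$. Manifolds are smooth, finite-dimensional, Hausdorff, second countable and without boundary; $\mathbf{Man}$ is the category of manifolds and smooth maps. **Groupoids of connections.** A $G$-connection on a manifold $M$ is a smooth principal (right) $G$-bundle $\pi\colon P\to M$ with a form $\Theta\in\Omega^1(P;\mathfrak g)$ that restricts to $\theta$ on each fibre (identified with $G$ by the orbit map of any of its points) and satisfies $R_g^*\Theta=\mathrm{Ad}_{g^{-1}}\Theta$ for all $g\in G$. An isomorphism $(P',\Theta')\to(P,\Theta)$ is a $G$-equivariant diffeomorphism $\varphi\colon P'\to P$ over $M$ with $\varphi^*\Theta=\Theta'$. Let $\mathcal G(M)$ be the resulting groupoid. More generally, a bundle map covering a smooth map $f\colon N\to M$ from a $G$-connection on $N$ to one on $M$ is a smooth $G$-equivariant map $\varphi$ of total spaces covering $f$ such that $\varphi^*$ carries the second connection form to the first. **The presheaf of groupoids $B_\nabla G$.** It is the strictly functorial version of $M\mapsto\mathcal G(M)$: an object of $B_\nabla G(M)$ assigns to each smooth map $f\colon N\to M$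 a $G$-connection on $N$, and to each map of manifolds over $M$ a bundle map covering it, compatibly with identities and compositions (that is, a $G$-connection on $M$ together with chosen pullbacks); a morphism is a compatible family of isomorphisms of $G$-connections. Pullback along $M'\to M$ is given by precomposition. **The presheaf of groupoids $B_\nabla^{\mathrm{triv}}G$.** The group of smooth maps $g\colon M\to G$ acts from the right on $\Omega^1(M;\mathfrak g)$ by gauge transformations $$\alpha\cdot g=g^*\theta+\mathrm{Ad}_{g^{-1}}\alpha ,$$ and $B_\nabla^{\mathrm{triv}}G(M)$ is the action groupoid: its objects are the forms $\alpha\in\Omega^1(M;\mathfrak g)$ and its arrows are $g\colon\alpha\to\alpha\cdot g$. **The map.** Let $\psi\colon B_\nabla^{\mathrm{triv}}G\to B_\nabla G$ send $\alpha\in\Omega^1(M;\mathfrak g)$ to the trivial bundle $M\times G\to M$ with connection "$\alpha+\theta$", i.e. $\Theta_{(x,h)}=\mathrm{Ad}_{h^{-1}}\alpha_x+\theta_h$ (with chosen pullback along $f\colon N\to M$ the trivial bundle over $N$ with connection $f^*\alpha+\theta$), and send $g\colon\alpha\to\alpha\cdot g$ to the isomorphism $(x,h)\mapsto(x,g(x)^{-1}h)$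 from the trivial bundle with connection $\alpha+\theta$ to the trivial bundle with connection $\alpha\cdot g+\theta$. **Weak equivalence.** A simplicial presheaf on manifolds is a functor $F\colon\mathbf{Man}^{\mathrm{op}}\to\mathbf{Set}_\Delta$. Its $m$-dimensional stalk is the simplicial set $\operatorname{colim}_{r\to0}F(B^m(r))$, where $B^m(r)\subset\mathbb R^m$ is the open ball of radius $r$ about $0$. A map of simplicial presheaves is a weak equivalence if for every $m\ge0$ the induced map of $m$-dimensional stalks is a weak equivalence of simplicial sets, i.e. its geometric realization is a weak homotopy equivalence. A presheaf of groupoids is regarded as a simplicial presheaf through the nerve. **Proposition.** $\psi\colon B_\nabla^{\mathrm{triv}}G\to B_\nabla G$ is a weak equivalence of groupoids, hence of simplicial presheaves. Precisely: 1. for every ball $B=B^m(r)$, $m\ge0$, $r>0$, the functor $B_\nabla^{\mathrm{triv}}G(B)\to\mathcal G(B)$, $\alpha\mapsto(B\times G,\alpha+\theta)$, and the functor $\psi(B)\colon B_\nabla^{\mathrm{triv}}G(B)\to B_\nabla G(B)$ are equivalences of groupoids; 2. the map of simplicial presheaves induced by $\psi$ is a weak equivalence. -/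

import Mathlib

set_option linter.unusedSectionVars false
set_option linter.style.haveILetI false

open CategoryTheory Bundle
open scoped Manifold ContDiff

noncomputable section

namespace GConn

section Forms

variable {E : Type} [NormedAddCommGroup E] [NormedSpace ℝ E] {H : Type} [TopologicalSpace H]
  {I : ModelWithCorners ℝ E H} {M : Type} [TopologicalSpace M] [ChartedSpace H M]
  [IsManifold I ∞ M]
  {E' : Type} [NormedAddCommGroup E'] [NormedSpace ℝ E'] {H' : Type} [TopologicalSpace H']
  {I' : ModelWithCorners ℝ E' H'} {M' : Type} [TopologicalSpace M'] [ChartedSpace H' M']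
  [IsManifold I' ∞ M']
  {E'' : Type} [NormedAddCommGroup E''] [NormedSpace ℝ E''] {H'' : Type} [TopologicalSpace H'']
  {I'' : ModelWithCorners ℝ E'' H''} {M'' : Type} [TopologicalSpace M''] [ChartedSpace H'' M'']
  [IsManifold I'' ∞ M'']
  {V : Type} [NormedAddCommGroup V] [NormedSpace ℝ V]

/-- A smooth `1`-form on the manifold `M` with values in the vector space `V`: a smooth function
`TM → V` which is linear on each tangent space. -/
structure OneForm {E : Type} [NormedAddCommGroup E] [NormedSpace ℝ E] {H : Type}
    [TopologicalSpace H] (I : ModelWithCorners ℝ E H) (M : Type) [TopologicalSpace M]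
    [ChartedSpace H M] [IsManifold I ∞ M] (V : Type) [NormedAddCommGroup V]
    [NormedSpace ℝ V] where
  toFun : TangentBundle I M → V
  map_add' : ∀ (x : M) (v w : TangentSpace I x), toFun ⟨x, v + w⟩ = toFun ⟨x, v⟩ + toFun ⟨x, w⟩
  map_smul' : ∀ (x : M) (c : ℝ) (v : TangentSpace I x), toFun ⟨x, c • v⟩ = c • toFun ⟨x, v⟩
  contMDiff' : ContMDiff I.tangent 𝓘(ℝ, V) ∞ toFun

instance : CoeFun (OneForm I M V) (fun _ => TangentBundle I M → V) := ⟨OneForm.toFun⟩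

theorem OneForm.ext {α β : OneForm I M V} (h : ∀ v, α v = β v) : α = β := by
  cases α; cases β; congr; exact funext h

theorem contMDiff_tangentMap {f : M → M'} (hf : ContMDiff I I' ∞ f) :
    ContMDiff I.tangent I'.tangent ∞ (tangentMap I I' f) := by
  haveI : IsManifold I 1 M := IsManifold.of_le (n := ∞) (by simp)
  haveI : IsManifold I' 1 M' := IsManifold.of_le (n := ∞) (by simp)
  exact hf.contMDiff_tangentMap (by simp)

/-- The pullback `f^*α`. -/
def OneForm.pull (f : M → M') (hf : ContMDiff I I' ∞ f) (α : OneForm I' M' V) :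
    OneForm I M V where
  toFun v := α (tangentMap I I' f v)
  map_add' x v w := by
    simp only [tangentMap, map_add]
    exact α.map_add' _ _ _
  map_smul' x c v := by
    simp only [tangentMap, map_smul]
    exact α.map_smul' _ _ _
  contMDiff' := α.contMDiff'.comp (contMDiff_tangentMap hf)

theorem tangentMap_comp_apply {f : M → M'} {g : M' → M''} (hg : ContMDiff I' I'' ∞ g)
    (hf : ContMDiff I I' ∞ f) (v : TangentBundle I M) :
    tangentMap I' I'' g (tangentMap I I' f v) = tangentMap I I'' (fun x => g (f x)) v :=
  (congrFun (tangentMap_comp (hg.mdifferentiable (by simp)) (hf.mdifferentiable (by simp))) v).symm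

theorem OneForm.pull_id (α : OneForm I M V) : α.pull (fun x => x) contMDiff_id = α :=
  OneForm.ext fun v => congrArg α (congrFun tangentMap_id v)

theorem OneForm.pull_pull {f : M → M'} {g : M' → M''} (hg : ContMDiff I' I'' ∞ g)
    (hf : ContMDiff I I' ∞ f) (α : OneForm I'' M'' V) :
    (α.pull g hg).pull f hf = α.pull (fun x => g (f x)) (hg.comp hf) :=
  OneForm.ext fun v => congrArg α (tangentMap_comp_apply hg hf v)

/-- The tangent vector at `x` with components `ξ` in the model space; in Mathlib the tangent space
at `x` is, as a vector space, the model space. -/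
def vec (I : ModelWithCorners ℝ E H) (x : M) (ξ : E) : TangentBundle I M :=
  ⟨x, (show TangentSpace I x from ξ)⟩

/-- The components of a tangent vector in the model space. -/
def comps (w : TangentBundle I M) : E := w.snd

theorem comps_vec (x : M) (ξ : E) : comps (vec I x ξ) = ξ := rfl

theorem vec_comps (w : TangentBundle I M) : vec I w.proj (comps w) = w := rfl

theorem comps_tangentMap_add (f : M → M') (x : M) (ξ η : E) :
    comps (tangentMap I I' f (vec I x (ξ + η))) =
      comps (tangentMap I I' f (vec I x ξ)) + comps (tangentMap I I' f (vec I x η)) :=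
  (mfderiv I I' f x).map_add _ _

theorem comps_tangentMap_smul (f : M → M') (x : M) (c : ℝ) (ξ : E) :
    comps (tangentMap I I' f (vec I x (c • ξ))) = c • comps (tangentMap I I' f (vec I x ξ)) :=
  (mfderiv I I' f x).map_smul _ _

theorem comps_tangentMap_zero (f : M → M') (x : M) :
    comps (tangentMap I I' f (vec I x 0)) = 0 :=
  (mfderiv I I' f x).map_zero

theorem comps_tangentMap_const (y : M') (w : TangentBundle I M) :
    comps (tangentMap I I' (fun _ => y) w) = 0 := by
  have h : mfderiv I I' (fun _ : M => y) w.proj = 0 := mfderiv_const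
  have h2 := DFunLike.congr_fun h w.snd
  exact h2

end Forms

section LieGroup

variable {E : Type} [NormedAddCommGroup E] [NormedSpace ℝ E] {H : Type} [TopologicalSpace H]
  (I : ModelWithCorners ℝ E H) {G : Type} [TopologicalSpace G] [ChartedSpace H G] [Group G]
  [LieGroup I ∞ G]

/-- The Maurer-Cartan form `θ` of the Lie group `G`, as a function on the tangent bundle: it sends
`w ∈ T_g G` to `d(L_{g⁻¹}) w ∈ T_1 G = 𝔤`. As a vector space, `T_1 G` is the model space `E`. -/
def mc (w : TangentBundle I G) : E := comps (tangentMap I I (fun x : G => w.proj⁻¹ * x) w)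

/-- The adjoint action of `G` on `𝔤 = T_1 G`: the differential at `1` of `x ↦ g x g⁻¹`. -/
def Ad (g : G) (ξ : E) : E := comps (tangentMap I I (fun x : G => g * x * g⁻¹) (vec I 1 ξ))

theorem contMDiff_conj (g : G) : ContMDiff I I ∞ (fun x : G => g * x * g⁻¹) :=
  (contMDiff_const.mul contMDiff_id).mul contMDiff_const

theorem contMDiff_lmul (g : G) : ContMDiff I I ∞ (fun x : G => g * x) :=
  contMDiff_const.mul contMDiff_id

theorem contMDiff_rmul (g : G) : ContMDiff I I ∞ (fun x : G => x * g) :=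
  contMDiff_id.mul contMDiff_const

theorem comps_tangentMap_conj (g : G) (w : TangentBundle I G) (hw : w.proj = 1) :
    comps (tangentMap I I (fun x : G => g * x * g⁻¹) w) = Ad I g (comps w) := by
  obtain ⟨x, v⟩ := w
  cases hw
  rfl

theorem Ad_add (g : G) (ξ η : E) : Ad I g (ξ + η) = Ad I g ξ + Ad I g η :=
  comps_tangentMap_add _ _ _ _

theorem Ad_smul (g : G) (c : ℝ) (ξ : E) : Ad I g (c • ξ) = c • Ad I g ξ :=
  comps_tangentMap_smul _ _ _ _

theorem Ad_zero (g : G) : Ad I g (0 : E) = 0 := comps_tangentMap_zero _ _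

theorem Ad_one (ξ : E) : Ad I (1 : G) ξ = ξ := by
  have : (fun x : G => 1 * x * 1⁻¹) = id := by ext; simp
  unfold Ad
  rw [this, tangentMap_id]; rfl

theorem Ad_mul (g h : G) (ξ : E) : Ad I (g * h) ξ = Ad I g (Ad I h ξ) := by
  have e : (fun x : G => g * h * x * (g * h)⁻¹) = fun x => g * (h * x * h⁻¹) * g⁻¹ := by
    ext x; group
  rw [Ad, e, ← tangentMap_comp_apply (contMDiff_conj I g) (contMDiff_conj I h),
    comps_tangentMap_conj]
  · rfl
  · simp [tangentMap, vec]

theorem comps_tangentMap_mul {E' : Type} [NormedAddCommGroup E'] [NormedSpace ℝ E'] {H' : Type}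
    [TopologicalSpace H'] {I' : ModelWithCorners ℝ E' H'} {M : Type} [TopologicalSpace M]
    [ChartedSpace H' M] [IsManifold I' ∞ M] {f k : M → G} (hf : ContMDiff I' I ∞ f) (hk : ContMDiff I' I ∞ k)
    (v : TangentBundle I' M) :
    comps (tangentMap I' I (fun x => f x * k x) v) =
      comps (tangentMap I I (fun y => y * k v.proj) (tangentMap I' I f v)) +
      comps (tangentMap I I (fun y => f v.proj * y) (tangentMap I' I k v)) := by
  have hmul : ContMDiff (I.prod I) I ∞ (fun p : G × G => p.1 * p.2) := contMDiff_mul I ∞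
  have h1 : (fun x => f x * k x) = (fun p : G × G => p.1 * p.2) ∘ (fun x => (f x, k x)) := rfl
  have hd : MDifferentiableAt I' (I.prod I) (fun x => (f x, k x)) v.proj :=
    (hf.prodMk hk).mdifferentiable (by simp) _
  have hm := hmul.mdifferentiable (by simp) (f v.proj, k v.proj)
  have h2 := mfderiv_comp_apply (I := I') (I' := I.prod I) (I'' := I) v.proj hm hd v.snd
  have h3 := mfderiv_prodMk (hf.mdifferentiable (by simp) v.proj)
    (hk.mdifferentiable (by simp) v.proj)
  have h4 := mfderiv_prod_eq_add_apply (v := mfderiv I' (I.prod I) (fun x => (f x, k x)) v.proj v.snd) hm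
  rw [h3] at h4
  refine Eq.trans h2 ?_
  rw [h3]
  exact h4

theorem mc_const {E' : Type} [NormedAddCommGroup E'] [NormedSpace ℝ E'] {H' : Type}
    [TopologicalSpace H'] {I' : ModelWithCorners ℝ E' H'} {M : Type} [TopologicalSpace M]
    [ChartedSpace H' M] [IsManifold I' ∞ M] (g : G) (v : TangentBundle I' M) :
    mc I (tangentMap I' I (fun _ => g) v) = 0 := by
  unfold mc
  rw [tangentMap_comp_apply (contMDiff_lmul I _) contMDiff_const]
  exact comps_tangentMap_const _ _

theorem mc_mul {E' : Type} [NormedAddCommGroup E'] [NormedSpace ℝ E'] {H' : Type}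
    [TopologicalSpace H'] {I' : ModelWithCorners ℝ E' H'} {M : Type} [TopologicalSpace M]
    [ChartedSpace H' M] [IsManifold I' ∞ M] {f k : M → G} (hf : ContMDiff I' I ∞ f) (hk : ContMDiff I' I ∞ k)
    (v : TangentBundle I' M) :
    mc I (tangentMap I' I (fun x => f x * k x) v) =
      Ad I (k v.proj)⁻¹ (mc I (tangentMap I' I f v)) + mc I (tangentMap I' I k v) := by
  have key : ∀ (a b : G) (u : TangentBundle I' M), 
      comps (tangentMap I' I (fun x => (b⁻¹ * a⁻¹ * f x) * k x) u) =
      comps (tangentMap I I (fun y => y * k u.proj)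
        (tangentMap I' I (fun x => b⁻¹ * a⁻¹ * f x) u)) +
      comps (tangentMap I I (fun y => (b⁻¹ * a⁻¹ * f u.proj) * y) (tangentMap I' I k u)) :=
    fun a b u => comps_tangentMap_mul I (contMDiff_const.mul hf) hk u
  have h := key (f v.proj) (k v.proj) v
  have e1 : mc I (tangentMap I' I (fun x => f x * k x) v) =
      comps (tangentMap I' I (fun x => ((k v.proj)⁻¹ * (f v.proj)⁻¹ * f x) * k x) v) := by
    unfold mc
    rw [tangentMap_comp_apply (f := fun x => f x * k x) (contMDiff_lmul I _) (hf.mul hk)]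
    have : (fun x => (tangentMap I' I (fun x => f x * k x) v).proj⁻¹ * (f x * k x)) =
      (fun x => ((k v.proj)⁻¹ * (f v.proj)⁻¹ * f x) * k x) := by
      ext x; simp only [tangentMap]; group
    rw [this]
  have e2 : mc I (tangentMap I' I k v) =
      comps (tangentMap I I (fun y => ((k v.proj)⁻¹ * (f v.proj)⁻¹ * f v.proj) * y)
        (tangentMap I' I k v)) := by
    unfold mc
    have : (fun y => ((k v.proj)⁻¹ * (f v.proj)⁻¹ * f v.proj) * y) =
      (fun y => (tangentMap I' I k v).proj⁻¹ * y) := by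
      ext x; simp only [tangentMap]; group
    rw [this]
  have e3 : Ad I (k v.proj)⁻¹ (mc I (tangentMap I' I f v)) =
      comps (tangentMap I I (fun y => y * k v.proj)
        (tangentMap I' I (fun x => (k v.proj)⁻¹ * (f v.proj)⁻¹ * f x) v)) := by
    unfold mc
    rw [← comps_tangentMap_conj]
    · rw [tangentMap_comp_apply (contMDiff_lmul I _) hf,
        tangentMap_comp_apply (f := fun x => (tangentMap I' I f v).proj⁻¹ * f x)
          (contMDiff_conj I _) (contMDiff_const.mul hf),
        tangentMap_comp_apply (f := fun x => (k v.proj)⁻¹ * (f v.proj)⁻¹ * f x)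
          (contMDiff_rmul I _) (contMDiff_const.mul hf)]
      have : (fun x => (k v.proj)⁻¹ * ((tangentMap I' I f v).proj⁻¹ * f x) * (k v.proj)⁻¹⁻¹) =
        (fun x => (k v.proj)⁻¹ * (f v.proj)⁻¹ * f x * k v.proj) := by
        ext x; simp only [tangentMap]; group
      rw [this]
    · simp [tangentMap]
  rw [e1, e2, e3, h]

theorem trivializationAt_self (w : TangentBundle I G) [IsManifold I 1 G] :
    (trivializationAt E (TangentSpace I) w.proj w).2 = comps w := by
  obtain ⟨x, v⟩ := w
  exact congrArg Prod.snd ((tangentBundleCore I G).localTrivAt_apply_mk x v)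

theorem contMDiff_comps {E' : Type} [NormedAddCommGroup E'] [NormedSpace ℝ E'] {H' : Type}
    [TopologicalSpace H'] {I' : ModelWithCorners ℝ E' H'} {M : Type} [TopologicalSpace M]
    [ChartedSpace H' M] [IsManifold I' ∞ M] {F : M → TangentBundle I G}
    (hF : ContMDiff I' I.tangent ∞ F) (h1 : ∀ x, (F x).proj = 1) :
    ContMDiff I' 𝓘(ℝ, E) ∞ (fun x => comps (F x)) := by
  haveI : IsManifold I 1 G := IsManifold.of_le (n := ∞) (by simp)
  intro x
  have h := (Bundle.contMDiffAt_totalSpace.1 (hF x)).2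
  refine h.congr_of_eventuallyEq (Filter.Eventually.of_forall fun y => ?_)
  have e : (F x).proj = (F y).proj := (h1 x).trans (h1 y).symm
  have h2 := trivializationAt_self I (F y)
  rw [← e] at h2
  exact h2.symm

theorem contMDiff_vec (x : G) : ContMDiff 𝓘(ℝ, E) I.tangent ∞ (fun ξ : E => vec I x ξ) := by
  haveI : IsManifold I 1 G := IsManifold.of_le (n := ∞) (by simp)
  intro ξ
  refine Bundle.contMDiffAt_totalSpace.2 ⟨contMDiffAt_const, ?_⟩
  refine contMDiffAt_id.congr_of_eventuallyEq (Filter.Eventually.of_forall fun y => ?_)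
  exact trivializationAt_self I (vec I x y)

theorem contMDiff_zeroVec : ContMDiff I I.tangent ∞ (fun x : G => vec I x 0) := by
  haveI : IsManifold I 1 G := IsManifold.of_le (n := ∞) (by simp)
  exact contMDiff_zeroSection ℝ (TangentSpace I : G → Type)

/-- The tangent vector `(u, w)` of `G × G`. -/
def pairVec (u w : TangentBundle I G) : TangentBundle (I.prod I) (G × G) :=
  (equivTangentBundleProd I G I G).symm (u, w)

theorem contMDiff_pairVec {E' : Type} [NormedAddCommGroup E'] [NormedSpace ℝ E'] {H' : Type}
    [TopologicalSpace H'] {I' : ModelWithCorners ℝ E' H'} {M : Type} [TopologicalSpace M]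
    [ChartedSpace H' M] {F K : M → TangentBundle I G}
    (hF : ContMDiff I' I.tangent ∞ F) (hK : ContMDiff I' I.tangent ∞ K) :
    ContMDiff I' (I.prod I).tangent ∞ (fun x => pairVec I (F x) (K x)) := by
  haveI : IsManifold I 1 G := IsManifold.of_le (n := ∞) (by simp)
  exact contMDiff_equivTangentBundleProd_symm.comp (hF.prodMk hK)

theorem comps_tangentMap_pairVec {f : G × G → G} (hf : ContMDiff (I.prod I) I ∞ f) (a : G)
    (w : TangentBundle I G) :
    comps (tangentMap (I.prod I) I f (pairVec I (vec I a 0) w)) =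
      comps (tangentMap I I (fun y => f (a, y)) w) := by
  have hm := hf.mdifferentiable (by simp) (a, w.proj)
  have h4 := mfderiv_prod_eq_add_apply (v := (pairVec I (vec I a 0) w).snd) hm
  refine Eq.trans h4 ?_
  have h5 := (mfderiv I I (fun z => f (z, w.proj)) a).map_zero
  refine (congrArg₂ (fun a b : E => a + b) h5 rfl).trans (zero_add _)

theorem contMDiff_mc : ContMDiff I.tangent 𝓘(ℝ, E) ∞ (mc I : TangentBundle I G → E) := by
  haveI : IsManifold I 1 G := IsManifold.of_le (n := ∞) (by simp)
  have hp : ContMDiff I.tangent I ∞ (fun w : TangentBundle I G => w.proj) :=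
    Bundle.contMDiff_proj (TangentSpace I)
  have hmul : ContMDiff (I.prod I) I ∞ (fun p : G × G => p.1 * p.2) := contMDiff_mul I ∞
  have h := (contMDiff_tangentMap hmul).comp
    (contMDiff_pairVec I ((contMDiff_zeroVec I).comp hp.inv) contMDiff_id)
  refine (contMDiff_comps I h (fun w => ?_)).congr (fun w => ?_)
  · exact inv_mul_cancel w.proj
  · exact (comps_tangentMap_pairVec I hmul w.proj⁻¹ w).symm

theorem contMDiff_Ad : ContMDiff (I.prod 𝓘(ℝ, E)) 𝓘(ℝ, E) ∞ (fun p : G × E => Ad I p.1 p.2) := by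
  have hc : ContMDiff (I.prod I) I ∞ (fun p : G × G => p.1 * p.2 * p.1⁻¹) :=
    (contMDiff_fst.mul contMDiff_snd).mul contMDiff_fst.inv
  have h := (contMDiff_tangentMap hc).comp
    (contMDiff_pairVec I ((contMDiff_zeroVec I).comp contMDiff_fst)
      ((contMDiff_vec I (1 : G)).comp (contMDiff_snd (I := I) (J := 𝓘(ℝ, E)) (M := G))))
  refine (contMDiff_comps I h (fun p => ?_)).congr (fun p => ?_)
  · show p.1 * 1 * p.1⁻¹ = 1
    simp
  · exact (comps_tangentMap_pairVec I hc p.1 (vec I 1 p.2)).symm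

end LieGroup

section Gauge

variable {E : Type} [NormedAddCommGroup E] [NormedSpace ℝ E] {H : Type} [TopologicalSpace H]
  (J : ModelWithCorners ℝ E H) {G : Type} [TopologicalSpace G] [ChartedSpace H G] [Group G]
  [LieGroup J ∞ G]
  {E' : Type} [NormedAddCommGroup E'] [NormedSpace ℝ E'] {H' : Type} [TopologicalSpace H']
  {I : ModelWithCorners ℝ E' H'} {M : Type} [TopologicalSpace M] [ChartedSpace H' M]
  [IsManifold I ∞ M]
  {E'' : Type} [NormedAddCommGroup E''] [NormedSpace ℝ E''] {H'' : Type} [TopologicalSpace H'']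
  {I' : ModelWithCorners ℝ E'' H''} {N : Type} [TopologicalSpace N] [ChartedSpace H'' N]
  [IsManifold I' ∞ N]

theorem contMDiff_Ad_comp {g : M → G} (hg : ContMDiff I J ∞ g) {k : M → E}
    (hk : ContMDiff I 𝓘(ℝ, E) ∞ k) : ContMDiff I 𝓘(ℝ, E) ∞ (fun x => Ad J (g x) (k x)) :=
  (contMDiff_Ad J).comp (hg.prodMk hk)

/-- The gauge action `α · g = g^*θ + Ad_{g⁻¹} α` of a smooth map `g : M → G` on a `𝔤`-valued
`1`-form `α` on `M`. -/
def OneForm.gauge (α : OneForm I M E) (g : M → G) (hg : ContMDiff I J ∞ g) : OneForm I M E where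
  toFun v := mc J (tangentMap I J g v) + Ad J (g v.proj)⁻¹ (α v)
  map_add' x v w := by
    have h1 := comps_tangentMap_add (I := I) (I' := J) (fun y => (g x)⁻¹ * g y) x v w
    rw [α.map_add', Ad_add]
    simp only [mc]
    rw [tangentMap_comp_apply (contMDiff_lmul J _) hg, tangentMap_comp_apply (contMDiff_lmul J _) hg,
      tangentMap_comp_apply (contMDiff_lmul J _) hg]
    exact (congrArg (· + _) h1).trans (add_add_add_comm _ _ _ _)
  map_smul' x c v := by
    have h1 := comps_tangentMap_smul (I := I) (I' := J) (fun y => (g x)⁻¹ * g y) x c v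
    rw [α.map_smul', Ad_smul]
    simp only [mc]
    rw [tangentMap_comp_apply (contMDiff_lmul J _) hg, tangentMap_comp_apply (contMDiff_lmul J _) hg]
    exact (congrArg (· + _) h1).trans (smul_add _ _ _).symm
  contMDiff' := by
    haveI : IsManifold I 1 M := IsManifold.of_le (n := ∞) (by simp)
    have hp : ContMDiff I.tangent I ∞ (fun w : TangentBundle I M => w.proj) :=
      Bundle.contMDiff_proj (TangentSpace I)
    haveI : IsManifold J 1 G := IsManifold.of_le (n := ∞) (by simp)
    exact ((contMDiff_mc J).comp (contMDiff_tangentMap hg)).add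
      (contMDiff_Ad_comp J ((hg.comp hp).inv) α.contMDiff')

theorem gauge_apply (α : OneForm I M E) (g : M → G) (hg : ContMDiff I J ∞ g)
    (v : TangentBundle I M) :
    α.gauge J g hg v = mc J (tangentMap I J g v) + Ad J (g v.proj)⁻¹ (α v) := rfl

theorem gauge_one (α : OneForm I M E) : α.gauge J (fun _ => (1 : G)) contMDiff_const = α :=
  OneForm.ext fun v => by
    rw [gauge_apply, mc_const, inv_one, Ad_one, zero_add]

theorem gauge_gauge (α : OneForm I M E) {g h : M → G} (hg : ContMDiff I J ∞ g)
    (hh : ContMDiff I J ∞ h) :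
    (α.gauge J g hg).gauge J h hh = α.gauge J (fun x => g x * h x) (hg.mul hh) :=
  OneForm.ext fun v => by
    rw [gauge_apply, gauge_apply, gauge_apply, mc_mul J hg hh, mul_inv_rev, Ad_mul, Ad_add]
    abel

theorem pull_gauge (α : OneForm I M E) {g : M → G} (hg : ContMDiff I J ∞ g) {f : N → M}
    (hf : ContMDiff I' I ∞ f) :
    (α.gauge J g hg).pull f hf = (α.pull f hf).gauge J (fun y => g (f y)) (hg.comp hf) :=
  OneForm.ext fun v => by
    rw [gauge_apply]
    show mc J (tangentMap I J g (tangentMap I' I f v)) + _ = _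
    rw [tangentMap_comp_apply hg hf]
    rfl

theorem gauge_const_apply (α : OneForm I M E) (g : G) (v : TangentBundle I M) :
    α.gauge J (fun _ => g) contMDiff_const v = Ad J g⁻¹ (α v) := by
  rw [gauge_apply, mc_const, zero_add]

theorem gauge_congr {α β : OneForm I M E} (h : α = β) {g k : M → G} (e : ∀ x, g x = k x)
    (hg : ContMDiff I J ∞ g) (hk : ContMDiff I J ∞ k) : α.gauge J g hg = β.gauge J k hk := by
  obtain rfl : g = k := funext e
  subst h; rfl

theorem pull_congr {V : Type} [NormedAddCommGroup V] [NormedSpace ℝ V] (α : OneForm I M V)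
    {f k : N → M} (e : ∀ x, f x = k x) (hf : ContMDiff I' I ∞ f) (hk : ContMDiff I' I ∞ k) :
    α.pull f hf = α.pull k hk := by
  obtain rfl : f = k := funext e
  rfl

end Gauge

/-! ### The category of manifolds -/

/-- A smooth manifold: finite-dimensional, without boundary, Hausdorff and second countable. -/
structure Man : Type 1 where
  carrier : Type
  E : Type
  H : Type
  [normedE : NormedAddCommGroup E]
  [spaceE : NormedSpace ℝ E]
  [finE : FiniteDimensional ℝ E]
  [topH : TopologicalSpace H]
  I : ModelWithCorners ℝ E H
  [boundaryless : I.Boundaryless]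
  [top : TopologicalSpace carrier]
  [charted : ChartedSpace H carrier]
  [mfd : IsManifold I ∞ carrier]
  [t2 : T2Space carrier]
  [sc : SecondCountableTopology carrier]

instance : CoeSort Man Type := ⟨Man.carrier⟩

attribute [instance] Man.normedE Man.spaceE Man.finE Man.topH Man.boundaryless Man.top
  Man.charted Man.mfd Man.t2 Man.sc

/-- A smooth map of manifolds. -/
structure Man.Hom (M N : Man) where
  toFun : M → N
  smooth : ContMDiff M.I N.I ∞ toFun

/-- The category of smooth manifolds and smooth maps. -/
instance : Category Man where
  Hom := Man.Hom
  id M := ⟨fun x => x, contMDiff_id⟩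
  comp f g := ⟨fun x => g.toFun (f.toFun x), g.smooth.comp f.smooth⟩

theorem Man.comp_toFun {M N K : Man} (f : M ⟶ N) (g : N ⟶ K) (x : M) :
    (f ≫ g).toFun x = g.toFun (f.toFun x) := rfl

/-- The product manifold. -/
abbrev Man.prod (M N : Man) : Man where
  carrier := M × N
  E := M.E × N.E
  H := ModelProd M.H N.H
  I := M.I.prod N.I

/-- The open ball of radius `r` about the origin of `ℝ^m`. -/
abbrev Man.ball (m : ℕ) (r : ℝ) : Man where
  carrier := (⟨Metric.ball 0 r, Metric.isOpen_ball⟩ :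
    TopologicalSpace.Opens (EuclideanSpace ℝ (Fin m)))
  E := EuclideanSpace ℝ (Fin m)
  H := EuclideanSpace ℝ (Fin m)
  I := modelWithCornersSelf ℝ (EuclideanSpace ℝ (Fin m))

/-- The balls of positive radius about the origin of `ℝ^m` and their inclusions. -/
def ballFunctor (m : ℕ) : {r : ℝ // 0 < r} ⥤ Man where
  obj r := Man.ball m r
  map {r s} h := ⟨TopologicalSpace.Opens.inclusion (Metric.ball_subset_ball (leOfHom h)),
    contMDiff_inclusion _⟩

/-! ### Principal bundles with connection -/

section Bundles

variable (G : Man) [Group G] [LieGroup G.I ∞ G]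

/-- A smooth principal `G`-bundle `π : P → M`, with `G` acting on `P` from the right. The local
trivializations make the action free with orbits the fibres of `π`. -/
structure PrincipalBundle (M : Man) : Type 1 where
  /-- the total space `P` -/
  total : Man
  /-- the projection `π : P → M` -/
  proj : total ⟶ M
  /-- the right action -/
  act : total → G → total
  smooth_act : ContMDiff (total.I.prod G.I) total.I ∞ (fun p : total × G => act p.1 p.2)
  act_one : ∀ p, act p 1 = p
  act_mul : ∀ p g h, act p (g * h) = act (act p g) h
  proj_act : ∀ p g, proj.toFun (act p g) = proj.toFun p
  /-- smooth `G`-equivariant local trivializations -/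
  locally_trivial : ∀ x : M, ∃ e : Trivialization G proj.toFun, x ∈ e.baseSet ∧
    ContMDiffOn total.I (M.I.prod G.I) ∞ e e.source ∧
    ContMDiffOn (M.I.prod G.I) total.I ∞ e.toOpenPartialHomeomorph.symm e.target ∧
    ∀ p ∈ e.source, ∀ g, e (act p g) = ((e p).1, (e p).2 * g)

variable {G} in
theorem PrincipalBundle.smooth_act_right {M : Man} (P : PrincipalBundle G M) (g : G) :
    ContMDiff P.total.I P.total.I ∞ (fun p => P.act p g) :=
  P.smooth_act.comp (contMDiff_id.prodMk contMDiff_const)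

/-- A `G`-connection on `M`: a principal `G`-bundle `π : P → M` with a connection, i.e. a form
`Θ ∈ Ω¹(P; 𝔤)` which restricts to the Maurer-Cartan form on each fibre (identified with `G` by the
orbit map of any of its points) and satisfies `R_g^*Θ = Ad_{g⁻¹} Θ` for all `g ∈ G`. -/
structure Connection (M : Man) : Type 1 extends PrincipalBundle G M where
  form : OneForm total.I total G.E
  restrict_fibre : ∀ (p : total) (w : TangentBundle G.I G),
    form (tangentMap G.I total.I (fun g => act p g) w) = mc G.I w
  equivariant : ∀ (g : G) (v : TangentBundle total.I total),
    form (tangentMap total.I total.I (fun p => act p g) v) = Ad G.I g⁻¹ (form v)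

variable {G}

/-- A morphism of `G`-connections covering a smooth map `f : N → M` of the bases: a smooth
`G`-equivariant map `φ` of total spaces over `f` with `φ^*Θ = Θ'`. -/
structure BundleMap {N M : Man} (f : N ⟶ M) (Q : Connection G N) (P : Connection G M) where
  toFun : Q.total → P.total
  smooth : ContMDiff Q.total.I P.total.I ∞ toFun
  proj_toFun : ∀ q, P.proj.toFun (toFun q) = f.toFun (Q.proj.toFun q)
  equivariant : ∀ q g, toFun (Q.act q g) = P.act (toFun q) g
  pull_form : P.form.pull toFun smooth = Q.form

/-- An isomorphism of `G`-connections on `M`: a `G`-equivariant diffeomorphism `φ` of total spaces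
over `M` with `φ^*Θ = Θ'`. -/
structure Connection.Iso {M : Man} (P' P : Connection G M) where
  toFun : P'.total → P.total
  invFun : P.total → P'.total
  left_inv : ∀ q, invFun (toFun q) = q
  right_inv : ∀ p, toFun (invFun p) = p
  smooth : ContMDiff P'.total.I P.total.I ∞ toFun
  smooth_inv : ContMDiff P.total.I P'.total.I ∞ invFun
  proj_toFun : ∀ q, P.proj.toFun (toFun q) = P'.proj.toFun q
  equivariant : ∀ q g, toFun (P'.act q g) = P.act (toFun q) g
  pull_form : P.form.pull toFun smooth = P'.form

theorem Connection.Iso.ext {M : Man} {P' P : Connection G M} {φ ψ : Connection.Iso P' P}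
    (h : ∀ q, φ.toFun q = ψ.toFun q) : φ = ψ := by
  obtain ⟨f, f', h1, h2, _, _, _, _, _⟩ := φ
  obtain ⟨g, g', h3, h4, _, _, _, _, _⟩ := ψ
  obtain rfl : f = g := funext h
  obtain rfl : f' = g' := funext fun p => by rw [← h2 p, h3, h1]
  rfl

/-- The groupoid of `G`-connections on `M`. -/
instance (M : Man) : Groupoid (Connection G M) where
  Hom := Connection.Iso
  id P := ⟨fun p => p, fun p => p, fun _ => rfl, fun _ => rfl, contMDiff_id, contMDiff_id,
    fun _ => rfl, fun _ _ => rfl, OneForm.pull_id _⟩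
  comp φ ψ := 
    { toFun := fun p => ψ.toFun (φ.toFun p)
      invFun := fun p => φ.invFun (ψ.invFun p)
      left_inv := fun p => by rw [ψ.left_inv, φ.left_inv]
      right_inv := fun p => by rw [φ.right_inv, ψ.right_inv]
      smooth := ψ.smooth.comp φ.smooth
      smooth_inv := φ.smooth_inv.comp ψ.smooth_inv
      proj_toFun := fun p => by rw [ψ.proj_toFun, φ.proj_toFun]
      equivariant := fun p g => by rw [φ.equivariant, ψ.equivariant]
      pull_form := by rw [← OneForm.pull_pull ψ.smooth φ.smooth, ψ.pull_form, φ.pull_form] }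
  inv {P' P} φ :=
    { toFun := φ.invFun
      invFun := φ.toFun
      left_inv := φ.right_inv
      right_inv := φ.left_inv
      smooth := φ.smooth_inv
      smooth_inv := φ.smooth
      proj_toFun := fun p => by rw [← φ.proj_toFun, φ.right_inv]
      equivariant := fun p g => by
        rw [← φ.left_inv (P'.act (φ.invFun p) g), φ.equivariant, φ.right_inv]
      pull_form := by
        rw [← φ.pull_form, OneForm.pull_pull φ.smooth φ.smooth_inv]
        exact (pull_congr _ φ.right_inv _ contMDiff_id).trans (OneForm.pull_id _) }
  id_comp _ := Connection.Iso.ext fun _ => rfl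
  comp_id _ := Connection.Iso.ext fun _ => rfl
  assoc _ _ _ := Connection.Iso.ext fun _ => rfl
  inv_comp φ := Connection.Iso.ext φ.right_inv
  comp_inv φ := Connection.Iso.ext φ.left_inv

theorem pull_const {N M : Man} {V : Type} [NormedAddCommGroup V] [NormedSpace ℝ V]
    (α : OneForm M.I M V) (x : M) (v : TangentBundle N.I N) :
    α.pull (fun _ : N => x) contMDiff_const v = 0 := by
  have h0 : α (vec M.I x 0) = 0 := by
    have h := α.map_smul' x 0 0
    rw [zero_smul, zero_smul] at h
    exact h
  have h1 : comps (tangentMap N.I M.I (fun _ : N => x) v) = 0 := comps_tangentMap_const x v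
  refine Eq.trans ?_ h0
  rw [← h1]
  rfl

variable (G) in
/-- The trivial principal bundle `M × G → M`. -/
def trivialBundle (M : Man) : PrincipalBundle G M where
  total := M.prod G
  proj := ⟨Prod.fst, contMDiff_fst⟩
  act p g := (p.1, p.2 * g)
  smooth_act := contMDiff_fst.fst.prodMk (contMDiff_fst.snd.mul contMDiff_snd)
  act_one p := by simp
  act_mul p g h := by simp [mul_assoc]
  proj_act _ _ := rfl
  locally_trivial x := by
    refine ⟨{ toOpenPartialHomeomorph := OpenPartialHomeomorph.refl (M × G)
              baseSet := Set.univ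
              open_baseSet := isOpen_univ
              source_eq := by simp
              target_eq := by simp
              proj_toFun := fun _ _ => rfl }, trivial, contMDiffOn_id, contMDiffOn_id, ?_⟩
    intro p _ g
    rfl

/-- The trivial bundle `M × G` with the connection `Θ = α + θ`, that is
`Θ_(x,h) = Ad_{h⁻¹} α_x + θ_h`: the form `pr₁^*α` acted upon by the gauge transformation
`pr₂ : M × G → G`. Its pullback along the section `x ↦ (x, 1)` is `α`. -/
def trivialConnection (M : Man) (α : OneForm M.I M G.E) : Connection G M where
  toPrincipalBundle := trivialBundle G M
  form := (α.pull (M := M × G) Prod.fst contMDiff_fst).gauge G.I Prod.snd contMDiff_snd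
  restrict_fibre p w := by
    have hs : ContMDiff G.I (M.I.prod G.I) ∞ (fun g : G => ((p.1, p.2 * g) : M × G)) :=
      contMDiff_const.prodMk (contMDiff_const.mul contMDiff_id)
    have h := congrArg (fun β : OneForm G.I G G.E => β w) (pull_gauge G.I
      (α.pull (M := M × G) Prod.fst contMDiff_fst) contMDiff_snd hs)
    refine h.trans ?_
    simp only [OneForm.pull_pull]
    rw [gauge_apply, pull_const, Ad_zero, add_zero]
    have h2 := mc_mul G.I (f := fun _ : G => p.2) (k := fun g : G => g) contMDiff_const
      contMDiff_id w
    refine h2.trans ?_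
    rw [mc_const, Ad_zero, zero_add]
    exact congrArg (mc G.I) (congrFun tangentMap_id w)
  equivariant g v := by
    have hs : ContMDiff (M.I.prod G.I) (M.I.prod G.I) ∞
        (fun p : M × G => ((p.1, p.2 * g) : M × G)) :=
      contMDiff_fst.prodMk (contMDiff_snd.mul contMDiff_const)
    have h := congrArg (fun β : OneForm (M.I.prod G.I) (M × G) G.E => β v) (pull_gauge G.I
      (α.pull (M := M × G) Prod.fst contMDiff_fst) contMDiff_snd hs)
    rw [OneForm.pull_pull contMDiff_fst hs, ← gauge_gauge G.I (g := fun p : M × G => p.2)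
      (h := fun _ => g) _ contMDiff_snd contMDiff_const] at h
    exact h.trans (gauge_const_apply G.I _ g v)

theorem trivialConnection_pull {N M : Man} (α : OneForm M.I M G.E) (f : N → M)
    (hf : ContMDiff N.I M.I ∞ f) (k : N × G → G) (hk : ContMDiff (N.I.prod G.I) G.I ∞ k) :
    (trivialConnection M α).form.pull (fun p : N × G => ((f p.1, k p) : M × G))
      ((hf.comp contMDiff_fst).prodMk hk) =
    ((α.pull f hf).pull (M := N × G) Prod.fst contMDiff_fst).gauge G.I k hk := by
  refine (pull_gauge G.I (α.pull (M := M × G) Prod.fst contMDiff_fst) contMDiff_snd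
    ((hf.comp contMDiff_fst).prodMk hk)).trans ?_
  refine gauge_congr G.I ?_ (fun _ => rfl) _ _
  rw [OneForm.pull_pull, OneForm.pull_pull]
  rfl

/-- The isomorphism of trivial bundles `(x, h) ↦ (x, g(x)⁻¹ h)` induced by a smooth map
`g : M → G`; it carries the connection `α + θ` to the connection `α · g + θ`. -/
def trivialIso {M : Man} {α β : OneForm M.I M G.E} (g : M → G) (hg : ContMDiff M.I G.I ∞ g)
    (h : β = α.gauge G.I g hg) : trivialConnection M α ⟶ trivialConnection M β where
  toFun p := (p.1, (g p.1)⁻¹ * p.2)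
  invFun p := (p.1, g p.1 * p.2)
  left_inv p := Prod.ext rfl (mul_inv_cancel_left _ _)
  right_inv p := Prod.ext rfl (inv_mul_cancel_left _ _)
  smooth := contMDiff_fst.prodMk ((hg.comp contMDiff_fst).inv.mul contMDiff_snd)
  smooth_inv := contMDiff_fst.prodMk ((hg.comp contMDiff_fst).mul contMDiff_snd)
  proj_toFun _ := rfl
  equivariant p k := Prod.ext rfl (mul_assoc _ _ _).symm
  pull_form := by
    have hk : ContMDiff (M.I.prod G.I) G.I ∞ (fun p : M × G => (g p.1)⁻¹ * p.2) :=
      (hg.comp contMDiff_fst).inv.mul contMDiff_snd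
    refine (trivialConnection_pull β (fun x => x) contMDiff_id _ hk).trans ?_
    rw [OneForm.pull_id, h, pull_gauge G.I α hg contMDiff_fst, gauge_gauge]
    exact gauge_congr G.I rfl (fun p => mul_inv_cancel_left _ _) _ contMDiff_snd

/-- The bundle map `(x, h) ↦ (f x, h)` of trivial bundles, covering `f`. -/
def trivialBundleMap {N M : Man} (f : N ⟶ M) {α : OneForm M.I M G.E} {β : OneForm N.I N G.E}
    (h : α.pull f.toFun f.smooth = β) :
    BundleMap f (trivialConnection N β) (trivialConnection M α) where
  toFun p := (f.toFun p.1, p.2)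
  smooth := (f.smooth.comp contMDiff_fst).prodMk contMDiff_snd
  proj_toFun _ := rfl
  equivariant _ _ := rfl
  pull_form := by
    refine (trivialConnection_pull α f.toFun f.smooth _ contMDiff_snd).trans ?_
    rw [h]; rfl

/-! ### The action groupoid of the gauge action -/

variable (G) in
/-- The objects of the groupoid `B_∇^triv G (M)`: elements of `Ω¹(M; 𝔤)`. -/
structure BTriv (M : Man) : Type 1 where
  form : OneForm M.I M G.E

/-- The arrows `α ⟶ β` of `B_∇^triv G (M)`: smooth maps `g : M → G` with `β = α · g`. -/
structure BTriv.Hom {M : Man} (α β : BTriv G M) : Type 1 where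
  toFun : M → G
  smooth : ContMDiff M.I G.I ∞ toFun
  eq_gauge : β.form = α.form.gauge G.I toFun smooth

theorem BTriv.Hom.ext {M : Man} {α β : BTriv G M} {g h : BTriv.Hom α β}
    (e : ∀ x, g.toFun x = h.toFun x) : g = h := by
  obtain ⟨g, _, _⟩ := g
  obtain ⟨h, _, _⟩ := h
  obtain rfl : g = h := funext e
  rfl

/-- The action groupoid of the group of smooth maps `M → G` acting on `Ω¹(M; 𝔤)` from the right
by gauge transformations; the composition of `g : α ⟶ α · g` and `h : α · g ⟶ α · g · h` is
`g h`. -/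
instance (M : Man) : Groupoid (BTriv G M) where
  Hom := BTriv.Hom
  id α := ⟨fun _ => 1, contMDiff_const, (gauge_one G.I α.form).symm⟩
  comp {α β γ} g h := ⟨fun x => g.toFun x * h.toFun x, g.smooth.mul h.smooth, by
    rw [h.eq_gauge, ← gauge_gauge G.I α.form g.smooth h.smooth, ← g.eq_gauge]⟩
  inv {α β} g := ⟨fun x => (g.toFun x)⁻¹, g.smooth.inv, by
    rw [g.eq_gauge, gauge_gauge]
    exact (gauge_one G.I α.form).symm.trans
      (gauge_congr G.I rfl (fun x => (mul_inv_cancel _).symm) _ _)⟩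
  id_comp _ := BTriv.Hom.ext fun _ => one_mul _
  comp_id _ := BTriv.Hom.ext fun _ => mul_one _
  assoc _ _ _ := BTriv.Hom.ext fun _ => mul_assoc _ _ _
  inv_comp _ := BTriv.Hom.ext fun _ => inv_mul_cancel _
  comp_inv _ := BTriv.Hom.ext fun _ => mul_inv_cancel _

/-- Pullback of forms and gauge transformations along a smooth map. -/
def BTriv.pull {N M : Man} (f : N ⟶ M) : BTriv G M ⥤ BTriv G N where
  obj α := ⟨α.form.pull f.toFun f.smooth⟩
  map {α β} g := ⟨fun y => g.toFun (f.toFun y), g.smooth.comp f.smooth, by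
    rw [g.eq_gauge, pull_gauge]⟩
  map_id _ := rfl
  map_comp _ _ := rfl

theorem BTriv.hom_heq {M : Man} {α β α' β' : BTriv G M} (h1 : α = α') (h2 : β = β')
    {g : α ⟶ β} {g' : α' ⟶ β'} (h : ∀ x, BTriv.Hom.toFun g x = BTriv.Hom.toFun g' x) :
    g ≍ g' := by
  subst h1 h2
  exact heq_of_eq (BTriv.Hom.ext h)

variable (G) in
/-- The sheaf of groupoids `B_∇^triv G`. -/
def bTriv : Manᵒᵖ ⥤ Grpd.{1, 1} where
  obj M := Grpd.of (BTriv G M.unop)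
  map f := BTriv.pull f.unop
  map_id M := by
    have h : ∀ α : BTriv G M.unop, (BTriv.pull (𝟙 M.unop)).obj α = α := fun α =>
      congrArg BTriv.mk (OneForm.pull_id α.form)
    exact Functor.hext h fun α β g => BTriv.hom_heq (h α) (h β) fun _ => rfl
  map_comp {M N K} f k := by
    have h : ∀ α : BTriv G M.unop, (BTriv.pull (f ≫ k).unop).obj α =
        (BTriv.pull k.unop).obj ((BTriv.pull f.unop).obj α) := fun α =>
      congrArg BTriv.mk (OneForm.pull_pull f.unop.smooth k.unop.smooth α.form).symm
    exact Functor.hext h fun α β g => BTriv.hom_heq (h α) (h β) fun _ => rfl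

/-- The functor from the action groupoid to the groupoid of `G`-connections on `M`: it sends `α`
to the trivial bundle with the connection `α + θ`, and `g : α ⟶ α · g` to the induced
isomorphism of trivial bundles. -/
def BTriv.toConnection (M : Man) : BTriv G M ⥤ Connection G M where
  obj α := trivialConnection M α.form
  map g := trivialIso g.toFun g.smooth g.eq_gauge
  map_id _ := Connection.Iso.ext fun p => Prod.ext rfl (by
    show (1 : G)⁻¹ * p.2 = p.2
    simp)
  map_comp {_ _ _} g h := Connection.Iso.ext fun p => Prod.ext rfl (by
    show (BTriv.Hom.toFun g p.1 * BTriv.Hom.toFun h p.1)⁻¹ * p.2 =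
      (BTriv.Hom.toFun h p.1)⁻¹ * ((BTriv.Hom.toFun g p.1)⁻¹ * p.2)
    rw [mul_inv_rev, mul_assoc])

/-! ### The presheaf of groupoids of `G`-connections -/

variable (G) in
/-- A compatible system of `G`-connections on all manifolds over `M`: a `G`-connection `obj X` on
`N` for each smooth map `X : N → M`, and for each map `h : X ⟶ Y` of manifolds over `M` a bundle
map covering `h`, compatibly with identities and compositions (a section over `M` of the category
of `G`-connections, fibred in groupoids over the category of manifolds). Such a system is a
`G`-connection on `M`, its value at `id : M → M`, together with a choice of its pullback along
each `N → M`. -/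
structure BConn (M : Man) : Type 1 where
  obj : ∀ X : Over M, Connection G X.left
  map : ∀ {X Y : Over M} (h : X ⟶ Y), BundleMap h.left (obj X) (obj Y)
  map_id : ∀ (X : Over M) (p : (obj X).total), (map (𝟙 X)).toFun p = p
  map_comp : ∀ {X Y Z : Over M} (h : X ⟶ Y) (k : Y ⟶ Z) (p : (obj X).total),
    (map (h ≫ k)).toFun p = (map k).toFun ((map h).toFun p)

/-- An isomorphism of compatible systems of `G`-connections. -/
structure BConn.Iso {M : Man} (P' P : BConn G M) : Type 1 where
  app : ∀ X : Over M, P'.obj X ⟶ P.obj X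
  naturality : ∀ {X Y : Over M} (h : X ⟶ Y) (p : (P'.obj X).total),
    (app Y).toFun ((P'.map h).toFun p) = (P.map h).toFun ((app X).toFun p)

theorem BConn.Iso.ext {M : Man} {P' P : BConn G M} {φ ψ : BConn.Iso P' P}
    (h : ∀ X, φ.app X = ψ.app X) : φ = ψ := by
  obtain ⟨f, _⟩ := φ
  obtain ⟨g, _⟩ := ψ
  obtain rfl : f = g := funext h
  rfl

instance (M : Man) : Groupoid (BConn G M) where
  Hom := BConn.Iso
  id P := ⟨fun X => 𝟙 (P.obj X), fun _ _ => rfl⟩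
  comp φ ψ := ⟨fun X => φ.app X ≫ ψ.app X, fun {X Y} h p =>
    (congrArg (ψ.app Y).toFun (φ.naturality h p)).trans (ψ.naturality h _)⟩
  inv {P' P} φ := ⟨fun X => Groupoid.inv (φ.app X), fun {X Y} h p => by
    have h1 := φ.naturality h ((φ.app X).invFun p)
    rw [(φ.app X).right_inv] at h1
    show (φ.app Y).invFun _ = (P'.map h).toFun ((φ.app X).invFun p)
    rw [← h1, (φ.app Y).left_inv]⟩
  id_comp _ := BConn.Iso.ext fun _ => Category.id_comp _
  comp_id _ := BConn.Iso.ext fun _ => Category.comp_id _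
  assoc _ _ _ := BConn.Iso.ext fun _ => Category.assoc _ _ _
  inv_comp _ := BConn.Iso.ext fun _ => Groupoid.inv_comp _
  comp_inv _ := BConn.Iso.ext fun _ => Groupoid.comp_inv _

/-- Pullback of systems of `G`-connections along `f : M' → M`: the value at `X : N → M'` of the
pullback is the value at `f ∘ X : N → M`. -/
def BConn.pull {M' M : Man} (f : M' ⟶ M) : BConn G M ⥤ BConn G M' where
  obj P :=
    { obj := fun X => P.obj ((Over.map f).obj X)
      map := fun h => P.map ((Over.map f).map h)
      map_id := fun X p => P.map_id ((Over.map f).obj X) p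
      map_comp := fun h k p => P.map_comp ((Over.map f).map h) ((Over.map f).map k) p }
  map φ := ⟨fun X => φ.app ((Over.map f).obj X), fun h p => φ.naturality ((Over.map f).map h) p⟩
  map_id _ := rfl
  map_comp _ _ := rfl

variable (G) in
/-- The presheaf of groupoids `B_∇ G`. -/
def bConn : Manᵒᵖ ⥤ Grpd.{1, 1} where
  obj M := Grpd.of (BConn G M.unop)
  map f := BConn.pull f.unop
  map_id _ := rfl
  map_comp _ _ := rfl

/-- The system of trivial bundles determined by a compatible system of `1`-forms. -/
def BConn.ofForms {M : Man} (a : ∀ X : Over M, OneForm X.left.I X.left G.E)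
    (ha : ∀ {X Y : Over M} (h : X ⟶ Y), (a Y).pull h.left.toFun h.left.smooth = a X) :
    BConn G M where
  obj X := trivialConnection X.left (a X)
  map h := trivialBundleMap h.left (ha h)
  map_id _ _ := rfl
  map_comp _ _ _ := rfl

theorem BConn.ofForms_congr {M : Man} {a a' : ∀ X : Over M, OneForm X.left.I X.left G.E}
    {ha : ∀ {X Y : Over M} (h : X ⟶ Y), (a Y).pull h.left.toFun h.left.smooth = a X}
    {ha' : ∀ {X Y : Over M} (h : X ⟶ Y), (a' Y).pull h.left.toFun h.left.smooth = a' X}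
    (e : a = a') : BConn.ofForms a ha = BConn.ofForms a' ha' := by
  subst e
  rfl

/-- The isomorphism of systems of trivial bundles determined by a compatible system of gauge
transformations. -/
def BConn.ofGauge {M : Man} {a b : ∀ X : Over M, OneForm X.left.I X.left G.E}
    {ha : ∀ {X Y : Over M} (h : X ⟶ Y), (a Y).pull h.left.toFun h.left.smooth = a X}
    {hb : ∀ {X Y : Over M} (h : X ⟶ Y), (b Y).pull h.left.toFun h.left.smooth = b X}
    (g : ∀ X : Over M, X.left ⟶ G)
    (hg : ∀ {X Y : Over M} (h : X ⟶ Y) (x : X.left),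
      (g Y).toFun (h.left.toFun x) = (g X).toFun x)
    (hab : ∀ X, b X = (a X).gauge G.I (g X).toFun (g X).smooth) :
    BConn.ofForms a ha ⟶ BConn.ofForms b hb where
  app X := trivialIso (g X).toFun (g X).smooth (hab X)
  naturality {_ _} h p := Prod.ext rfl (congrArg (fun x : G => x⁻¹ * p.2) (hg h p.1))

theorem BConn.ofGauge_heq {M : Man} {a b a' b' : ∀ X : Over M, OneForm X.left.I X.left G.E}
    {ha : ∀ {X Y : Over M} (h : X ⟶ Y), (a Y).pull h.left.toFun h.left.smooth = a X}
    {hb : ∀ {X Y : Over M} (h : X ⟶ Y), (b Y).pull h.left.toFun h.left.smooth = b X}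
    {ha' : ∀ {X Y : Over M} (h : X ⟶ Y), (a' Y).pull h.left.toFun h.left.smooth = a' X}
    {hb' : ∀ {X Y : Over M} (h : X ⟶ Y), (b' Y).pull h.left.toFun h.left.smooth = b' X}
    (ea : a = a') (eb : b = b') (g : ∀ X : Over M, X.left ⟶ G)
    (hg : ∀ {X Y : Over M} (h : X ⟶ Y) (x : X.left),
      (g Y).toFun (h.left.toFun x) = (g X).toFun x)
    (hab : ∀ X, b X = (a X).gauge G.I (g X).toFun (g X).smooth)
    (hab' : ∀ X, b' X = (a' X).gauge G.I (g X).toFun (g X).smooth) :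
    BConn.ofGauge (ha := ha) (hb := hb) g hg hab ≍
      BConn.ofGauge (ha := ha') (hb := hb') g hg hab' := by
  subst ea eb
  rfl

theorem OneForm.pull_over {M : Man} (α : OneForm M.I M G.E) {X Y : Over M} (h : X ⟶ Y) :
    (α.pull Y.hom.toFun Y.hom.smooth).pull h.left.toFun h.left.smooth =
      α.pull X.hom.toFun X.hom.smooth := by
  rw [OneForm.pull_pull]
  exact pull_congr _ (fun x => congrArg (fun k => Man.Hom.toFun k x) (Over.w h)) _ _

/-- The system of trivial bundles with the connections `f^*α + θ`, for `f : N → M`. -/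
def BTriv.toBConn (M : Man) : BTriv G M ⥤ BConn G M where
  obj α := BConn.ofForms (fun X => α.form.pull X.hom.toFun X.hom.smooth) 
    (fun h => α.form.pull_over h)
  map {α β} g := BConn.ofGauge (fun X => X.hom ≫ ⟨g.toFun, g.smooth⟩)
    (fun {X Y} h x => congrArg g.toFun (congrArg (fun k => Man.Hom.toFun k x) (Over.w h)))
    (fun X => by rw [g.eq_gauge, pull_gauge]; rfl)
  map_id α := BConn.Iso.ext fun X => (BTriv.toConnection X.left).map_id _
  map_comp g h := BConn.Iso.ext fun X =>
    (BTriv.toConnection X.left).map_comp ((BTriv.pull X.hom).map g) ((BTriv.pull X.hom).map h)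

variable (G) in
/-- The map `ψ : B_∇^triv G → B_∇ G` of presheaves of groupoids. -/
def psi : bTriv G ⟶ bConn G where
  app M := BTriv.toBConn M.unop
  naturality {M N} f := by
    have h : ∀ α : BTriv G M.unop,
        (fun X : Over N.unop => (α.form.pull f.unop.toFun f.unop.smooth).pull
          X.hom.toFun X.hom.smooth) =
        fun X : Over N.unop => α.form.pull ((Over.map f.unop).obj X).hom.toFun
          ((Over.map f.unop).obj X).hom.smooth :=
      fun α => funext fun X => OneForm.pull_pull f.unop.smooth X.hom.smooth α.form
    refine Functor.hext (fun α => ?_) fun α β g => ?_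
    · exact BConn.ofForms_congr
        (ha := fun k => (α.form.pull f.unop.toFun f.unop.smooth).pull_over k)
        (ha' := fun k => α.form.pull_over ((Over.map f.unop).map k)) (h α)
    · exact BConn.ofGauge_heq
        (ha := fun k => (α.form.pull f.unop.toFun f.unop.smooth).pull_over k)
        (hb := fun k => (β.form.pull f.unop.toFun f.unop.smooth).pull_over k)
        (ha' := fun k => α.form.pull_over ((Over.map f.unop).map k))
        (hb' := fun k => β.form.pull_over ((Over.map f.unop).map k))
        (h α) (h β) (fun X => X.hom ≫ f.unop ≫ ⟨g.toFun, g.smooth⟩)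
        (fun {X Y} k x => congrArg (fun y => g.toFun (f.unop.toFun y))
          (congrArg (fun k => Man.Hom.toFun k x) (Over.w k)))
        (fun X => by rw [g.eq_gauge, pull_gauge, pull_gauge]; rfl)
        (fun X => by rw [g.eq_gauge, pull_gauge]; rfl)

end Bundles

/-! ### Simplicial presheaves and weak equivalences -/

section Homotopy

/-- The map `π₀ X → π₀ Y` induced by a continuous map. -/
def mapPi0 {X Y : Type*} [TopologicalSpace X] [TopologicalSpace Y] (f : C(X, Y)) :
    ZerothHomotopy X → ZerothHomotopy Y :=
  ZerothHomotopy.lift (fun x => ZerothHomotopy.mk (f x)) fun _ _ p =>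
    ZerothHomotopy.sound (p.map f.continuous)

/-- The map `π_n(X, x) → π_n(Y, f x)` induced by a continuous map. -/
def mapPi (n : ℕ) {X Y : Type*} [TopologicalSpace X] [TopologicalSpace Y] (f : C(X, Y)) (x : X) :
    HomotopyGroup (Fin n) X x → HomotopyGroup (Fin n) Y (f x) :=
  Quotient.map (fun γ => ⟨f.comp γ.1, fun y hy => congrArg f (γ.2 y hy)⟩)
    fun _ _ h => ContinuousMap.HomotopicRel.comp_continuousMap h f

/-- Weak homotopy equivalences of topological spaces. -/
structure IsWeakHomotopyEquiv {X Y : Type*} [TopologicalSpace X] [TopologicalSpace Y]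
    (f : C(X, Y)) : Prop where
  bijective_mapPi0 : Function.Bijective (mapPi0 f)
  bijective_mapPi : ∀ n : ℕ, 0 < n → ∀ x : X, Function.Bijective (mapPi n f x)

/-- A map of simplicial sets is a weak equivalence if its geometric realization is a weak homotopy
equivalence. -/
def IsWeakEquivSSet {S T : SSet.{1}} (f : S ⟶ T) : Prop :=
  IsWeakHomotopyEquiv (SSet.toTop.map f).hom

/-- The `m`-dimensional stalk of a simplicial presheaf on manifolds: the colimit, as `r → 0`, of
its values on the balls of radius `r` in `ℝ^m`. -/
def stalk (m : ℕ) (F : Manᵒᵖ ⥤ SSet.{1}) : SSet.{1} :=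
  Limits.colimit ((ballFunctor m).op ⋙ F)

/-- The map of stalks induced by a map of simplicial presheaves. -/
def stalkMap (m : ℕ) {F F' : Manᵒᵖ ⥤ SSet.{1}} (f : F ⟶ F') : stalk m F ⟶ stalk m F' :=
  Limits.colimMap (Functor.whiskerLeft (ballFunctor m).op f)

/-- A map of simplicial presheaves on manifolds is a weak equivalence if the induced maps of
`m`-dimensional stalks are weak equivalences of simplicial sets for all `m`. -/
def IsWeakEquiv {F F' : Manᵒᵖ ⥤ SSet.{1}} (f : F ⟶ F') : Prop :=
  ∀ m : ℕ, IsWeakEquivSSet (stalkMap m f)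

/-- The functor sending a groupoid to the associated simplicial set, its nerve. -/
def groupoidNerve : Grpd.{1, 1} ⥤ SSet.{1} := Grpd.forgetToCat ⋙ nerveFunctor

end Homotopy

end GConn

end

open GConn
open scoped Manifold ContDiff

/-! Over a ball every principal bundle has a smooth section `s`. It identifies a connection `(P, Θ)`
with the trivial bundle carrying `s^*Θ + θ`, by `(x, h) ↦ s(x) h`; this is essential surjectivity.
An isomorphism of trivial bundles is left multiplication by a function `k : M → G`, and comparing
the forms along the unit section shows that `k⁻¹` is a gauge transformation; this is full
faithfulness, over any base. The Leibniz rule for the action (`Connection.form_pull_act`) is the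
computation behind the first claim.

The section does not use the connection. The ball is diffeomorphic to `ℝ^m`, and two lifts of a map
defined on `ℝ^m` are glued by multiplying the second with their difference, a `G`-valued function on
the overlap which is extended by composing with a smooth retraction (`IsLiftOn.glue`). A box is
treated by cutting it into small boxes, and `ℝ^m` by exhausting it with balls.

For chosen pullbacks, bundle maps are bijective on fibres, so two bundle maps covering the same map
with the same target differ by a unique isomorphism (`BundleMap.lift`). As `id : M → M` is terminal
among the manifolds over `M`, evaluation there is fully faithful, and the statement for `B_∇ G`
reduces to the one for connections.

The stalk map is a directed colimit of nerves of equivalences of groupoids. Three properties are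
isolated: `HasTransport` of the target, `LiftsSimplices` and `ReachesVertices` of the map. Each
instance of them concerns finitely many simplices, so they survive directed colimits. Together they
produce a homotopy inverse by `exists_doubleHomotopy_inverse`: choose edges from the image to the
vertices of the target, and uniqueness makes all further constructions natural. The homotopies
assign to an `n`-simplex a simplex of shape `[n] ⋆ [n]`; on realizations they become paths running
from the first half to the second. It remains that homotopy equivalences induce bijections on `π_n`,
where the base point moves and the loops are transported by collars. -/

noncomputable section

namespace GConn

/-! ### Homotopy equivalences are weak homotopy equivalences -/

section HomotopyEquivalences

open scoped unitInterval Topology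

variable {n : ℕ} {X Y : Type*} [TopologicalSpace X] [TopologicalSpace Y]

/-- The distance of a point of the cube from its centre, normalized to be `1` on the boundary. -/
def centreDist (s : Fin n → I) : ℝ := ‖fun i => 2 * (s i : ℝ) - 1‖

/-- Scaling the cube about its centre by the factor `c`, followed by the projection to the cube. -/
def cubeScale (c : ℝ) (s : Fin n → I) : Fin n → I := fun i =>
  Set.projIcc 0 1 zero_le_one (1 / 2 + c * ((s i : ℝ) - 1 / 2))

theorem continuous_centreDist : Continuous (centreDist (n := n)) := by
  unfold centreDist
  fun_prop

theorem continuous_cubeScale : Continuous fun p : ℝ × (Fin n → I) => cubeScale p.1 p.2 := by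
  unfold cubeScale
  refine continuous_pi fun i => continuous_projIcc.comp ?_
  fun_prop

theorem cubeScale_one (s : Fin n → I) : cubeScale 1 s = s := by
  funext i
  have h : (1 / 2 + 1 * ((s i : ℝ) - 1 / 2)) = s i := by ring
  simp only [cubeScale, h]
  exact Set.projIcc_val _ _

theorem centreDist_nonneg (s : Fin n → I) : 0 ≤ centreDist s := norm_nonneg _

theorem centreDist_le_one (s : Fin n → I) : centreDist s ≤ 1 := by
  refine (pi_norm_le_iff_of_nonneg zero_le_one).2 fun i => ?_
  rw [Real.norm_eq_abs, abs_le]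
  have := (s i).2.1
  have := (s i).2.2
  constructor <;> linarith

theorem centreDist_of_mem_boundary {s : Fin n → I} (hs : s ∈ Cube.boundary (Fin n)) :
    centreDist s = 1 := by
  refine le_antisymm (centreDist_le_one s) ?_
  obtain ⟨i, hi⟩ := hs
  refine le_trans ?_ (norm_le_pi_norm (fun i => 2 * (s i : ℝ) - 1) i)
  rcases hi with hi | hi <;> simp [hi]
  norm_num

/-- Before the projection to the cube, the scaled point has normalized distance `c * centreDist s`
from the centre. Once this is at least `1`, some coordinate has left `(0, 1)` and is clamped to `0`
or `1`. -/
theorem cubeScale_mem_boundary {c : ℝ} (hc : 0 ≤ c) {s : Fin n → I} (h : 1 ≤ c * centreDist s) :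
    cubeScale c s ∈ Cube.boundary (Fin n) := by
  by_contra hn
  simp only [Cube.boundary, Set.mem_ofPred_eq, not_exists, not_or] at hn
  refine absurd h (not_le.2 ?_)
  have e : c * centreDist s = ‖c • fun i => 2 * (s i : ℝ) - 1‖ := by
    rw [norm_smul, Real.norm_of_nonneg hc, centreDist]
  rw [e, pi_norm_lt_iff zero_lt_one]
  intro i
  simp only [Pi.smul_apply, smul_eq_mul, Real.norm_eq_abs]
  by_contra h1
  rw [abs_lt, not_and_or, not_lt, not_lt] at h1
  rcases h1 with h1 | h1
  · exact (hn i).1 (Set.projIcc_of_le_left _ (by linarith))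
  · exact (hn i).2 (Set.projIcc_of_right_le _ (by linarith))

/-- Homotopies given by formulas in a real time parameter, which spares membership proofs in the
unit interval. -/
theorem homotopicRel_of_real {f g : C(Fin n → I, X)} {S : Set (Fin n → I)}
    (F : ℝ → (Fin n → I) → X) (hF : Continuous fun p : ℝ × (Fin n → I) => F p.1 p.2)
    (h0 : ∀ s, F 0 s = f s) (h1 : ∀ s, F 1 s = g s)
    (hS : ∀ t : I, ∀ s ∈ S, F t s = f s) : f.HomotopicRel g S :=
  ⟨{ toFun := fun p => F p.1 p.2
     continuous_toFun := hF.comp (continuous_subtype_val.prodMap continuous_id)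
     map_zero_left := h0
     map_one_left := h1
     prop' := fun t s hs => hS t s hs }⟩

/-- At distance `1 / 2` the inner cube ends on its boundary, where `D` equals `P a 1`, and the
collar parameter `2 - 2 * (1 / 2)` is `1`, so the two formulas agree. The parameter space `A` is a
point for single loops and the time axis for homotopies. -/
theorem continuous_collar {A : Type*} [TopologicalSpace A] (P : A → ℝ → X)
    (D : A → (Fin n → I) → X) (hP : Continuous fun q : A × ℝ => P q.1 q.2)
    (hD : Continuous fun q : A × (Fin n → I) => D q.1 q.2)
    (h : ∀ a, ∀ s ∈ Cube.boundary (Fin n), D a s = P a 1) :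
    Continuous fun q : A × (Fin n → I) => if centreDist q.2 ≤ 1 / 2 then D q.1 (cubeScale 2 q.2)
      else P q.1 (2 - 2 * centreDist q.2) := by
  have hd : Continuous fun q : A × (Fin n → I) => centreDist q.2 :=
    continuous_centreDist.comp continuous_snd
  refine Continuous.if_le ?_ ?_ hd continuous_const ?_
  · exact hD.comp (continuous_fst.prodMk (continuous_cubeScale.comp
      (continuous_const.prodMk continuous_snd)))
  · exact hP.comp (continuous_fst.prodMk (by fun_prop))
  · intro q hq
    rw [h _ _ (cubeScale_mem_boundary zero_le_two (by rw [hq]; norm_num)), hq]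
    norm_num

/-- Transport of a generalized loop along a path from `x₀` to the base point `x₁`: the loop fills
the cube of half the size, and the path the collar around it. -/
def collar (p : ℝ → X) (hp : Continuous p) {x₀ x₁ : X} (h0 : p 0 = x₀) (h1 : p 1 = x₁)
    (δ : GenLoop (Fin n) X x₁) : GenLoop (Fin n) X x₀ :=
  ⟨⟨fun s => if centreDist s ≤ 1 / 2 then δ (cubeScale 2 s) else p (2 - 2 * centreDist s),
    (continuous_collar (A := Unit) (fun _ => p) (fun _ => δ) (hp.comp continuous_snd)
      (δ.1.continuous.comp continuous_snd) (fun _ s hs => (δ.2 s hs).trans h1.symm)).comp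
      (continuous_const (y := ()).prodMk continuous_id)⟩, fun s hs => by
    have e := centreDist_of_mem_boundary hs
    simp only [ContinuousMap.coe_mk, e]
    norm_num [h0]⟩

theorem collar_apply (p : ℝ → X) (hp : Continuous p) {x₀ x₁ : X} (h0 : p 0 = x₀) (h1 : p 1 = x₁)
    (δ : GenLoop (Fin n) X x₁) (s : Fin n → I) : (collar p hp h0 h1 δ).1 s =
      if centreDist s ≤ 1 / 2 then δ.1 (cubeScale 2 s) else p (2 - 2 * centreDist s) := rfl

/-- The homotopy runs in the inner cube while the collar stays fixed; the two keep matching because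
the homotopy is relative to the boundary. -/
theorem collar_homotopic (p : ℝ → X) (hp : Continuous p) {x₀ x₁ : X} (h0 : p 0 = x₀)
    (h1 : p 1 = x₁) {δ δ' : GenLoop (Fin n) X x₁} (h : GenLoop.Homotopic δ δ') :
    GenLoop.Homotopic (collar p hp h0 h1 δ) (collar p hp h0 h1 δ') := by
  obtain ⟨F⟩ := h
  refine homotopicRel_of_real (fun t s => if centreDist s ≤ 1 / 2 then
    F (Set.projIcc 0 1 zero_le_one t, cubeScale 2 s) else p (2 - 2 * centreDist s)) ?_ ?_ ?_ ?_
  · refine continuous_collar (A := ℝ) (fun _ => p) (fun t s => F (Set.projIcc 0 1 zero_le_one t, s))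
      (hp.comp continuous_snd) (F.continuous.comp
        ((continuous_projIcc.comp continuous_fst).prodMk continuous_snd)) fun t s hs => ?_
    exact (F.eq_fst _ hs).trans ((δ.2 s hs).trans h1.symm)
  · intro s
    simp only [Set.projIcc_left, collar_apply]
    exact if_congr Iff.rfl (F.apply_zero _) rfl
  · intro s
    simp only [Set.projIcc_right, collar_apply]
    exact if_congr Iff.rfl (F.apply_one _) rfl
  · intro t s hs
    have e := centreDist_of_mem_boundary hs
    rw [collar_apply, e]
    norm_num

/-- Magnify the cube by `1 + t`. At `t = 1` everything outside the half-size cube is clamped to the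
boundary, where `δ` has the constant value `x`. -/
theorem homotopic_collar_const {x : X} (δ : GenLoop (Fin n) X x) :
    GenLoop.Homotopic δ (collar (fun _ => x) continuous_const rfl rfl δ) := by
  refine homotopicRel_of_real (fun t s => δ.1 (cubeScale (1 + t) s)) ?_ ?_ ?_ ?_
  · exact δ.1.continuous.comp (continuous_cubeScale.comp
      (f := fun q : ℝ × (Fin n → I) => (1 + q.1, q.2)) (by fun_prop))
  · intro s; simp only [add_zero, cubeScale_one]
  · intro s
    rw [collar_apply]
    split_ifs with h
    · norm_num
    · refine δ.2 _ (cubeScale_mem_boundary (by norm_num) ?_)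
      linarith
  · intro t s hs
    rw [δ.2 s hs]
    refine δ.2 _ (cubeScale_mem_boundary (by linarith [t.2.1]) ?_)
    rw [centreDist_of_mem_boundary hs]
    linarith [t.2.1]

/-- The outer collar runs along the reverse of the inner one, so both can be shrunk simultaneously
to their common end `x₁`; two constant collars change nothing up to homotopy. -/
theorem collar_collar_homotopic (p q : ℝ → X) (hp : Continuous p) (hq : Continuous q) {x₀ x₁ : X}
    (h0 : p 0 = x₀) (h1 : p 1 = x₁) (h0' : q 0 = x₁) (h1' : q 1 = x₀) (hpq : ∀ t, q t = p (1 - t))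
    (δ : GenLoop (Fin n) X x₁) :
    GenLoop.Homotopic (collar q hq h0' h1' (collar p hp h0 h1 δ)) δ := by
  have step1 := homotopic_collar_const δ
  -- At stage `u` only the part of `p` from time `1 - u` to `1` is traversed: `u = 0` gives the
  -- constant path at `x₁`, `u = 1` gives `p`. Below, `min u 1 ⊔ 0` clamps the real time `u`,
  -- because `r u 1 = p 1` needs `u ≥ 0`.
  let r : ℝ → ℝ → X := fun u t => p (max t (1 - u))
  have hr : Continuous fun w : ℝ × ℝ => r w.1 w.2 := by
    simp only [r]
    exact hp.comp (by fun_prop)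
  have step2 : GenLoop.Homotopic (collar (fun _ => x₁) continuous_const rfl rfl
      (collar (fun _ => x₁) continuous_const rfl rfl δ))
      (collar q hq h0' h1' (collar p hp h0 h1 δ)) := by
    refine homotopicRel_of_real (fun u s => if centreDist s ≤ 1 / 2 then
      (if centreDist (cubeScale 2 s) ≤ 1 / 2 then δ.1 (cubeScale 2 (cubeScale 2 s)) else
        r (min u 1 ⊔ 0) (2 - 2 * centreDist (cubeScale 2 s))) else
        r (min u 1 ⊔ 0) (1 - (2 - 2 * centreDist s))) ?_ ?_ ?_ ?_
    · refine continuous_collar (A := ℝ) (fun u t => r (min u 1 ⊔ 0) (1 - t))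
        (fun u s => if centreDist s ≤ 1 / 2 then δ.1 (cubeScale 2 s) else
          r (min u 1 ⊔ 0) (2 - 2 * centreDist s))
        (hr.comp (f := fun q : ℝ × ℝ => (min q.1 1 ⊔ 0, 1 - q.2)) (by fun_prop))
        (continuous_collar (A := ℝ) (fun u t => r (min u 1 ⊔ 0) t) (fun _ => δ.1)
          (hr.comp (f := fun q : ℝ × ℝ => (min q.1 1 ⊔ 0, q.2)) (by fun_prop))
          (δ.1.continuous.comp continuous_snd) ?_) ?_
      · intro u s hs
        rw [δ.2 s hs, ← h1]
        have : (1 : ℝ) ≥ 1 - (min u 1 ⊔ 0) := by linarith [le_max_right (min u 1) 0]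
        simp only [r, max_eq_left this]
      · intro u s hs
        simp only [centreDist_of_mem_boundary hs]
        norm_num
    · intro s
      have a : centreDist (cubeScale 2 s) ≤ 1 := centreDist_le_one _
      have b : centreDist s ≤ 1 := centreDist_le_one _
      have c := centreDist_nonneg (cubeScale 2 s)
      simp only [collar_apply, r]
      split_ifs with h h'
      · rfl
      · rw [← h1]; congr 1; norm_num; linarith
      · rw [← h1]; congr 1; norm_num; linarith
    · intro s
      have a : centreDist (cubeScale 2 s) ≤ 1 := centreDist_le_one _
      have b : centreDist s ≤ 1 := centreDist_le_one _
      simp only [collar_apply, r]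
      split_ifs with h h'
      · rfl
      · congr 1; norm_num; linarith
      · rw [hpq]; congr 1; norm_num; linarith
    · intro t s hs
      simp only [collar_apply, centreDist_of_mem_boundary hs, r, ← h1]
      have : (1 : ℝ) ≥ 1 - (min (t : ℝ) 1 ⊔ 0) := by linarith [le_max_right (min (t : ℝ) 1) 0]
      norm_num
  exact (step1.trans ((collar_homotopic _ _ _ _ step1).trans step2)).symm

/-- The action of a continuous map on generalized loops. -/
def mapGenLoop (f : C(X, Y)) {x : X} {y : Y} (h : f x = y) (γ : GenLoop (Fin n) X x) :
    GenLoop (Fin n) Y y := ⟨f.comp γ.1, fun s hs => (congrArg f (γ.2 s hs)).trans h⟩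

/-- At time `u` the inner cube carries `H u ∘ γ` and the collar the track of `x` from time `0` to
time `u`. For `u = 0` the collar is constant. -/
theorem homotopic_collar_mapGenLoop (H : ℝ → X → X) (hH : Continuous fun q : ℝ × X => H q.1 q.2)
    (h0 : ∀ x, H 0 x = x) (k : C(X, X)) (h1 : ∀ x, H 1 x = k x) (x : X)
    (γ : GenLoop (Fin n) X x) :
    GenLoop.Homotopic γ (collar (fun t => H t x)
      (hH.comp (f := fun t : ℝ => (t, x)) (by fun_prop)) (h0 x) (h1 x)
      (mapGenLoop k rfl γ)) := by
  refine (homotopic_collar_const γ).trans (homotopicRel_of_real (fun u s => if centreDist s ≤ 1 / 2 then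
    H u (γ.1 (cubeScale 2 s)) else H (u * (2 - 2 * centreDist s)) x) ?_ ?_ ?_ ?_)
  · refine continuous_collar (A := ℝ) (fun u t => H (u * t) x) (fun u s => H u (γ.1 s))
      (hH.comp (f := fun q : ℝ × ℝ => (q.1 * q.2, x)) (by fun_prop))
      (hH.comp (f := fun q : ℝ × (Fin n → I) => (q.1, γ.1 q.2)) (by fun_prop)) ?_
    intro u s hs
    rw [γ.2 s hs, mul_one]
  · intro s
    rw [collar_apply]
    simp only [h0, zero_mul]
  · intro s
    rw [collar_apply]
    simp only [h1, one_mul]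
    rfl
  · intro t s hs
    rw [collar_apply, centreDist_of_mem_boundary hs]
    norm_num [h0]

/-- A continuous map which is homotopic to the identity induces bijections of homotopy groups. -/
theorem bijective_mapPi_of_homotopic_id (k : C(X, X)) (h : (ContinuousMap.id X).Homotopic k)
    (x : X) : Function.Bijective (mapPi n k x) := by
  obtain ⟨F⟩ := h
  let H : ℝ → X → X := fun t x => F (Set.projIcc 0 1 zero_le_one t, x)
  have hH : Continuous fun q : ℝ × X => H q.1 q.2 :=
    F.continuous.comp ((continuous_projIcc.comp continuous_fst).prodMk continuous_snd)
  have h0 : ∀ x, H 0 x = x := fun x => by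
    simp only [H, Set.projIcc_left]; exact F.apply_zero x
  have h1 : ∀ x, H 1 x = k x := fun x => by
    simp only [H, Set.projIcc_right]; exact F.apply_one x
  have key := homotopic_collar_mapGenLoop (n := n) H hH h0 k h1 x
  have hp : Continuous fun t => H t x := hH.comp (f := fun t : ℝ => (t, x)) (by fun_prop)
  constructor
  · intro a b
    refine Quotient.inductionOn₂ a b fun γ γ' e => Quotient.sound ?_
    have e' : GenLoop.Homotopic (mapGenLoop k rfl γ) (mapGenLoop k rfl γ') := Quotient.exact e
    exact (key γ).trans ((collar_homotopic _ hp _ _ e').trans (key γ').symm)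
  · intro b
    refine Quotient.inductionOn b fun δ => ?_
    -- The preimage is `δ` carried back along the track of `x`. By `key`, collaring `k ∘ γ` gives
    -- `γ` up to homotopy, so removing the collar on both sides with the reversed path gives `k ∘ γ
    -- ≃ δ`.
    let γ := collar (fun t => H t x) hp (h0 x) (h1 x) δ
    refine ⟨⟦γ⟧, Quotient.sound ?_⟩
    have hq : Continuous fun t => H (1 - t) x :=
      hH.comp (f := fun t : ℝ => (1 - t, x)) (by fun_prop)
    have q0 : H (1 - 0) x = k x := by rw [sub_zero, h1]
    have q1 : H (1 - 1) x = x := by rw [sub_self, h0]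
    have inv := fun δ' : GenLoop (Fin n) X (k x) => collar_collar_homotopic (fun t => H t x)
      (fun t => H (1 - t) x) hp hq (h0 x) (h1 x) q0 q1 (fun _ => rfl) δ'
    exact (inv (mapGenLoop k rfl γ)).symm.trans
      ((collar_homotopic _ hq q0 q1 (key γ).symm).trans (inv δ))

theorem mapPi0_eq_of_homotopic {f g : C(X, Y)} (h : f.Homotopic g) : mapPi0 f = mapPi0 g := by
  obtain ⟨F⟩ := h
  funext a
  induction a using ZerothHomotopy.rec with
  | _ x => exact ZerothHomotopy.sound (F.evalAt x)

theorem mapPi_comp (f : C(X, Y)) {Z : Type*} [TopologicalSpace Z] (g : C(Y, Z)) (x : X) :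
    mapPi n (g.comp f) x = mapPi n g (f x) ∘ mapPi n f x :=
  funext (Quotient.ind fun _ => rfl)

theorem mapPi0_bijective_of_homotopic_id (k : C(X, X)) (h : (ContinuousMap.id X).Homotopic k) :
    Function.Bijective (mapPi0 k) := by
  rw [← mapPi0_eq_of_homotopic h]
  have : mapPi0 (ContinuousMap.id X) = id := funext fun a => by
    induction a using ZerothHomotopy.rec with
    | _ x => rfl
  rw [this]
  exact Function.bijective_id

theorem mapPi0_comp (f : C(X, Y)) {Z : Type*} [TopologicalSpace Z] (g : C(Y, Z)) :
    mapPi0 (g.comp f) = mapPi0 g ∘ mapPi0 f := funext fun a => by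
  induction a using ZerothHomotopy.rec with
  | _ x => rfl

/-- A homotopy equivalence is a weak homotopy equivalence. -/
theorem isWeakHomotopyEquiv_of_homotopic (f : C(X, Y)) (g : C(Y, X))
    (hgf : (ContinuousMap.id X).Homotopic (g.comp f))
    (hfg : (ContinuousMap.id Y).Homotopic (f.comp g)) : IsWeakHomotopyEquiv f where
  bijective_mapPi0 := by
    have a := mapPi0_bijective_of_homotopic_id _ hgf
    have b := mapPi0_bijective_of_homotopic_id _ hfg
    rw [mapPi0_comp] at a b
    exact ⟨a.injective.of_comp, b.surjective.of_comp⟩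
  bijective_mapPi n _ x := by
    have a := bijective_mapPi_of_homotopic_id (n := n) _ hgf x
    have b := bijective_mapPi_of_homotopic_id (n := n) _ hfg (f x)
    rw [mapPi_comp] at a b
    -- The map induced by `f` occurs at the two base points `x` and `g (f x)`, whereas that of `g`
    -- at `f x` occurs in both composites: it is injective by the second and surjective by the
    -- first.
    have hg : Function.Bijective (mapPi n g (f x)) :=
      ⟨b.injective.of_comp, a.surjective.of_comp⟩
    exact (Function.Bijective.of_comp_iff' hg _).1 a

end HomotopyEquivalences

end GConn

end

noncomputable section

namespace GConn

/-! ### Simplicial maps which are homotopic through doubled simplices -/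

section Doubling

open Opposite

open scoped unitInterval Simplicial

universe u

/-- The map `θ ⋆ θ` of ordinals, as a function. -/
def doubleFun {a b : ℕ} (θ : Fin a → Fin b) (i : Fin (a + a)) : Fin (b + b) :=
  Fin.addCases (motive := fun _ => Fin (b + b)) (fun i => Fin.castAdd b (θ i))
    (fun i => Fin.natAdd b (θ i)) i

theorem doubleFun_castAdd {a b : ℕ} (θ : Fin a → Fin b) (i : Fin a) :
    doubleFun θ (Fin.castAdd a i) = Fin.castAdd b (θ i) := by
  simp only [doubleFun, Fin.addCases_left]

theorem doubleFun_natAdd {a b : ℕ} (θ : Fin a → Fin b) (i : Fin a) :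
    doubleFun θ (Fin.natAdd a i) = Fin.natAdd b (θ i) := by
  simp only [doubleFun, Fin.addCases_right]

/-- The map `θ ⋆ θ` of ordinals. -/
def doubleHom {a b : ℕ} (θ : Fin a →o Fin b) : Fin (a + a) →o Fin (b + b) where
  toFun := doubleFun θ
  monotone' := by
    refine Fin.addCases (fun i => ?_) (fun i => ?_) <;>
      refine Fin.addCases (fun j => ?_) (fun j => ?_) <;> intro h
    · rw [doubleFun_castAdd, doubleFun_castAdd]
      exact θ.monotone h
    · rw [doubleFun_castAdd, doubleFun_natAdd]
      exact Fin.le_def.2 (by simp only [Fin.val_castAdd, Fin.val_natAdd]; lia)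
    · have := Fin.le_def.1 h
      simp only [Fin.val_castAdd, Fin.val_natAdd] at this
      lia
    · rw [doubleFun_natAdd, doubleFun_natAdd]
      have h' := Fin.le_def.1 h
      simp only [Fin.val_natAdd] at h'
      have := θ.monotone (show i ≤ j from Fin.le_def.2 (by lia))
      exact Nat.add_le_add_left this _

theorem doubleHom_castAdd {a b : ℕ} (θ : Fin a →o Fin b) (i : Fin a) :
    doubleHom θ (Fin.castAdd a i) = Fin.castAdd b (θ i) := doubleFun_castAdd θ i

theorem doubleHom_natAdd {a b : ℕ} (θ : Fin a →o Fin b) (i : Fin a) :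
    doubleHom θ (Fin.natAdd a i) = Fin.natAdd b (θ i) := doubleFun_natAdd θ i

/-- The ordinal `[n] ⋆ [n]`. -/
def doubleObj (Δ : SimplexCategory) : SimplexCategory := .mk (Δ.len + 1 + Δ.len)

/-- The first half of `[n] ⋆ [n]`. -/
def fstHalf (Δ : SimplexCategory) : Δ ⟶ doubleObj Δ :=
  SimplexCategory.Hom.mk ⟨Fin.castAdd (Δ.len + 1), fun _ _ h => h⟩

/-- The second half of `[n] ⋆ [n]`. -/
def sndHalf (Δ : SimplexCategory) : Δ ⟶ doubleObj Δ :=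
  SimplexCategory.Hom.mk ⟨Fin.natAdd (Δ.len + 1), fun _ _ h => Nat.add_le_add_left h _⟩

/-- The map `θ ⋆ θ`. -/
def doubleMap {Δ Δ' : SimplexCategory} (θ : Δ ⟶ Δ') : doubleObj Δ ⟶ doubleObj Δ' :=
  SimplexCategory.Hom.mk (doubleHom θ.toOrderHom)

theorem fstHalf_doubleMap {Δ Δ' : SimplexCategory} (θ : Δ ⟶ Δ') :
    fstHalf Δ ≫ doubleMap θ = θ ≫ fstHalf Δ' :=
  SimplexCategory.Hom.ext _ _ (OrderHom.ext _ _ (funext fun i => doubleHom_castAdd θ.toOrderHom i))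

theorem sndHalf_doubleMap {Δ Δ' : SimplexCategory} (θ : Δ ⟶ Δ') :
    sndHalf Δ ≫ doubleMap θ = θ ≫ sndHalf Δ' :=
  SimplexCategory.Hom.ext _ _ (OrderHom.ext _ _ (funext fun i => doubleHom_natAdd θ.toOrderHom i))

/-- A homotopy between simplicial maps `f` and `g`: a natural family of `(2n+1)`-simplices with
halves `f x` and `g x`, for the `n`-simplices `x`. -/
structure DoubleHomotopy {X Y : SSet.{u}} (f g : X ⟶ Y) where
  toFun : ∀ Δ : SimplexCategory, X.obj (op Δ) → Y.obj (op (doubleObj Δ))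
  naturality : ∀ {Δ Δ' : SimplexCategory} (θ : Δ ⟶ Δ') (x : X.obj (op Δ')),
    toFun Δ (X.map θ.op x) = Y.map (doubleMap θ).op (toFun Δ' x)
  map_fstHalf : ∀ Δ x, Y.map (fstHalf Δ).op (toFun Δ x) = f.app (op Δ) x
  map_sndHalf : ∀ Δ x, Y.map (sndHalf Δ).op (toFun Δ x) = g.app (op Δ) x

/-- The map `Δ^n × I → Δ^{2n+1}`, `(t, s) ↦ ((1 - s) t, s t)`. -/
def simplexPath (a : ℕ) (s : I) (t : stdSimplex ℝ (Fin a)) : stdSimplex ℝ (Fin (a + a)) :=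
  ⟨(1 - (s : ℝ)) • (stdSimplex.map (Fin.castAdd a) t).1 +
    (s : ℝ) • (stdSimplex.map (Fin.natAdd a) t).1,
    convex_stdSimplex ℝ _ (Subtype.prop _) (Subtype.prop _) (sub_nonneg.2 s.2.2) s.2.1
      (sub_add_cancel _ _)⟩

theorem continuous_simplexPath (a : ℕ) :
    Continuous fun p : stdSimplex ℝ (Fin a) × I => simplexPath a p.2 p.1 := by
  refine Continuous.subtype_mk ?_ _
  have h1 := continuous_subtype_val.comp
    (stdSimplex.continuous_map (S := ℝ) (Fin.castAdd a (n := a)))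
  have h2 := continuous_subtype_val.comp
    (stdSimplex.continuous_map (S := ℝ) (Fin.natAdd a (m := a)))
  exact ((continuous_const.sub (continuous_subtype_val.comp continuous_snd)).smul
    (h1.comp continuous_fst)).add ((continuous_subtype_val.comp continuous_snd).smul
    (h2.comp continuous_fst))

theorem simplexPath_zero (a : ℕ) (t : stdSimplex ℝ (Fin a)) :
    simplexPath a 0 t = stdSimplex.map (Fin.castAdd a) t :=
  Subtype.ext (by simp [simplexPath])

theorem simplexPath_one (a : ℕ) (t : stdSimplex ℝ (Fin a)) :
    simplexPath a 1 t = stdSimplex.map (Fin.natAdd a) t :=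
  Subtype.ext (by simp [simplexPath])

/-- Both sides are affine in `s`, so only the two halves have to be compared. This makes the paths
of a `DoubleHomotopy` compatible with all simplicial operators. -/
theorem map_simplexPath {a b : ℕ} (θ : Fin a →o Fin b) (s : I) (t : stdSimplex ℝ (Fin a)) :
    stdSimplex.map (doubleHom θ) (simplexPath a s t) = simplexPath b s (stdSimplex.map θ t) := by
  have e1 : stdSimplex.map (doubleHom θ) (stdSimplex.map (Fin.castAdd a) t) =
      stdSimplex.map (Fin.castAdd b) (stdSimplex.map θ t) := by
    rw [stdSimplex.map_comp_apply, stdSimplex.map_comp_apply]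
    exact congrArg (fun f => stdSimplex.map f t) (funext (doubleHom_castAdd θ))
  have e2 : stdSimplex.map (doubleHom θ) (stdSimplex.map (Fin.natAdd a) t) =
      stdSimplex.map (Fin.natAdd b) (stdSimplex.map θ t) := by
    rw [stdSimplex.map_comp_apply, stdSimplex.map_comp_apply]
    exact congrArg (fun f => stdSimplex.map f t) (funext (doubleHom_natAdd θ))
  refine Subtype.ext ?_
  have key : (stdSimplex.map (doubleHom θ) (simplexPath a s t)).1 =
      (1 - (s : ℝ)) • (stdSimplex.map (doubleHom θ) (stdSimplex.map (Fin.castAdd a) t)).1 +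
      (s : ℝ) • (stdSimplex.map (doubleHom θ) (stdSimplex.map (Fin.natAdd a) t)).1 :=
    ((FunOnFinite.linearMap ℝ ℝ (doubleHom θ)).map_add _ _).trans
      (congrArg₂ (· + ·) (map_smul _ _ _) (map_smul _ _ _))
  rw [key, e1, e2]
  rfl

/-- The continuous map `Δ^n → |X|` given by an `n`-simplex of `X`. -/
def simplexReal {X : SSet.{u}} (Δ : SimplexCategory) (x : X.obj (op Δ)) :
    C(stdSimplex ℝ (Fin (Δ.len + 1)), SSet.toTop.obj X) :=
  (((sSetTopAdj.unit.app X).app (op Δ) x).down.hom).comp ⟨ULift.up, continuous_uliftUp⟩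

/-- Naturality of the unit of the adjunction between realization and singular set, evaluated at a
point. -/
theorem simplexReal_map {X : SSet.{u}} {Δ Δ' : SimplexCategory} (θ : Δ ⟶ Δ') (x : X.obj (op Δ'))
    (t : stdSimplex ℝ (Fin (Δ.len + 1))) :
    simplexReal Δ (X.map θ.op x) t = simplexReal Δ' x (stdSimplex.map θ.toOrderHom t) := by
  have h := (sSetTopAdj.unit.app X).naturality_apply θ.op x
  exact congrArg (fun z : (TopCat.toSSet.obj (SSet.toTop.obj X)).obj (op Δ) =>
    z.down.hom (ULift.up t)) h

variable {X Y : SSet.{u}} {f g : X ⟶ Y}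

/-- The map from `X` to the singular set of the path space of `|Y|` given by a homotopy. -/
def DoubleHomotopy.toPaths (K : DoubleHomotopy f g) :
    X ⟶ TopCat.toSSet.obj (TopCat.of C(I, SSet.toTop.obj Y)) where
  app Δ := ↾fun x => ULift.up (TopCat.ofHom (ContinuousMap.comp
    (ContinuousMap.curry ((simplexReal (doubleObj Δ.unop) (K.toFun Δ.unop x)).comp
      ⟨fun p => simplexPath (Δ.unop.len + 1) p.2 p.1, continuous_simplexPath (Δ.unop.len + 1)⟩))
    ⟨ULift.down, continuous_uliftDown⟩))
  naturality Δ Δ' θ := by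
    ext x
    refine ULift.ext _ _ (TopCat.hom_ext (ContinuousMap.ext fun t => ContinuousMap.ext fun s => ?_))
    have h1 := simplexReal_map (doubleMap θ.unop) (K.toFun Δ.unop x)
      (simplexPath (Δ'.unop.len + 1) s t.down)
    have h2 := congrArg (simplexReal (doubleObj Δ.unop) (K.toFun Δ.unop x))
      (map_simplexPath θ.unop.toOrderHom s t.down)
    have h3 := congrArg (fun z => simplexReal (doubleObj Δ'.unop) z
      (simplexPath (Δ'.unop.len + 1) s t.down)) (K.naturality θ.unop x)
    exact h3.trans (h1.trans h2)

/-- The transpose of `K.toPaths` followed by evaluation at `s` is a map out of `|X|`, hence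
determined by its adjoint, which can be compared simplex by simplex. It is used at the ends of the
interval, with `h = f` and `h = g`. -/
theorem DoubleHomotopy.evalPaths (K : DoubleHomotopy f g) {h : X ⟶ Y} (s : I)
    (hs : ∀ (Δ : SimplexCategory) (x : X.obj (op Δ)) (t : stdSimplex ℝ (Fin (Δ.len + 1))),
      simplexReal (doubleObj Δ) (K.toFun Δ x) (simplexPath (Δ.len + 1) s t) =
        simplexReal Δ (h.app (op Δ) x) t) (a : SSet.toTop.obj X) :
    ((sSetTopAdj.homEquiv X (TopCat.of C(I, SSet.toTop.obj Y))).symm K.toPaths).hom a s =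
      SSet.toTop.map h a := by
  let ev : TopCat.of C(I, SSet.toTop.obj Y) ⟶ SSet.toTop.obj Y :=
    TopCat.ofHom ⟨fun k => k s, continuous_eval_const s⟩
  have key : (sSetTopAdj.homEquiv X (TopCat.of C(I, SSet.toTop.obj Y))).symm K.toPaths ≫ ev =
      SSet.toTop.map h := by
    rw [← Adjunction.homEquiv_naturality_right_symm, Equiv.symm_apply_eq,
      Adjunction.homEquiv_unit]
    refine Eq.trans ?_ (sSetTopAdj.unit.naturality h)
    ext Δ x
    refine ULift.ext _ _ (TopCat.hom_ext (ContinuousMap.ext fun t => ?_))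
    exact hs Δ.unop x t.down
  exact congrArg (fun k : SSet.toTop.obj X ⟶ SSet.toTop.obj Y => k a) key

/-- Mapping into the path space of `|Y|` needs only the universal property of `|X|`, not a
comparison of `|X| × I` with the realization of a product. The resulting map uncurries to a
homotopy. -/
theorem DoubleHomotopy.homotopic (K : DoubleHomotopy f g) :
    (SSet.toTop.map f).hom.Homotopic (SSet.toTop.map g).hom := by
  let Φ := ((sSetTopAdj.homEquiv X (TopCat.of C(I, SSet.toTop.obj Y))).symm K.toPaths).hom
  have hΦ : Continuous fun p : SSet.toTop.obj X × I => Φ p.1 p.2 :=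
    ContinuousMap.continuous_uncurry_of_continuous Φ
  refine ⟨{ toFun := fun p => Φ p.2 p.1
            continuous_toFun := hΦ.comp continuous_swap
            map_zero_left := fun a => K.evalPaths 0 (fun Δ x t => ?_) a
            map_one_left := fun a => K.evalPaths 1 (fun Δ x t => ?_) a }⟩
  · rw [simplexPath_zero]
    exact (simplexReal_map (fstHalf Δ) _ t).symm.trans
      (congrArg (fun z => simplexReal Δ z t) (K.map_fstHalf Δ x))
  · rw [simplexPath_one]
    exact (simplexReal_map (sndHalf Δ) _ t).symm.trans
      (congrArg (fun z => simplexReal Δ z t) (K.map_sndHalf Δ x))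

end Doubling

end GConn

end

noncomputable section

namespace GConn

/-! ### A criterion for weak equivalences of simplicial sets -/

section Criterion

open Opposite

open scoped Simplicial

universe u

variable {X Y : SSet.{u}}

theorem sset_map_map (X : SSet.{u}) {Δ Δ' Δ'' : SimplexCategory} (θ : Δ ⟶ Δ') (φ : Δ' ⟶ Δ'')
    (x : X.obj (op Δ'')) : X.map θ.op (X.map φ.op x) = X.map (θ ≫ φ).op x := by
  rw [op_comp]
  exact (congrArg (fun k : X.obj (op Δ'') ⟶ X.obj (op Δ) => k x) (X.map_comp φ.op θ.op)).symm

/-- The `i`-th vertex of a simplex. -/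
def vertex (X : SSet.{u}) (Δ : SimplexCategory) (x : X.obj (op Δ)) (i : Fin (Δ.len + 1)) :
    X.obj (op ⦋0⦌) := X.map (SimplexCategory.const ⦋0⦌ Δ i).op x

theorem vertex_map {Δ Δ' : SimplexCategory} (θ : Δ ⟶ Δ') (x : X.obj (op Δ'))
    (i : Fin (Δ.len + 1)) : vertex X Δ (X.map θ.op x) i = vertex X Δ' x (θ.toOrderHom i) := by
  unfold vertex
  rw [sset_map_map, SimplexCategory.const_comp]

theorem vertex_app (f : X ⟶ Y) {Δ : SimplexCategory} (x : X.obj (op Δ)) (i : Fin (Δ.len + 1)) :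
    vertex Y Δ (f.app (op Δ) x) i = f.app (op ⦋0⦌) (vertex X Δ x i) :=
  (f.naturality_apply (SimplexCategory.const ⦋0⦌ Δ i).op x).symm

/-- The edge of `[n] ⋆ [n]` which joins the two copies of `i`. -/
def crossEdge (Δ : SimplexCategory) (i : Fin (Δ.len + 1)) : ⦋1⦌ ⟶ doubleObj Δ :=
  SimplexCategory.Hom.mk ⟨![Fin.castAdd (Δ.len + 1) i, Fin.natAdd (Δ.len + 1) i], by
    intro a b h
    fin_cases a <;> fin_cases b
    · exact le_rfl
    · exact Fin.le_def.2 (by simp)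
    · exact absurd h (by decide)
    · exact le_rfl⟩

theorem crossEdge_doubleMap {Δ Δ' : SimplexCategory} (θ : Δ ⟶ Δ') (i : Fin (Δ.len + 1)) :
    crossEdge Δ i ≫ doubleMap θ = crossEdge Δ' (θ.toOrderHom i) := by
  refine SimplexCategory.Hom.ext _ _ (OrderHom.ext _ _ (funext fun a => ?_))
  fin_cases a
  · exact doubleHom_castAdd θ.toOrderHom i
  · exact doubleHom_natAdd θ.toOrderHom i

/-- A simplex `y` of `Y` can be transported in a unique way along edges ending at its vertices. -/
def HasTransport (Y : SSet.{u}) : Prop :=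
  ∀ (Δ : SimplexCategory) (y : Y.obj (op Δ)) (e : Fin (Δ.len + 1) → Y.obj (op ⦋1⦌)),
    (∀ i, vertex Y ⦋1⦌ (e i) 1 = vertex Y Δ y i) →
    ∃! z : Y.obj (op (doubleObj Δ)), Y.map (sndHalf Δ).op z = y ∧
      ∀ i, Y.map (crossEdge Δ i).op z = e i

/-- The map `f` is full and faithful: every simplex of `Y` lifts uniquely to `X`, with prescribed
vertices. -/
def LiftsSimplices (f : X ⟶ Y) : Prop :=
  ∀ (Δ : SimplexCategory) (y : Y.obj (op Δ)) (v : Fin (Δ.len + 1) → X.obj (op ⦋0⦌)),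
    (∀ i, f.app (op ⦋0⦌) (v i) = vertex Y Δ y i) →
    ∃! x : X.obj (op Δ), f.app (op Δ) x = y ∧ ∀ i, vertex X Δ x i = v i

/-- The map `f` is essentially surjective: every vertex of `Y` is joined to a vertex in the
image. -/
def ReachesVertices (f : X ⟶ Y) : Prop :=
  ∀ y : Y.obj (op ⦋0⦌), ∃ (x : X.obj (op ⦋0⦌)) (e : Y.obj (op ⦋1⦌)),
    vertex Y ⦋1⦌ e 0 = f.app (op ⦋0⦌) x ∧ vertex Y ⦋1⦌ e 1 = y

/-- Choices are made on vertices only: `x₀ y` and an edge `e₀ y` from `f (x₀ y)` to `y`.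
Transporting a simplex `y` backwards along these edges gives `z y`; its first half has vertices `f
(x₀ _)` and lifts uniquely to `g y`. Thus `z` is the homotopy on `Y`, and its lift `w` along `f` the
one on `X`. -/
theorem exists_doubleHomotopy_inverse {f : X ⟶ Y} (hY : HasTransport Y) (hf : LiftsSimplices f)
    (hv : ReachesVertices f) : ∃ g : Y ⟶ X,
      Nonempty (DoubleHomotopy (g ≫ f) (𝟙 Y)) ∧ Nonempty (DoubleHomotopy (f ≫ g) (𝟙 X)) := by
  choose x₀ e₀ he0 he1 using hv
  choose z hz huz using fun (Δ : SimplexCategory) (y : Y.obj (op Δ)) =>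
    hY Δ y (fun i => e₀ (vertex Y Δ y i)) (fun i => he1 _)
  -- The restriction of `z y` along `θ ⋆ θ` has the second half and the cross edges required of the
  -- transport of `θ^* y`, so uniqueness identifies them.
  have z_nat : ∀ {Δ Δ' : SimplexCategory} (θ : Δ ⟶ Δ') (y : Y.obj (op Δ')),
      z Δ (Y.map θ.op y) = Y.map (doubleMap θ).op (z Δ' y) := fun {Δ Δ'} θ y =>
    (huz Δ _ _ ⟨by rw [sset_map_map, sndHalf_doubleMap, ← sset_map_map, (hz Δ' y).1], fun i => by
      rw [sset_map_map, crossEdge_doubleMap, (hz Δ' y).2, vertex_map]⟩).symm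
  have z_fst : ∀ (Δ : SimplexCategory) (y : Y.obj (op Δ)) (i : Fin (Δ.len + 1)),
      f.app (op ⦋0⦌) (x₀ (vertex Y Δ y i)) = vertex Y _ (z Δ y) ((fstHalf Δ).toOrderHom i) :=
    fun Δ y i => by
      rw [← he0, ← (hz Δ y).2 i, vertex_map]
      rfl
  have z_snd : ∀ (Δ : SimplexCategory) (y : Y.obj (op Δ)) (i : Fin (Δ.len + 1)),
      vertex Y Δ y i = vertex Y _ (z Δ y) ((sndHalf Δ).toOrderHom i) :=
    fun Δ y i => by
      rw [← vertex_map, (hz Δ y).1]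
  choose G hG huG using fun (Δ : SimplexCategory) (y : Y.obj (op Δ)) =>
    hf Δ (Y.map (fstHalf Δ).op (z Δ y)) (fun i => x₀ (vertex Y Δ y i))
      (fun i => by rw [vertex_map, z_fst])
  let g : Y ⟶ X :=
    { app := fun Δ => ↾fun y => G Δ.unop y
      naturality := fun Δ Δ' θ => by
        ext y
        refine (huG Δ'.unop _ _ ⟨?_, fun i => ?_⟩).symm
        · have h1 := f.naturality_apply θ (G Δ.unop y)
          refine h1.trans ?_
          rw [(hG Δ.unop y).1]
          have h2 := z_nat θ.unop y
          have h3 := sset_map_map Y (fstHalf Δ'.unop) (doubleMap θ.unop) (z Δ.unop y)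
          have h4 := sset_map_map Y θ.unop (fstHalf Δ.unop) (z Δ.unop y)
          rw [fstHalf_doubleMap, ← h4] at h3
          rw [← h2] at h3
          exact h3.symm
        · have h1 := vertex_map θ.unop (G Δ.unop y) i
          refine h1.trans ?_
          rw [(hG Δ.unop y).2]
          exact congrArg x₀ (vertex_map θ.unop y i).symm }
  -- For `y = f x` the second half of `z y` also has vertices in the image, namely those of `x`.
  -- Hence the whole doubled simplex lifts, not only its first half.
  have hw : ∀ (Δ : SimplexCategory) (x : X.obj (op Δ)) (i : Fin ((Δ.len + 1) + (Δ.len + 1))),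
      f.app (op ⦋0⦌) (Fin.addCases (motive := fun _ => X.obj (op ⦋0⦌))
        (fun i => x₀ (vertex Y Δ (f.app _ x) i)) (fun i => vertex X Δ x i) i) =
      vertex Y (doubleObj Δ) (z Δ (f.app _ x)) i := fun Δ x => by
    refine Fin.addCases (fun i => ?_) (fun i => ?_)
    · rw [Fin.addCases_left, z_fst]
      rfl
    · rw [Fin.addCases_right, ← vertex_app, z_snd]
      rfl
  choose w hw1 hw2 using fun (Δ : SimplexCategory) (x : X.obj (op Δ)) =>
    hf (doubleObj Δ) (z Δ (f.app _ x)) _ (hw Δ x)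
  have w_fst : ∀ (Δ : SimplexCategory) (x : X.obj (op Δ)) (i : Fin (Δ.len + 1)),
      vertex X (doubleObj Δ) (w Δ x) (Fin.castAdd (Δ.len + 1) i) =
        x₀ (vertex Y Δ (f.app _ x) i) := fun Δ x i => by
    refine ((hw1 Δ x).2 _).trans ?_
    exact Fin.addCases_left (motive := fun _ => X.obj (op ⦋0⦌)) i
  have w_snd : ∀ (Δ : SimplexCategory) (x : X.obj (op Δ)) (i : Fin (Δ.len + 1)),
      vertex X (doubleObj Δ) (w Δ x) (Fin.natAdd (Δ.len + 1) i) = vertex X Δ x i := fun Δ x i => by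
    refine ((hw1 Δ x).2 _).trans ?_
    exact Fin.addCases_right (motive := fun _ => X.obj (op ⦋0⦌)) i
  refine ⟨g, ⟨⟨z, z_nat, fun Δ y => (hG Δ y).1.symm, fun Δ y => (hz Δ y).1⟩⟩,
    ⟨⟨w, fun {Δ Δ'} θ x => ?_, fun Δ x => ?_, fun Δ x => ?_⟩⟩⟩
  · refine (hw2 Δ _ _ ⟨?_, ?_⟩).symm
    · have h1 := f.naturality_apply (doubleMap θ).op (w Δ' x)
      refine h1.trans ?_
      rw [(hw1 Δ' x).1, ← z_nat]
      exact congrArg (z Δ) (f.naturality_apply θ.op x).symm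
    · refine Fin.addCases (m := Δ.len + 1) (n := Δ.len + 1) (fun i => ?_) (fun i => ?_)
      · refine Eq.trans ?_ (Fin.addCases_left (motive := fun _ => X.obj (op ⦋0⦌)) i).symm
        refine (vertex_map _ _ _).trans ?_
        refine (congrArg (vertex X _ (w Δ' x)) (doubleHom_castAdd θ.toOrderHom i)).trans ?_
        rw [w_fst]
        refine congrArg x₀ ?_
        rw [vertex_app, vertex_app, vertex_map]
      · refine Eq.trans ?_ (Fin.addCases_right (motive := fun _ => X.obj (op ⦋0⦌)) i).symm
        refine (vertex_map _ _ _).trans ?_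
        refine (congrArg (vertex X _ (w Δ' x)) (doubleHom_natAdd θ.toOrderHom i)).trans ?_
        rw [w_snd, vertex_map]
  · refine huG Δ _ _ ⟨?_, fun i => ?_⟩
    · refine (f.naturality_apply (fstHalf Δ).op (w Δ x)).trans ?_
      rw [(hw1 Δ x).1]
      rfl
    · rw [vertex_map]
      exact w_fst Δ x i
  · refine (hf Δ (f.app _ x) (fun i => vertex X Δ x i) (fun i => (vertex_app f x i).symm)).unique
      ⟨?_, fun i => ?_⟩ ⟨rfl, fun i => rfl⟩
    · refine (f.naturality_apply (sndHalf Δ).op (w Δ x)).trans ?_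
      rw [(hw1 Δ x).1, (hz Δ _).1]
    · rw [vertex_map]
      exact w_snd Δ x i

theorem isWeakEquivSSet_of_liftsSimplices {X Y : SSet.{1}} {f : X ⟶ Y} (hY : HasTransport Y)
    (hf : LiftsSimplices f) (hv : ReachesVertices f) : IsWeakEquivSSet f := by
  obtain ⟨g, ⟨K⟩, ⟨K'⟩⟩ := exists_doubleHomotopy_inverse hY hf hv
  have h := K.homotopic.symm
  have h' := K'.homotopic.symm
  rw [CategoryTheory.Functor.map_comp, CategoryTheory.Functor.map_id] at h h'
  exact isWeakHomotopyEquiv_of_homotopic _ (SSet.toTop.map g).hom h' h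

end Criterion

end GConn

end

noncomputable section

namespace GConn

/-! ### The criterion passes to directed colimits -/

section DirectedColimits

open Opposite Limits

open scoped Simplicial

universe u

variable {J : Type} [SmallCategory J] [IsFiltered J] [Quiver.IsThin J]

theorem exists_forall_hom {ι : Type} [Finite ι] (j : ι → J) : ∃ k, ∀ i, Nonempty (j i ⟶ k) := by
  classical
  cases nonempty_fintype ι
  obtain ⟨k, hk⟩ := IsFiltered.sup_objs_exists (Finset.univ.image j)
  exact ⟨k, fun i => hk (Finset.mem_image_of_mem _ (Finset.mem_univ i))⟩

variable {K : J ⥤ SSet.{u}} {c : Cocone K}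

theorem cocone_app_map {j k : J} (h : j ⟶ k) {Δ : SimplexCategory} (x : (K.obj j).obj (op Δ)) :
    (c.ι.app k).app (op Δ) ((K.map h).app (op Δ) x) = (c.ι.app j).app (op Δ) x := by
  have e := congrArg (fun f : K.obj j ⟶ c.pt => f.app (op Δ) x) (c.w h)
  exact e

theorem cocone_vertex {j : J} {Δ : SimplexCategory} (x : (K.obj j).obj (op Δ))
    (i : Fin (Δ.len + 1)) : (c.ι.app j).app (op ⦋0⦌) (vertex (K.obj j) Δ x i) =
      vertex c.pt Δ ((c.ι.app j).app (op Δ) x) i := (vertex_app (c.ι.app j) x i).symm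

theorem diagram_map_eq {j k l : J} (h : j ⟶ k) (h' : k ⟶ l) (h'' : j ⟶ l) {Δ : SimplexCategory}
    (x : (K.obj j).obj (op Δ)) :
    (K.map h').app (op Δ) ((K.map h).app (op Δ) x) = (K.map h'').app (op Δ) x := by
  rw [Subsingleton.elim h'' (h ≫ h')]
  exact (congrArg (fun f : K.obj j ⟶ K.obj l => f.app (op Δ) x) (K.map_comp h h')).symm

section

variable [HasColimitsOfShape J (Type u)] (hc : IsColimit c)
include hc

/-- Colimits of simplicial sets are computed in each degree; finitely many stages have a common
successor. -/
theorem exists_rep {ι : Type} [Finite ι] {Δ : ι → SimplexCategory}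
    (a : ∀ i, c.pt.obj (op (Δ i))) :
    ∃ (j : J) (b : ∀ i, (K.obj j).obj (op (Δ i))), ∀ i, (c.ι.app j).app (op (Δ i)) (b i) = a i := by
  have h : ∀ i, ∃ (j : J) (b : (K.obj j).obj (op (Δ i))), (c.ι.app j).app (op (Δ i)) b = a i :=
    fun i => Types.jointly_surjective_of_isColimit
      (isColimitOfPreserves ((evaluation _ _).obj (op (Δ i))) hc) (a i)
  choose j b hb using h
  obtain ⟨k, hk⟩ := exists_forall_hom j
  exact ⟨k, fun i => (K.map (hk i).some).app _ (b i), fun i => by rw [cocone_app_map, hb]⟩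

/-- Each equality holds at some later stage. Thinness makes all routes to a common later stage
agree, so one arrow serves for all `i`. -/
theorem exists_map_eq {ι : Type} [Finite ι] {j : J} {Δ : ι → SimplexCategory}
    (a b : ∀ i, (K.obj j).obj (op (Δ i)))
    (h : ∀ i, (c.ι.app j).app (op (Δ i)) (a i) = (c.ι.app j).app (op (Δ i)) (b i)) :
    ∃ (k : J) (f : j ⟶ k), ∀ i, (K.map f).app (op (Δ i)) (a i) = (K.map f).app (op (Δ i)) (b i) := by
  have h' : ∀ i, ∃ (k : J) (f : j ⟶ k),
      (K.map f).app (op (Δ i)) (a i) = (K.map f).app (op (Δ i)) (b i) := fun i =>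
    (Types.FilteredColimit.isColimit_eq_iff' (isColimitOfPreserves
      ((evaluation _ _).obj (op (Δ i))) hc) (a i) (b i)).1 (h i)
  choose k f hf using h'
  obtain ⟨l, hl⟩ := exists_forall_hom (fun i : Option ι => i.elim j k)
  have f₀ : j ⟶ l := (hl none).some
  have g : ∀ i, k i ⟶ l := fun i => (hl (some i)).some
  exact ⟨l, f₀, fun i => by
    rw [← diagram_map_eq (f i) (g i) f₀, hf, diagram_map_eq (f i) (g i) f₀]⟩

/-- Represent the simplex and its finitely many edges at one stage, go on until their incidences
hold, and transport there. Two solutions are compared at a stage where their second halves and cross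
edges coincide. -/
theorem hasTransport_colimit (hK : ∀ j, HasTransport (K.obj j)) : HasTransport c.pt := by
  intro Δ y e he
  obtain ⟨j, b, hb⟩ := exists_rep hc (ι := Option (Fin (Δ.len + 1)))
    (Δ := fun i => i.elim Δ (fun _ => ⦋1⦌))
    (fun i => match i with
      | none => y
      | some i => e i)
  let yj : (K.obj j).obj (op Δ) := b none
  let ej : Fin (Δ.len + 1) → (K.obj j).obj (op ⦋1⦌) := fun i => b (some i)
  have hyj : (c.ι.app j).app (op Δ) yj = y := hb none
  have hej : ∀ i, (c.ι.app j).app (op ⦋1⦌) (ej i) = e i := fun i => hb (some i)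
  obtain ⟨k, f, hf⟩ := exists_map_eq hc (Δ := fun _ => ⦋0⦌) (fun i => vertex _ ⦋1⦌ (ej i) 1)
    (fun i => vertex _ Δ yj i) (fun i => by
      rw [cocone_vertex, cocone_vertex, hyj, hej, he])
  obtain ⟨z, ⟨hz1, hz2⟩, -⟩ := hK k Δ ((K.map f).app _ yj) (fun i => (K.map f).app _ (ej i))
    (fun i => by rw [vertex_app, vertex_app]; exact hf i)
  refine ⟨(c.ι.app k).app _ z, ⟨?_, fun i => ?_⟩, ?_⟩
  · refine ((c.ι.app k).naturality_apply (sndHalf Δ).op z).symm.trans ?_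
    rw [hz1, cocone_app_map, hyj]
  · refine ((c.ι.app k).naturality_apply (crossEdge Δ i).op z).symm.trans ?_
    rw [hz2, cocone_app_map, hej]
  · rintro z' ⟨hz1', hz2'⟩
    obtain ⟨l, w, hw⟩ := exists_rep hc (Δ := fun _ => doubleObj Δ) ![z', (c.ι.app k).app _ z]
    have hw0 : (c.ι.app l).app _ (w 0) = z' := hw 0
    have hw1 : (c.ι.app l).app _ (w 1) = (c.ι.app k).app _ z := hw 1
    let θ : ∀ i : Option (Fin (Δ.len + 1)), (i.elim Δ (fun _ => ⦋1⦌)) ⟶ doubleObj Δ := fun i =>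
      match i with
      | none => sndHalf Δ
      | some i => crossEdge Δ i
    have hθ : ∀ i, (c.ι.app l).app _ ((K.obj l).map (θ i).op (w 0)) =
        (c.ι.app l).app _ ((K.obj l).map (θ i).op (w 1)) := fun i => by
      refine ((c.ι.app l).naturality_apply (θ i).op (w 0)).trans
        (Eq.trans ?_ ((c.ι.app l).naturality_apply (θ i).op (w 1)).symm)
      rw [hw0, hw1]
      refine Eq.trans ?_ ((c.ι.app k).naturality_apply (θ i).op z)
      cases i with
      | none =>
        refine hz1'.trans ?_
        have : (K.obj k).map (θ none).op z = (K.map f).app _ yj := hz1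
        rw [this]
        exact (hyj.symm.trans (cocone_app_map f yj).symm)
      | some i =>
        refine (hz2' i).trans ?_
        have : (K.obj k).map (θ (some i)).op z = (K.map f).app _ (ej i) := hz2 i
        rw [this]
        exact ((hej i).symm.trans (cocone_app_map f (ej i)).symm)
    obtain ⟨m, g, hg⟩ := exists_map_eq hc _ _ hθ
    -- The data to be transported are read off from the representative `w 1`, so the incidence
    -- condition is automatic and `w 0` is the competitor.
    have hu := (hK m Δ ((K.obj m).map (sndHalf Δ).op ((K.map g).app _ (w 1)))
      (fun i => (K.obj m).map (crossEdge Δ i).op ((K.map g).app _ (w 1))) (fun i => by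
        rw [vertex_map, vertex_map]
        rfl)).unique (y₁ := (K.map g).app _ (w 0)) (y₂ := (K.map g).app _ (w 1))
      ⟨?_, fun i => ?_⟩ ⟨rfl, fun i => rfl⟩
    · rw [← hw0, ← hw1, ← cocone_app_map g, hu, cocone_app_map]
    · have h1 := (K.map g).naturality_apply (sndHalf Δ).op (w 0)
      have h2 := (K.map g).naturality_apply (sndHalf Δ).op (w 1)
      exact h1.symm.trans ((hg none).trans h2)
    · have h1 := (K.map g).naturality_apply (crossEdge Δ i).op (w 0)
      have h2 := (K.map g).naturality_apply (crossEdge Δ i).op (w 1)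
      exact h1.symm.trans ((hg (some i)).trans h2)

end

variable {K' : J ⥤ SSet.{u}} {c' : Cocone K'} (τ : K ⟶ K') (f : c.pt ⟶ c'.pt)
  (hf : ∀ j, c.ι.app j ≫ f = τ.app j ≫ c'.ι.app j)

include hf in
theorem colimit_map_app {j : J} {Δ : SimplexCategory} (x : (K.obj j).obj (op Δ)) :
    f.app (op Δ) ((c.ι.app j).app (op Δ) x) = (c'.ι.app j).app (op Δ) ((τ.app j).app (op Δ) x) :=
  congrArg (fun k : K.obj j ⟶ c'.pt => k.app (op Δ) x) (hf j)

theorem diagram_trans_app {j k : J} (h : j ⟶ k) {Δ : SimplexCategory} (x : (K.obj j).obj (op Δ)) :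
    (τ.app k).app (op Δ) ((K.map h).app (op Δ) x) =
      (K'.map h).app (op Δ) ((τ.app j).app (op Δ) x) :=
  congrArg (fun g : K.obj j ⟶ K'.obj k => g.app (op Δ) x) (τ.naturality h)

variable [HasColimitsOfShape J (Type u)] (hc : IsColimit c) (hc' : IsColimit c')
include hf hc hc'

theorem reachesVertices_colimit (hτ : ∀ j, ReachesVertices (τ.app j)) : ReachesVertices f := by
  intro y
  obtain ⟨j, b, hb⟩ := exists_rep hc' (ι := Unit) (Δ := fun _ => ⦋0⦌) (fun _ => y)
  obtain ⟨x, e, h0, h1⟩ := hτ j (b ())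
  refine ⟨(c.ι.app j).app _ x, (c'.ι.app j).app _ e, ?_, ?_⟩
  · rw [vertex_app, h0, colimit_map_app τ f hf]
  · rw [vertex_app, h1, hb]

/-- The same scheme as for transport, except that a lift involves representatives in both diagrams:
the given vertices in `K`, the given simplex in `K'`. -/
theorem liftsSimplices_colimit (hτ : ∀ j, LiftsSimplices (τ.app j)) : LiftsSimplices f := by
  intro Δ y v hv
  obtain ⟨j₁, b₁, hb₁⟩ := exists_rep hc' (ι := Unit) (Δ := fun _ => Δ) (fun _ => y)
  obtain ⟨j₂, b₂, hb₂⟩ := exists_rep hc (Δ := fun _ => ⦋0⦌) v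
  obtain ⟨j, hj⟩ := exists_forall_hom ![j₁, j₂]
  let f₁ : j₁ ⟶ j := (hj 0).some
  let f₂ : j₂ ⟶ j := (hj 1).some
  let yj := (K'.map f₁).app (op Δ) (b₁ ())
  let vj := fun i => (K.map f₂).app (op ⦋0⦌) (b₂ i)
  have hyj : (c'.ι.app j).app (op Δ) yj = y := (cocone_app_map f₁ _).trans (hb₁ ())
  have hvj : ∀ i, (c.ι.app j).app (op ⦋0⦌) (vj i) = v i := fun i =>
    (cocone_app_map f₂ _).trans (hb₂ i)
  obtain ⟨k, g, hg⟩ := exists_map_eq hc' (Δ := fun _ => ⦋0⦌)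
    (fun i => (τ.app j).app (op ⦋0⦌) (vj i)) (fun i => vertex _ Δ yj i) (fun i => by
      rw [cocone_vertex, hyj, ← colimit_map_app τ f hf, hvj, hv])
  obtain ⟨x, ⟨hx1, hx2⟩, -⟩ := hτ k Δ ((K'.map g).app _ yj) (fun i => (K.map g).app _ (vj i))
    (fun i => by rw [vertex_app, diagram_trans_app]; exact hg i)
  refine ⟨(c.ι.app k).app _ x, ⟨?_, fun i => ?_⟩, ?_⟩
  · rw [colimit_map_app τ f hf, hx1, cocone_app_map, hyj]
  · rw [vertex_app, hx2, cocone_app_map, hvj]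
  · rintro x' ⟨hx1', hx2'⟩
    obtain ⟨l, w, hw⟩ := exists_rep hc (Δ := fun _ => Δ) ![x', (c.ι.app k).app _ x]
    have hw0 : (c.ι.app l).app _ (w 0) = x' := hw 0
    have hw1 : (c.ι.app l).app _ (w 1) = (c.ι.app k).app _ x := hw 1
    obtain ⟨m₁, g₁, hg₁⟩ := exists_map_eq hc' (ι := Unit) (Δ := fun _ => Δ)
      (fun _ => (τ.app l).app _ (w 0)) (fun _ => (τ.app l).app _ (w 1)) (fun _ => by
        rw [← colimit_map_app τ f hf, ← colimit_map_app τ f hf, hw0, hw1, hx1',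
          colimit_map_app τ f hf, hx1, cocone_app_map, hyj])
    obtain ⟨m₂, g₂, hg₂⟩ := exists_map_eq hc (Δ := fun _ => ⦋0⦌)
      (fun i => vertex _ Δ (w 0) i) (fun i => vertex _ Δ (w 1) i) (fun i => by
        rw [cocone_vertex, cocone_vertex, hw0, hw1, hx2', ← cocone_vertex, hx2, cocone_app_map, hvj])
    -- The two candidates acquire equal images in `K'` at stage `m₁` and equal vertices in `K` at
    -- stage `m₂`; uniqueness is applied at a common later stage.
    obtain ⟨m, hm⟩ := exists_forall_hom ![m₁, m₂]
    let k₁ : m₁ ⟶ m := (hm 0).some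
    let k₂ : m₂ ⟶ m := (hm 1).some
    have hu := (hτ m Δ ((τ.app m).app _ ((K.map (g₁ ≫ k₁)).app _ (w 1)))
      (fun i => vertex _ Δ ((K.map (g₁ ≫ k₁)).app _ (w 1)) i) (fun i => (vertex_app _ _ _).symm)).unique
      (y₁ := (K.map (g₁ ≫ k₁)).app _ (w 0)) (y₂ := (K.map (g₁ ≫ k₁)).app _ (w 1))
      ⟨?_, fun i => ?_⟩ ⟨rfl, fun i => rfl⟩
    · rw [← hw0, ← hw1, ← cocone_app_map (g₁ ≫ k₁), hu, cocone_app_map]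
    · rw [diagram_trans_app, diagram_trans_app, ← diagram_map_eq g₁ k₁, hg₁ (),
        diagram_map_eq g₁ k₁]
    · rw [vertex_app, vertex_app, ← diagram_map_eq g₂ k₂, hg₂ i, diagram_map_eq g₂ k₂]

end DirectedColimits

end GConn

end

noncomputable section

namespace GConn

/-! ### Nerves of groupoids -/

section Nerves

open Opposite

open scoped Simplicial

universe v u

variable {D : Type u} [Groupoid.{v} D]

/-- The sequence of composable arrows formed by the targets of a family of arrows with a common
source. -/
def starFunctor {p : D} {N : ℕ} (R : Fin N → Σ d : D, p ⟶ d) : Fin N ⥤ D where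
  obj j := (R j).1
  map {i j} _ := Groupoid.inv (R i).2 ≫ (R j).2
  map_id _ := Groupoid.inv_comp _
  map_comp _ _ := by simp

/-- In a groupoid `F.map h` is forced to be `(ρ i)⁻¹ ≫ ρ j`. Equality of functors thus becomes
equality of families of arrows out of `p`, which is stable under restriction to faces. -/
theorem starFunctor_eq {p : D} {N : ℕ} {R : Fin N → Σ d : D, p ⟶ d} {F : Fin N ⥤ D}
    (ρ : ∀ j, p ⟶ F.obj j) (hR : ∀ j, R j = ⟨F.obj j, ρ j⟩)
    (hρ : ∀ {i j} (h : i ⟶ j), ρ i ≫ F.map h = ρ j) : starFunctor R = F := by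
  obtain rfl : R = fun j => ⟨F.obj j, ρ j⟩ := funext hR
  refine CategoryTheory.Functor.hext (fun _ => rfl) fun i j h => heq_of_eq ?_
  show Groupoid.inv (ρ i) ≫ ρ j = F.map h
  rw [← hρ h, ← Category.assoc, Groupoid.inv_comp, Category.id_comp]

/-- Every arrow `i ⟶ j` is recovered from the arrows of `i` and `j` to the last object, since arrows
of a groupoid can be cancelled. -/
theorem functor_fin_ext {m : ℕ} {F F' : Fin (m + 1) ⥤ D} (hobj : ∀ j, F.obj j = F'.obj j)
    (hmap : ∀ j, F.map (homOfLE (Fin.le_last j)) ≍ F'.map (homOfLE (Fin.le_last j))) :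
    F = F' := by
  obtain ⟨o, q, hi, hc⟩ := F
  obtain ⟨o', q', hi', hc'⟩ := F'
  obtain rfl : o = o' := funext hobj
  refine CategoryTheory.Functor.hext (fun _ => rfl) fun i j h => heq_of_eq ?_
  have hi1 : q (homOfLE (Fin.le_last i)) = q' (homOfLE (Fin.le_last i)) := eq_of_heq (hmap i)
  have hj1 : q (homOfLE (Fin.le_last j)) = q' (homOfLE (Fin.le_last j)) := eq_of_heq (hmap j)
  have e1 : q (homOfLE (Fin.le_last i)) = q h ≫ q (homOfLE (Fin.le_last j)) :=
    hc h (homOfLE (Fin.le_last j))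
  have e2 : q' (homOfLE (Fin.le_last i)) = q' h ≫ q' (homOfLE (Fin.le_last j)) :=
    hc' h (homOfLE (Fin.le_last j))
  show q h = q' h
  rw [e1, e2, hj1] at hi1
  exact (cancel_mono _).1 hi1

theorem functor_map_heq {C D : Type*} [Category C] [Category D] {F F' : C ⥤ D} (e : F = F') {i j : C}
    (h : i ⟶ j) : F.map h ≍ F'.map h := by
  subst e
  rfl

theorem comp_heq_comp {a b c a' b' c' : D} (ha : a = a') (hb : b = b') (hc : c = c')
    {f : a ⟶ b} {g : b ⟶ c} {f' : a' ⟶ b'} {g' : b' ⟶ c'} (hf : f ≍ f') (hg : g ≍ g') :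
    f ≫ g ≍ f' ≫ g' := by
  subst ha hb hc
  rw [eq_of_heq hf, eq_of_heq hg]

theorem sigma_comp_eqToHom {p d d' : D} (f : p ⟶ d) (h : d = d') :
    (⟨d, f⟩ : Σ d : D, p ⟶ d) = ⟨d', f ≫ eqToHom h⟩ := by
  subst h
  simp

/-- Existence: let `p` be the first vertex of `y` and take the star of arrows from `p` to the
vertices of `y`, together with these arrows followed by the inverses of the edges. Restricting this
star to the second half or to a cross edge gives the prescribed simplex. Uniqueness: the arrow from
a first-half vertex to the last one factors through its cross edge and then lies in the second half.
-/
theorem hasTransport_nerve : HasTransport (nerve D) := by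
  intro Δ y e he
  let y' : Fin (Δ.len + 1) ⥤ D := y
  let e' : Fin (Δ.len + 1) → (Fin 2 ⥤ D) := e
  have he' : ∀ i, (e' i).obj 1 = y'.obj i := fun i =>
    congrArg (fun F : Fin 1 ⥤ D => F.obj 0) (he i)
  have hu : ∀ z z' : Fin ((Δ.len + 1 + Δ.len) + 1) ⥤ D,
      (nerve D).map (sndHalf Δ).op z = (nerve D).map (sndHalf Δ).op z' →
      (∀ i, (nerve D).map (crossEdge Δ i).op z = (nerve D).map (crossEdge Δ i).op z') → z = z' := by
    intro z z' h1 h2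
    have o1 : ∀ i, z.obj (Fin.castAdd (Δ.len + 1) i) = z'.obj (Fin.castAdd (Δ.len + 1) i) :=
      fun i => congrArg (fun F : Fin 2 ⥤ D => F.obj 0) (h2 i)
    have o2 : ∀ i : Fin (Δ.len + 1), z.obj (Fin.natAdd (Δ.len + 1) i) = z'.obj (Fin.natAdd (Δ.len + 1) i) :=
      fun i => congrArg (fun F : Fin (Δ.len + 1) ⥤ D => F.obj i) h1
    have m2 : ∀ (i j : Fin (Δ.len + 1)) (h : i ≤ j),
        z.map (homOfLE (show Fin.natAdd (Δ.len + 1) i ≤ Fin.natAdd (Δ.len + 1) j from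
          Nat.add_le_add_left h _)) ≍ z'.map (homOfLE (show Fin.natAdd (Δ.len + 1) i ≤
          Fin.natAdd (Δ.len + 1) j from Nat.add_le_add_left h _)) := fun i j h =>
      functor_map_heq (F := (nerve D).map (sndHalf Δ).op z)
        (F' := (nerve D).map (sndHalf Δ).op z') h1 (homOfLE h)
    have m1 : ∀ (i : Fin (Δ.len + 1)) (h : Fin.castAdd (Δ.len + 1) i ≤ Fin.natAdd (Δ.len + 1) i),
        z.map (homOfLE h) ≍ z'.map (homOfLE h) := fun i h =>
      functor_map_heq (F := (nerve D).map (crossEdge Δ i).op z)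
        (F' := (nerve D).map (crossEdge Δ i).op z') (h2 i) (homOfLE (Fin.zero_le 1))
    refine functor_fin_ext (Fin.addCases (m := Δ.len + 1) (n := Δ.len + 1) o1 o2)
      (Fin.addCases (m := Δ.len + 1) (n := Δ.len + 1) (fun i => ?_)
        (fun i => m2 i (Fin.last _) (Fin.le_last i)))
    have h : Fin.castAdd (Δ.len + 1) i ≤ Fin.natAdd (Δ.len + 1) i :=
      Fin.le_def.2 (by simp)
    have h' : Fin.natAdd (Δ.len + 1) i ≤ Fin.natAdd (Δ.len + 1) (Fin.last Δ.len) :=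
      Nat.add_le_add_left (Fin.le_last i) _
    have c := z.map_comp (homOfLE h) (homOfLE h')
    have c' := z'.map_comp (homOfLE h) (homOfLE h')
    have k := comp_heq_comp (o1 i) (o2 i) (o2 (Fin.last _)) (m1 i h)
      (m2 i (Fin.last _) (Fin.le_last i))
    exact (heq_of_eq c).trans (k.trans (heq_of_eq c'.symm))
  let p : D := y'.obj 0
  let r : ∀ i, p ⟶ y'.obj i := fun i => y'.map (homOfLE (Fin.zero_le i))
  have hr : ∀ {i j} (h : i ⟶ j), r i ≫ y'.map h = r j := fun h => (y'.map_comp _ _).symm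
  -- The edge `e' i` ends at the vertex of `y'` only up to a propositional equality, whence the
  -- `eqToHom`.
  let a : ∀ i, (e' i).obj 0 ⟶ y'.obj i := fun i =>
    (e' i).map (homOfLE (Fin.zero_le 1)) ≫ eqToHom (he' i)
  let R : Fin ((Δ.len + 1) + (Δ.len + 1)) → Σ d : D, p ⟶ d :=
    Fin.addCases (motive := fun _ => Σ d : D, p ⟶ d)
      (fun i => ⟨(e' i).obj 0, r i ≫ Groupoid.inv (a i)⟩) (fun i => ⟨y'.obj i, r i⟩)
  have R1 : ∀ i, R (Fin.castAdd _ i) = ⟨(e' i).obj 0, r i ≫ Groupoid.inv (a i)⟩ := fun i =>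
    Fin.addCases_left (motive := fun _ => Σ d : D, p ⟶ d) i
  have R2 : ∀ i, R (Fin.natAdd _ i) = ⟨y'.obj i, r i⟩ := fun i =>
    Fin.addCases_right (motive := fun _ => Σ d : D, p ⟶ d) i
  have hz1 : (nerve D).map (sndHalf Δ).op (starFunctor R) = y := by
    exact starFunctor_eq (R := fun i => R (Fin.natAdd _ i)) (F := y') r R2 hr
  have hz2 : ∀ i, (nerve D).map (crossEdge Δ i).op (starFunctor R) = e i := by
    intro i
    refine starFunctor_eq (R := fun j : Fin 2 => R ((crossEdge Δ i).toOrderHom j)) (F := e' i)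
      (fun j => (r i ≫ Groupoid.inv (a i)) ≫ (e' i).map (homOfLE (Fin.zero_le j))) ?_ ?_
    · intro j
      fin_cases j
      · refine (R1 i).trans ?_
        have : (e' i).map (homOfLE (Fin.zero_le (0 : Fin 2))) = 𝟙 _ := (e' i).map_id 0
        show _ = (⟨(e' i).obj 0, (r i ≫ Groupoid.inv (a i)) ≫
          (e' i).map (homOfLE (Fin.zero_le (0 : Fin 2)))⟩ : Σ d : D, p ⟶ d)
        rw [this, Category.comp_id]
      · refine (R2 i).trans ((sigma_comp_eqToHom _ (he' i).symm).trans ?_)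
        show _ = (⟨(e' i).obj 1, (r i ≫ Groupoid.inv (a i)) ≫
          (e' i).map (homOfLE (Fin.zero_le (1 : Fin 2)))⟩ : Σ d : D, p ⟶ d)
        have : (e' i).map (homOfLE (Fin.zero_le (1 : Fin 2))) = a i ≫ eqToHom (he' i).symm := by
          simp [a]
        rw [this, Category.assoc, ← Category.assoc (Groupoid.inv (a i)), Groupoid.inv_comp,
          Category.id_comp]
    · intro j k h
      rw [Category.assoc]
      exact congrArg (fun g => (r i ≫ Groupoid.inv (a i)) ≫ g) ((e' i).map_comp _ _).symm
  exact ⟨starFunctor R, ⟨hz1, hz2⟩, fun z ⟨h1, h2⟩ => hu _ _ (h1.trans hz1.symm)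
    fun i => (h2 i).trans (hz2 i).symm⟩

/-- A simplex of the nerve is a functor from an ordinal. The prescribed vertices fix the objects of
its lift, and full faithfulness gives the arrows uniquely. -/
theorem liftsSimplices_nerveMap {C D : Type u} [Category.{v} C] [Category.{v} D] (F : C ⥤ D)
    [F.Full] [F.Faithful] : LiftsSimplices (nerveMap F) := by
  intro Δ y x hx
  let x₀ : Fin (Δ.len + 1) → C := fun i => CategoryTheory.Functor.obj (show Fin 1 ⥤ C from x i) 0
  have vert : ∀ (w : Fin (Δ.len + 1) ⥤ C) i, vertex (nerve C) Δ w i = x i ↔ w.obj i = x₀ i := by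
    intro w i
    refine ⟨fun h => congrArg (fun F : Fin 1 ⥤ C => F.obj 0) h, fun h => ?_⟩
    exact ComposableArrows.ext₀ h
  have hx₀ : ∀ i, F.obj (x₀ i) = CategoryTheory.Functor.obj (show Fin (Δ.len + 1) ⥤ D from y) i :=
    fun i => congrArg (fun F : Fin 1 ⥤ D => F.obj 0) (hx i)
  suffices h : ∃! w : Fin (Δ.len + 1) ⥤ C, w ⋙ F = y ∧ ∀ i, w.obj i = x₀ i by
    obtain ⟨w, ⟨hw1, hw2⟩, hw⟩ := h
    exact ⟨w, ⟨hw1, fun i => (vert w i).2 (hw2 i)⟩,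
      fun w' hw' => hw w' ⟨hw'.1, fun i => (vert w' i).1 (hw'.2 i)⟩⟩
  generalize x₀ = o at hx₀
  clear vert x₀ hx x
  change Fin (Δ.len + 1) ⥤ D at y
  obtain ⟨b, q, hi, hc⟩ := y
  -- Once the objects of `y` are literally `F.obj (o i)`, its arrows have preimages under `F`
  -- without transport along equalities.
  obtain rfl : (fun i => F.obj (o i)) = b := funext hx₀
  refine ⟨⟨o, fun h => F.preimage (q h), fun i => F.map_injective ?_,
    fun h k => F.map_injective ?_⟩, ⟨?_, fun _ => rfl⟩, ?_⟩
  · rw [F.map_preimage, F.map_id]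
    exact hi i
  · rw [F.map_comp, F.map_preimage, F.map_preimage, F.map_preimage]
    exact hc h k
  · exact CategoryTheory.Functor.hext (fun _ => rfl) fun i j h => heq_of_eq (F.map_preimage (q h))
  · rintro ⟨o', q', hi', hc'⟩ ⟨h1, h2⟩
    obtain rfl : o' = o := funext h2
    refine CategoryTheory.Functor.hext (fun _ => rfl) fun i j h => heq_of_eq (F.map_injective ?_)
    have h3 : F.map (q' h) = q h := eq_of_heq (functor_map_heq h1 h)
    exact h3.trans (F.map_preimage (q h)).symm

theorem reachesVertices_nerveMap {C D : Type u} [Category.{v} C] [Category.{v} D] (F : C ⥤ D)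
    [F.EssSurj] : ReachesVertices (nerveMap F) := by
  intro y
  let d : D := CategoryTheory.Functor.obj (show Fin 1 ⥤ D from y) 0
  refine ⟨ComposableArrows.mk₀ (F.objPreimage d), ComposableArrows.mk₁ (F.objObjPreimageIso d).hom,
    ComposableArrows.ext₀ rfl, ComposableArrows.ext₀ rfl⟩

/-- At each radius the nerve of an equivalence has the three properties; the stalk map is their
colimit over shrinking radii. -/
theorem isWeakEquiv_of_isEquivalence {F F' : Manᵒᵖ ⥤ Grpd.{1, 1}} (ψ : F ⟶ F')
    (h : ∀ (m : ℕ) (r : {r : ℝ // 0 < r}),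
      (show F.obj (op ((ballFunctor m).obj r)) ⥤ F'.obj (op ((ballFunctor m).obj r)) from
        ψ.app (op ((ballFunctor m).obj r))).IsEquivalence) :
    IsWeakEquiv (Functor.whiskerRight ψ groupoidNerve) := by
  intro m
  -- Nonemptiness is what makes the linearly ordered set of radii a filtered index category.
  have : Nonempty {r : ℝ // 0 < r} := ⟨⟨1, one_pos⟩⟩
  let τ := Functor.whiskerLeft (ballFunctor m).op (Functor.whiskerRight ψ groupoidNerve)
  have hτ : ∀ j, Limits.colimit.ι ((ballFunctor m).op ⋙ F ⋙ groupoidNerve) j ≫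
      stalkMap m (Functor.whiskerRight ψ groupoidNerve) =
      τ.app j ≫ Limits.colimit.ι ((ballFunctor m).op ⋙ F' ⋙ groupoidNerve) j := fun j =>
    Limits.ι_colimMap _ _
  refine isWeakEquivSSet_of_liftsSimplices ?_ ?_ ?_
  · exact hasTransport_colimit (Limits.colimit.isColimit _) fun j =>
      hasTransport_nerve (D := F'.obj (op ((ballFunctor m).obj j.unop)))
  · refine liftsSimplices_colimit τ _ hτ (Limits.colimit.isColimit _) (Limits.colimit.isColimit _)
      fun j => ?_
    have := h m j.unop
    exact liftsSimplices_nerveMap (show F.obj (op ((ballFunctor m).obj j.unop)) ⥤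
      F'.obj (op ((ballFunctor m).obj j.unop)) from ψ.app (op ((ballFunctor m).obj j.unop)))
  · refine reachesVertices_colimit τ _ hτ (Limits.colimit.isColimit _) (Limits.colimit.isColimit _)
      fun j => ?_
    have := h m j.unop
    exact reachesVertices_nerveMap (show F.obj (op ((ballFunctor m).obj j.unop)) ⥤
      F'.obj (op ((ballFunctor m).obj j.unop)) from ψ.app (op ((ballFunctor m).obj j.unop)))

end Nerves

end GConn

end

noncomputable section

namespace GConn

/-! ### Principal bundles: translations and lifts of maps from `ℝ^m` -/

section Lifts

variable {G : Man} [Group G] [LieGroup G.I ∞ G] {M : Man} (P : PrincipalBundle G M)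

namespace PrincipalBundle

theorem act_injective (p : P.total) {g h : G} (e : P.act p g = P.act p h) : g = h := by
  obtain ⟨t, ht, -, -, hact⟩ := P.locally_trivial (P.proj.toFun p)
  have hp : p ∈ t.source := t.mem_source.2 ht
  have e' := congrArg (fun q => (t q).2) e
  simp only [hact p hp] at e'
  exact mul_left_cancel e'

/-- In a trivialization the translation from `p` to `q` is the quotient of the fibre coordinates;
this explicit formula is the source of its smoothness. -/
theorem act_trivialization {t : Trivialization G P.proj.toFun}
    (hact : ∀ p ∈ t.source, ∀ g, t (P.act p g) = ((t p).1, (t p).2 * g)) {p q : P.total}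
    (hp : p ∈ t.source) (h : P.proj.toFun p = P.proj.toFun q) :
    P.act p ((t p).2⁻¹ * (t q).2) = q := by
  have hq : q ∈ t.source := t.mem_source.2 (h ▸ t.mem_source.1 hp)
  have hpg : ∀ g, P.act p g ∈ t.source := fun g =>
    t.mem_source.2 (by rw [P.proj_act]; exact t.mem_source.1 hp)
  refine t.toOpenPartialHomeomorph.injOn (hpg _) hq ?_
  refine (hact p hp _).trans (Prod.ext ?_ (mul_inv_cancel_left _ _))
  show (t p).1 = (t q).1
  rw [t.coe_fst hp, t.coe_fst hq, h]

theorem exists_act_eq {p q : P.total} (h : P.proj.toFun p = P.proj.toFun q) :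
    ∃ g, P.act p g = q := by
  obtain ⟨t, ht, -, -, hact⟩ := P.locally_trivial (P.proj.toFun p)
  exact ⟨_, P.act_trivialization hact (t.mem_source.2 ht) h⟩

/-- The element of `G` which carries `p` to the point `q` of the same fibre. -/
def translation (p q : P.total) : G :=
  open Classical in
  if h : P.proj.toFun p = P.proj.toFun q then (P.exists_act_eq h).choose else 1

theorem act_translation {p q : P.total} (h : P.proj.toFun p = P.proj.toFun q) :
    P.act p (P.translation p q) = q := by
  rw [translation, dif_pos h]
  exact (P.exists_act_eq h).choose_spec

theorem translation_eq {p q : P.total} {g : G} (h : P.act p g = q) : P.translation p q = g :=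
  P.act_injective p ((P.act_translation (by rw [← h, P.proj_act])).trans h.symm)

/-! ### Smoothness of translations, and gluing of local lifts -/

section Smooth

variable {E' : Type} [NormedAddCommGroup E'] [NormedSpace ℝ E'] {H' : Type} [TopologicalSpace H']
  {I' : ModelWithCorners ℝ E' H'} {N : Type} [TopologicalSpace N] [ChartedSpace H' N]

theorem contMDiffAt_translation {f k : N → P.total} {x : N}
    (hf : ContMDiffAt I' P.total.I ∞ f x) (hk : ContMDiffAt I' P.total.I ∞ k x)
    (h : ∀ᶠ y in nhds x, P.proj.toFun (f y) = P.proj.toFun (k y)) :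
    ContMDiffAt I' G.I ∞ (fun y => P.translation (f y) (k y)) x := by
  obtain ⟨t, ht, hs, -, hact⟩ := P.locally_trivial (P.proj.toFun (f x))
  have hfx : f x ∈ t.source := t.mem_source.2 ht
  have hkx : k x ∈ t.source := t.mem_source.2 (h.self_of_nhds ▸ ht)
  have hts : ∀ p ∈ t.source, ContMDiffAt P.total.I G.I ∞ (fun p => (t p).2) p := fun p hp =>
    (hs.contMDiffAt (t.open_source.mem_nhds hp)).snd
  have h1 : ContMDiffAt I' G.I ∞ (fun y => (t (f y)).2⁻¹ * (t (k y)).2) x :=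
    ((hts _ hfx).comp x hf).inv.mul ((hts _ hkx).comp x hk)
  refine h1.congr_of_eventuallyEq ?_
  filter_upwards [h, hf.continuousAt (t.open_source.mem_nhds hfx)] with y hy hfy
  exact P.translation_eq (P.act_trivialization hact hfy hy)

theorem contMDiffAt_act {f : N → P.total} {g : N → G} {x : N}
    (hf : ContMDiffAt I' P.total.I ∞ f x) (hg : ContMDiffAt I' G.I ∞ g x) :
    ContMDiffAt I' P.total.I ∞ (fun y => P.act (f y) (g y)) x :=
  (P.smooth_act (f x, g x)).comp x (hf.prodMk hg)

/-- The map `s` is a smooth lift of `Φ` on the open set `U`. -/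
structure IsLiftOn (I' : ModelWithCorners ℝ E' H') (Φ : N → M) (s : N → P.total) (U : Set N) :
    Prop where
  isOpen : IsOpen U
  smooth : ∀ x ∈ U, ContMDiffAt I' P.total.I ∞ s x
  proj_eq : ∀ x ∈ U, P.proj.toFun (s x) = Φ x

theorem exists_isLiftOn_of_mem {Φ : N → M} (hΦ : ContMDiff I' M.I ∞ Φ) (x : N) :
    ∃ (s : N → P.total) (U : Set N), x ∈ U ∧ P.IsLiftOn I' Φ s U := by
  obtain ⟨t, ht, -, hs, -⟩ := P.locally_trivial (Φ x)
  refine ⟨fun y => t.toOpenPartialHomeomorph.symm (Φ y, 1), Φ ⁻¹' t.baseSet, ht,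
    t.open_baseSet.preimage hΦ.continuous, fun y hy => ?_, fun y hy => t.proj_symm_apply' hy⟩
  have hy' : ((Φ y, 1) : M × G) ∈ t.target :=
    t.mem_target.2 hy
  exact (hs.contMDiffAt (t.open_target.mem_nhds hy')).comp y
    ((hΦ y).prodMk contMDiffAt_const)

variable {P} in
/-- Two smooth lifts can be glued if the overlap of their domains admits a retraction. -/
theorem IsLiftOn.glue {Φ : N → M} {s₁ s₂ : N → P.total} {V₁ V₂ U₁ U₂ : Set N}
    (h₁ : P.IsLiftOn I' Φ s₁ U₁) (h₂ : P.IsLiftOn I' Φ s₂ U₂) (hV₁ : IsOpen V₁) (hV₂ : IsOpen V₂)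
    (hVU₁ : V₁ ⊆ U₁) (hVU₂ : V₂ ⊆ U₂) {ρ : N → N} (hρ : ContMDiff I' I' ∞ ρ)
    (hρU : ∀ x ∈ V₂, ρ x ∈ U₁ ∩ U₂) (hρid : ∀ x ∈ V₁ ∩ V₂, ρ x = x) :
    ∃ s, P.IsLiftOn I' Φ s (V₁ ∪ V₂) ∧ ∀ x ∈ V₁, s x = s₁ x := by
  classical
  -- The lift `s₂` is corrected by its difference from `s₁`, read off at the retracted point `ρ x`.
  -- Hence `T` makes sense on all of `V₂`, and it equals `s₁` where `ρ x = x`.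
  let T : N → P.total := fun x => P.act (s₂ x) (P.translation (s₂ (ρ x)) (s₁ (ρ x)))
  have hproj : ∀ x ∈ U₁ ∩ U₂, P.proj.toFun (s₂ x) = P.proj.toFun (s₁ x) := fun x hx => by
    rw [h₂.proj_eq x hx.2, h₁.proj_eq x hx.1]
  let s : N → P.total := fun x => if x ∈ V₁ then s₁ x else T x
  have hs₁ : ∀ x ∈ V₁, s x = s₁ x := fun x hx => if_pos hx
  have hs₂ : ∀ x ∈ V₂, s x = T x := fun x hx => by
    by_cases hx1 : x ∈ V₁
    · rw [hs₁ x hx1]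
      have e := hρid x ⟨hx1, hx⟩
      show s₁ x = P.act (s₂ x) (P.translation (s₂ (ρ x)) (s₁ (ρ x)))
      rw [e, P.act_translation (hproj x (e ▸ hρU x hx))]
    · exact if_neg hx1
  refine ⟨s, ⟨hV₁.union hV₂, ?_, ?_⟩, hs₁⟩
  · rintro x (hx | hx)
    · refine (h₁.smooth x (hVU₁ hx)).congr_of_eventuallyEq ?_
      filter_upwards [hV₁.mem_nhds hx] with y hy using hs₁ y hy
    · have hx' := hρU x hx
      have hT : ContMDiffAt I' P.total.I ∞ T x := by
        refine P.contMDiffAt_act (h₂.smooth x (hVU₂ hx)) (P.contMDiffAt_translation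
          ((h₂.smooth _ hx'.2).comp x (hρ x)) ((h₁.smooth _ hx'.1).comp x (hρ x)) ?_)
        filter_upwards [hV₂.mem_nhds hx] with y hy using hproj _ (hρU y hy)
      refine hT.congr_of_eventuallyEq ?_
      filter_upwards [hV₂.mem_nhds hx] with y hy using hs₂ y hy
  · rintro x (hx | hx)
    · rw [hs₁ x hx, h₁.proj_eq x (hVU₁ hx)]
    · rw [hs₂ x hx, P.proj_act, h₂.proj_eq x (hVU₂ hx)]

/-- The map `Φ` has a smooth lift in a neighbourhood of `S`. -/
def LiftsNear (I' : ModelWithCorners ℝ E' H') (Φ : N → M) (S : Set N) : Prop :=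
  ∃ (s : N → P.total) (U : Set N), S ⊆ U ∧ P.IsLiftOn I' Φ s U

variable {P} in
theorem LiftsNear.mono {Φ : N → M} {S T : Set N} (h : P.LiftsNear I' Φ T) (hST : S ⊆ T) :
    P.LiftsNear I' Φ S := by
  obtain ⟨s, U, hU, hs⟩ := h
  exact ⟨s, U, hST.trans hU, hs⟩

end Smooth

end PrincipalBundle

/-- A smooth function with values in `(-b, b)` which is the identity on `(-a, a)`. -/
theorem exists_smooth_clamp {a b : ℝ} (ha : 0 < a) (hab : a < b) :
    ∃ η : ℝ → ℝ, ContDiff ℝ ∞ η ∧ (∀ t, |t| < a → η t = t) ∧ ∀ t, |η t| < b := by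
  let f : ContDiffBump (0 : ℝ) := ⟨a, b, ha, hab⟩
  -- The identity times a bump function which is `1` for `|t| ≤ a` and `0` for `|t| ≥ b`.
  refine ⟨fun t => f t * t, f.contDiff.mul contDiff_id, fun t ht => ?_, fun t => ?_⟩
  · have : f t = 1 := f.one_of_mem_closedBall (by
      rw [mem_closedBall_zero_iff, Real.norm_eq_abs]; exact ht.le)
    simp only [this, one_mul]
  · by_cases ht : |t| < b
    · rw [abs_mul, abs_of_nonneg f.nonneg]
      exact lt_of_le_of_lt (mul_le_of_le_one_left (abs_nonneg t) f.le_one) ht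
    · have : f t = 0 := f.zero_of_le_dist (by
        rw [dist_zero_right, Real.norm_eq_abs]; exact not_lt.1 ht)
      simp only [this, zero_mul, abs_zero]
      exact ha.trans hab

/-! ### Lifts near boxes and closed balls, and on all of `ℝ^m` -/

namespace PrincipalBundle

variable {m : ℕ} {Φ : (Fin m → ℝ) → M}

/-- Both lifts exist near the compact slice `x i = c` of the box. Clamping the `i`-th coordinate
towards `c` retracts a neighbourhood of the second half into the overlap near this slice. -/
theorem liftsNear_Icc_of_halves {a b : Fin m → ℝ} {i : Fin m} {c : ℝ} (hac : a i ≤ c)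
    (h₁ : P.LiftsNear 𝓘(ℝ, Fin m → ℝ) Φ (Set.Icc a b ∩ {x | x i ≤ c}))
    (h₂ : P.LiftsNear 𝓘(ℝ, Fin m → ℝ) Φ (Set.Icc a b ∩ {x | c ≤ x i})) :
    P.LiftsNear 𝓘(ℝ, Fin m → ℝ) Φ (Set.Icc a b) := by
  obtain ⟨s₁, U₁, hU₁, hs₁⟩ := h₁
  obtain ⟨s₂, U₂, hU₂, hs₂⟩ := h₂
  have hF : IsCompact (Set.Icc a b ∩ {x | x i = c}) :=
    isCompact_Icc.inter_right (isClosed_eq (continuous_apply i) continuous_const)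
  have hFU : Set.Icc a b ∩ {x | x i = c} ⊆ U₁ ∩ U₂ := fun x hx =>
    ⟨hU₁ ⟨hx.1, le_of_eq hx.2⟩, hU₂ ⟨hx.1, ge_of_eq hx.2⟩⟩
  obtain ⟨ε, hε, hεU⟩ := hF.exists_thickening_subset_open (hs₁.isOpen.inter hs₂.isOpen) hFU
  obtain ⟨η, hη, hη1, hη2⟩ := exists_smooth_clamp (half_pos hε) (half_lt_self hε)
  let ρ : (Fin m → ℝ) → Fin m → ℝ := fun x => Function.update x i (c + η (x i - c))
  have hρ : ContDiff ℝ ∞ ρ := by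
    refine contDiff_pi.2 fun j => ?_
    by_cases hj : j = i
    · subst hj
      simp only [ρ, Function.update_self]
      exact contDiff_const.add (hη.comp ((contDiff_apply ℝ ℝ j).sub contDiff_const))
    · simp only [ρ, Function.update_of_ne hj]
      exact contDiff_apply ℝ ℝ j
  let V₁ := U₁ ∩ {x | x i < c + ε / 2}
  -- The preimage under `ρ` is part of the definition since `ρ x` is known to lie in the overlap
  -- only for `x` in the box; the remaining points of `U₂` are discarded.
  let V₂ := (U₂ ∩ {x | c - ε / 2 < x i}) ∩ ρ ⁻¹' (U₁ ∩ U₂)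
  have hV₁ : IsOpen V₁ := hs₁.isOpen.inter (isOpen_lt (continuous_apply i) continuous_const)
  have hV₂ : IsOpen V₂ := (hs₂.isOpen.inter (isOpen_lt continuous_const (continuous_apply i))).inter
    ((hs₁.isOpen.inter hs₂.isOpen).preimage hρ.continuous)
  obtain ⟨s, hs, -⟩ := hs₁.glue hs₂ hV₁ hV₂ Set.inter_subset_left
    (Set.inter_subset_left.trans Set.inter_subset_left) hρ.contMDiff (fun x hx => hx.2)
    (fun x hx => by
      have h1 : x i < c + ε / 2 := hx.1.2
      have h2 : c - ε / 2 < x i := hx.2.1.2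
      simp only [ρ]
      rw [hη1 _ (abs_lt.2 ⟨by linarith, by linarith⟩), add_sub_cancel, Function.update_eq_self])
  refine ⟨s, V₁ ∪ V₂, fun x hx => ?_, hs⟩
  rcases le_or_gt (x i) c with hxc | hxc
  · exact Or.inl ⟨hU₁ ⟨hx, hxc⟩, by show x i < c + ε / 2; linarith⟩
  · refine Or.inr ⟨⟨hU₂ ⟨hx, hxc.le⟩, by show c - ε / 2 < x i; linarith⟩, hεU ?_⟩
    refine Metric.mem_thickening_iff.2 ⟨Function.update x i c, ⟨⟨?_, ?_⟩, ?_⟩, ?_⟩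
    · exact le_update_iff.2 ⟨hac, fun j _ => hx.1 j⟩
    · exact update_le_iff.2 ⟨hxc.le.trans (hx.2 i), fun j _ => hx.2 j⟩
    · exact Function.update_self _ _ _
    · refine (dist_pi_lt_iff hε).2 fun j => ?_
      by_cases hj : j = i
      · subst hj
        simp only [ρ, Function.update_self, Real.dist_eq, add_sub_cancel_left]
        exact hη2 _
      · simp only [ρ, Function.update_of_ne hj, dist_self]
        exact hε

/-- By the Lebesgue number `δ`, a box with sides at most `δ / 2` lies in the domain of one local
lift. Larger boxes are cut into slabs, one coordinate direction after the other. -/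
theorem liftsNear_Icc (hΦ : ContMDiff 𝓘(ℝ, Fin m → ℝ) M.I ∞ Φ) (a₀ b₀ : Fin m → ℝ) :
    P.LiftsNear 𝓘(ℝ, Fin m → ℝ) Φ (Set.Icc a₀ b₀) := by
  choose s U hxU hsU using fun x => P.exists_isLiftOn_of_mem hΦ x
  obtain ⟨δ, hδ, hball⟩ := lebesgue_number_lemma_of_metric (isCompact_Icc (a := a₀) (b := b₀))
    (fun x => (hsU x).isOpen) (fun x _ => Set.mem_iUnion.2 ⟨x, hxU x⟩)
  have small : ∀ a b : Fin m → ℝ, Set.Icc a b ⊆ Set.Icc a₀ b₀ → (∀ i, b i - a i ≤ δ / 2) →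
      P.LiftsNear 𝓘(ℝ, Fin m → ℝ) Φ (Set.Icc a b) := by
    intro a b hab hd
    by_cases hle : a ≤ b
    · obtain ⟨x, hx⟩ := hball a (hab ⟨le_rfl, hle⟩)
      refine ⟨s x, U x, fun y hy => hx (Metric.mem_ball.2 ?_), hsU x⟩
      refine (dist_pi_lt_iff hδ).2 fun i => ?_
      rw [Real.dist_eq, abs_lt]
      have := hy.1 i
      have := hy.2 i
      have := hd i
      constructor <;> linarith
    · exact ⟨s a, U a, by rw [Set.Icc_eq_empty hle]; exact Set.empty_subset _, hsU a⟩
  -- `T` contains the directions in which the box may still be long. The inner induction bounds the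
  -- number of slabs of thickness `δ / 2` in the new direction `i`.
  have key : ∀ (T : Finset (Fin m)) (a b : Fin m → ℝ), Set.Icc a b ⊆ Set.Icc a₀ b₀ →
      (∀ i ∉ T, b i - a i ≤ δ / 2) → P.LiftsNear 𝓘(ℝ, Fin m → ℝ) Φ (Set.Icc a b) := by
    intro T
    induction T using Finset.induction_on with
    | empty => exact fun a b hab hd => small a b hab fun i => hd i (Finset.notMem_empty i)
    | insert i T hi ih =>
      have step : ∀ (n : ℕ) (a b : Fin m → ℝ), Set.Icc a b ⊆ Set.Icc a₀ b₀ →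
          (∀ j ∉ insert i T, b j - a j ≤ δ / 2) → b i - a i ≤ n * (δ / 2) →
          P.LiftsNear 𝓘(ℝ, Fin m → ℝ) Φ (Set.Icc a b) := by
        intro n
        induction n with
        | zero =>
          intro a b hab hd hn
          refine ih a b hab fun j hj => ?_
          by_cases hji : j = i
          · subst hji
            rw [Nat.cast_zero, zero_mul] at hn
            linarith
          · exact hd j (by simp [hji, hj])
        | succ n ihn =>
          intro a b hab hd hn
          by_cases hs : b i - a i ≤ δ / 2
          · refine ih a b hab fun j hj => ?_
            by_cases hji : j = i
            · subst hji
              exact hs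
            · exact hd j (by simp [hji, hj])
          · rw [not_le] at hs
            refine P.liftsNear_Icc_of_halves (i := i) (c := a i + δ / 2) (by linarith) ?_ ?_
            · refine LiftsNear.mono (T := Set.Icc a (Function.update b i (a i + δ / 2)))
                (ih _ _ ?_ fun j hj => ?_) ?_
              · exact (Set.Icc_subset_Icc_right (update_le_iff.2
                  ⟨by linarith, fun j _ => le_rfl⟩)).trans hab
              · by_cases hji : j = i
                · subst hji
                  rw [Function.update_self]
                  linarith
                · rw [Function.update_of_ne hji]
                  exact hd j (by simp [hji, hj])
              · exact fun x hx => ⟨hx.1.1, le_update_iff.2 ⟨hx.2, fun j _ => hx.1.2 j⟩⟩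
            · refine LiftsNear.mono (T := Set.Icc (Function.update a i (a i + δ / 2)) b)
                (ihn _ _ ?_ (fun j hj => ?_) ?_) ?_
              · exact (Set.Icc_subset_Icc_left (le_update_iff.2
                  ⟨by linarith, fun j _ => le_rfl⟩)).trans hab
              · have hji : j ≠ i := fun h => hj (by simp [h])
                rw [Function.update_of_ne hji]
                exact hd j hj
              · rw [Function.update_self]
                push_cast at hn
                linarith
              · exact fun x hx => ⟨update_le_iff.2 ⟨hx.2, fun j _ => hx.1.1 j⟩, hx.1.2⟩
      intro a b hab hd
      obtain ⟨n, hn⟩ := exists_nat_ge ((b i - a i) / (δ / 2))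
      exact step n a b hab hd ((div_le_iff₀ (half_pos hδ)).1 hn)
  exact key Finset.univ a₀ b₀ subset_rfl fun i hi => absurd (Finset.mem_univ i) hi

/-- The norm on `Fin m → ℝ` is the sup norm, so this ball is contained in a box. -/
theorem liftsNear_closedBall (hΦ : ContMDiff 𝓘(ℝ, Fin m → ℝ) M.I ∞ Φ) (r : ℝ) :
    P.LiftsNear 𝓘(ℝ, Fin m → ℝ) Φ (Metric.closedBall 0 r) := by
  refine (P.liftsNear_Icc hΦ (fun _ => -r) (fun _ => r)).mono fun x hx => ?_
  rw [mem_closedBall_zero_iff] at hx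
  have h : ∀ i, |x i| ≤ r := fun i => (norm_le_pi_norm x i).trans hx
  exact ⟨fun i => (abs_le.1 (h i)).1, fun i => (abs_le.1 (h i)).2⟩

variable {P} in
-- A lift near the larger ball is corrected to agree with `s`. Agreement on the smaller ball is
-- exact, so that successive extensions have a limit.
theorem IsLiftOn.extend (hΦ : ContMDiff 𝓘(ℝ, Fin m → ℝ) M.I ∞ Φ) {s : (Fin m → ℝ) → P.total}
    {U : Set (Fin m → ℝ)} (h : P.IsLiftOn 𝓘(ℝ, Fin m → ℝ) Φ s U) {r r' : ℝ} (hr : 0 ≤ r)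
    (hrr' : r ≤ r') (hU : Metric.closedBall 0 r ⊆ U) :
    ∃ (s' : (Fin m → ℝ) → P.total) (U' : Set (Fin m → ℝ)),
      (P.IsLiftOn 𝓘(ℝ, Fin m → ℝ) Φ s' U' ∧ Metric.closedBall 0 r' ⊆ U') ∧
      ∀ x ∈ Metric.closedBall 0 r, s' x = s x := by
  obtain ⟨s₂, U₂, hU₂, hs₂⟩ := P.liftsNear_closedBall hΦ r'
  obtain ⟨ε, hε, hεU⟩ := (isCompact_closedBall (0 : Fin m → ℝ) r).exists_thickening_subset_open
    (h.isOpen.inter hs₂.isOpen) (Set.subset_inter hU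
      ((Metric.closedBall_subset_closedBall hrr').trans hU₂))
  rw [thickening_closedBall hε hr] at hεU
  -- Clamping every coordinate sends all of `ℝ^m` into the ball of radius `r + ε`, on which both
  -- lifts exist, and fixes the ball of radius `r + ε / 2`, because the norm is the sup norm.
  obtain ⟨η, hη, hη1, hη2⟩ := exists_smooth_clamp (a := r + ε / 2) (b := ε + r) (by linarith)
    (by linarith)
  let ρ : (Fin m → ℝ) → Fin m → ℝ := fun x i => η (x i)
  have hρ : ContDiff ℝ ∞ ρ := contDiff_pi.2 fun j => hη.comp (contDiff_apply ℝ ℝ j)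
  have hρU : ∀ x, ρ x ∈ U ∩ U₂ := fun x => hεU (by
    rw [mem_ball_zero_iff]
    exact (pi_norm_lt_iff (by linarith)).2 fun i => hη2 _)
  obtain ⟨s', hs', hs'1⟩ := h.glue hs₂ (V₁ := U ∩ Metric.ball 0 (r + ε / 2)) (V₂ := U₂)
    (h.isOpen.inter Metric.isOpen_ball) hs₂.isOpen Set.inter_subset_left subset_rfl hρ.contMDiff
    (fun x _ => hρU x) (fun x hx => funext fun i => hη1 _ (by
      have := hx.1.2
      rw [mem_ball_zero_iff] at this
      exact (norm_le_pi_norm x i).trans_lt this))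
  refine ⟨s', _, ⟨hs', hU₂.trans Set.subset_union_right⟩, fun x hx => hs'1 x ⟨hU hx, ?_⟩⟩
  exact Metric.closedBall_subset_ball (by linarith) hx

/-- Every smooth map from `ℝ^m` to the base of a principal bundle lifts to the total space. -/
theorem exists_smooth_lift (hΦ : ContMDiff 𝓘(ℝ, Fin m → ℝ) M.I ∞ Φ) :
    ∃ s : (Fin m → ℝ) → P.total, ContMDiff 𝓘(ℝ, Fin m → ℝ) P.total.I ∞ s ∧
      ∀ x, P.proj.toFun (s x) = Φ x := by
  let A : ℕ → Type := fun n => {q : ((Fin m → ℝ) → P.total) × Set (Fin m → ℝ) //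
    P.IsLiftOn 𝓘(ℝ, Fin m → ℝ) Φ q.1 q.2 ∧ Metric.closedBall 0 (n : ℝ) ⊆ q.2}
  have hnext : ∀ (n : ℕ) (q : A n), ∃ q' : A (n + 1), ∀ x ∈ Metric.closedBall 0 (n : ℝ),
      q'.1.1 x = q.1.1 x := fun n q => by
    obtain ⟨s', U', h, e⟩ := q.2.1.extend hΦ (Nat.cast_nonneg n)
      (show (n : ℝ) ≤ ((n + 1 : ℕ) : ℝ) by push_cast; linarith) q.2.2
    exact ⟨⟨(s', U'), h⟩, e⟩
  choose next hnext using hnext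
  obtain ⟨s₀, U₀, hU₀, hs₀⟩ := P.liftsNear_closedBall hΦ ((0 : ℕ) : ℝ)
  let S : ∀ n, A n := fun n => Nat.rec ⟨(s₀, U₀), hs₀, hU₀⟩ next n
  have hS : ∀ k n : ℕ, n ≤ k → ∀ x ∈ Metric.closedBall 0 (n : ℝ), (S k).1.1 x = (S n).1.1 x := by
    intro k n hnk
    induction k, hnk using Nat.le_induction with
    | base => exact fun _ _ => rfl
    | succ k hk ih =>
      intro x hx
      refine Eq.trans (hnext k (S k) x ?_) (ih x hx)
      exact Metric.closedBall_subset_closedBall (Nat.cast_le.2 hk) hx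
  -- The limit lift uses stage `⌈‖x‖⌉` at `x`. On the ball of radius `n` it coincides with stage
  -- `n`, hence it is smooth.
  have hS' : ∀ (n : ℕ) (x : Fin m → ℝ), ‖x‖ ≤ n → (S ⌈‖x‖⌉₊).1.1 x = (S n).1.1 x :=
    fun n x hx => (hS n _ (Nat.ceil_le.2 hx) x
      (mem_closedBall_zero_iff.2 (Nat.le_ceil _))).symm
  refine ⟨fun x => (S ⌈‖x‖⌉₊).1.1 x, fun x => ?_, fun x => ?_⟩
  · obtain ⟨n, hn⟩ := exists_nat_gt ‖x‖
    refine ((S n).2.1.smooth x ((S n).2.2 (mem_closedBall_zero_iff.2 hn.le))).congr_of_eventuallyEq ?_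
    filter_upwards [Metric.isOpen_ball.mem_nhds (mem_ball_zero_iff.2 hn)] with y hy
    exact hS' n y (mem_ball_zero_iff.1 hy).le
  · exact (S _).2.1.proj_eq x ((S _).2.2 (mem_closedBall_zero_iff.2 (Nat.le_ceil _)))

/-- A principal bundle over a ball has a smooth section. -/
theorem exists_smooth_section {m : ℕ} {r : ℝ} (hr : 0 < r)
    (P : PrincipalBundle G (Man.ball m r)) :
    ∃ s : Man.ball m r → P.total, ContMDiff (Man.ball m r).I P.total.I ∞ s ∧
      ∀ x, P.proj.toFun (s x) = x := by
  let L : EuclideanSpace ℝ (Fin m) ≃L[ℝ] (Fin m → ℝ) := EuclideanSpace.equiv (Fin m) ℝ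
  -- A diffeomorphism from the whole space onto the ball. The section is a lift of `B` composed with
  -- the inverse of `B`.
  let B := OpenPartialHomeomorph.univBall (0 : EuclideanSpace ℝ (Fin m)) r
  have hB : ∀ v, B v ∈ Metric.ball (0 : EuclideanSpace ℝ (Fin m)) r := fun v => by
    rw [← OpenPartialHomeomorph.univBall_target 0 hr]
    exact B.map_source (by rw [OpenPartialHomeomorph.univBall_source]; trivial)
  let Φ : (Fin m → ℝ) → Man.ball m r := fun v => ⟨B (L.symm v), hB _⟩
  have hΦ : ContMDiff 𝓘(ℝ, Fin m → ℝ) (Man.ball m r).I ∞ Φ := by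
    refine (ContMDiff.subtypeVal_comp_iff _ Φ).1 ?_
    exact (OpenPartialHomeomorph.contDiff_univBall.comp L.symm.contDiff).contMDiff
  obtain ⟨s, hs, hsΦ⟩ := P.exists_smooth_lift hΦ
  refine ⟨fun x => s (L (B.symm x.1)), hs.comp ?_, fun x => ?_⟩
  · intro x
    refine (L.contDiff.contMDiff _).comp x ?_
    refine contMDiffAt_subtype_iff.2 ?_
    exact (OpenPartialHomeomorph.contDiffOn_univBall_symm.contDiffAt
      (Metric.isOpen_ball.mem_nhds x.2)).contMDiffAt
  · rw [hsΦ]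
    refine Subtype.ext ?_
    show B (L.symm (L (B.symm x.1))) = x.1
    rw [L.symm_apply_apply, B.right_inv]
    rw [OpenPartialHomeomorph.univBall_target 0 hr]
    exact x.2

end PrincipalBundle

end Lifts

end GConn

end

noncomputable section

namespace GConn

/-! ### Connections on bundles with a section -/

section Sections

variable {G : Man} [Group G] [LieGroup G.I ∞ G] {M : Man}

section

variable {E' : Type} [NormedAddCommGroup E'] [NormedSpace ℝ E'] {H' : Type} [TopologicalSpace H']
  {I' : ModelWithCorners ℝ E' H'} {N : Type} [TopologicalSpace N] [ChartedSpace H' N]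
  [IsManifold I' ∞ N]

/-- The Leibniz rule for the action: the chain rule, with the differential on the product split into
its partial differentials. -/
theorem comps_tangentMap_act (P : PrincipalBundle G M) {f : N → P.total} {k : N → G}
    (hf : ContMDiff I' P.total.I ∞ f) (hk : ContMDiff I' G.I ∞ k) (v : TangentBundle I' N) :
    comps (tangentMap I' P.total.I (fun x => P.act (f x) (k x)) v) =
      comps (tangentMap P.total.I P.total.I (fun p => P.act p (k v.proj))
        (tangentMap I' P.total.I f v)) +
      comps (tangentMap G.I P.total.I (fun g => P.act (f v.proj) g) (tangentMap I' G.I k v)) := by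
  have hd : MDifferentiableAt I' (P.total.I.prod G.I) (fun x => (f x, k x)) v.proj :=
    (hf.prodMk hk).mdifferentiable (by simp) _
  have hm := P.smooth_act.mdifferentiable (by simp) (f v.proj, k v.proj)
  have h2 := mfderiv_comp_apply (I := I') (I' := P.total.I.prod G.I) (I'' := P.total.I)
    v.proj hm hd v.snd
  have h3 := mfderiv_prodMk (hf.mdifferentiable (by simp) v.proj)
    (hk.mdifferentiable (by simp) v.proj)
  have h4 := mfderiv_prod_eq_add_apply
    (v := mfderiv I' (P.total.I.prod G.I) (fun x => (f x, k x)) v.proj v.snd) hm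
  rw [h3] at h4
  refine Eq.trans h2 ?_
  rw [h3]
  exact h4

/-- The two axioms of a connection evaluate the two Leibniz summands: equivariance gives `Ad_{k⁻¹}
f^*Θ`, restriction to the fibres gives `k^*θ`. -/
theorem Connection.form_pull_act (P : Connection G M) {f : N → P.total} {k : N → G}
    (hf : ContMDiff I' P.total.I ∞ f) (hk : ContMDiff I' G.I ∞ k) :
    P.form.pull (fun x => P.act (f x) (k x)) (P.smooth_act.comp (hf.prodMk hk)) =
      (P.form.pull f hf).gauge G.I k hk := by
  refine OneForm.ext fun v => ?_
  have h := comps_tangentMap_act P.toPrincipalBundle hf hk v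
  have h1 : tangentMap I' P.total.I (fun x => P.act (f x) (k x)) v =
      vec P.total.I (P.act (f v.proj) (k v.proj))
        (comps (tangentMap P.total.I P.total.I (fun p => P.act p (k v.proj))
          (tangentMap I' P.total.I f v)) +
        comps (tangentMap G.I P.total.I (fun g => P.act (f v.proj) g)
          (tangentMap I' G.I k v))) := by
    rw [← h]
    rfl
  have h2 : P.form (tangentMap I' P.total.I (fun x => P.act (f x) (k x)) v) =
      P.form (tangentMap P.total.I P.total.I (fun p => P.act p (k v.proj))
          (tangentMap I' P.total.I f v)) +
      P.form (tangentMap G.I P.total.I (fun g => P.act (f v.proj) g) (tangentMap I' G.I k v)) := by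
    rw [h1]
    exact P.form.map_add' _ _ _
  rw [P.restrict_fibre, P.equivariant] at h2
  exact h2.trans (add_comm _ _)

theorem trivialConnection_pull_pair (α : OneForm M.I M G.E) {f : N → M} (hf : ContMDiff I' M.I ∞ f)
    {k : N → G} (hk : ContMDiff I' G.I ∞ k) :
    (trivialConnection M α).form.pull (fun x => ((f x, k x) : M × G)) (hf.prodMk hk) =
      (α.pull f hf).gauge G.I k hk := by
  refine (pull_gauge G.I (α.pull (M := M × G) Prod.fst contMDiff_fst) contMDiff_snd
    (hf.prodMk hk)).trans ?_
  rw [OneForm.pull_pull]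

end

/-- The trivialization of a `G`-connection determined by a section `s`: an isomorphism from the
trivial bundle with the connection `s^*Θ + θ`. -/
def Connection.isoOfSection (P : Connection G M) (s : M → P.total)
    (hs : ContMDiff M.I P.total.I ∞ s) (hsP : ∀ x, P.proj.toFun (s x) = x) :
    trivialConnection M (P.form.pull s hs) ⟶ P where
  toFun p := P.act (s p.1) p.2
  invFun q := (P.proj.toFun q, P.translation (s (P.proj.toFun q)) q)
  left_inv p := by
    have h : P.proj.toFun (P.act (s p.1) p.2) = p.1 := by rw [P.proj_act, hsP]
    refine Prod.ext h ?_
    show P.translation (s (P.proj.toFun (P.act (s p.1) p.2))) (P.act (s p.1) p.2) = p.2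
    rw [h]
    exact P.translation_eq rfl
  right_inv q := P.act_translation (hsP _)
  smooth := P.smooth_act.comp ((hs.comp contMDiff_fst).prodMk contMDiff_snd)
  smooth_inv := P.proj.smooth.prodMk fun q =>
    P.contMDiffAt_translation ((hs.comp P.proj.smooth) q) contMDiffAt_id
      (Filter.Eventually.of_forall fun _ => hsP _)
  proj_toFun p := by
    show P.proj.toFun (P.act (s p.1) p.2) = p.1
    rw [P.proj_act, hsP]
  equivariant p g := P.act_mul (s p.1) p.2 g
  pull_form := by
    have hk : ContMDiff (M.I.prod G.I) G.I ∞ (Prod.snd : M × G → G) := contMDiff_snd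
    have hf : ContMDiff (M.I.prod G.I) P.total.I ∞ (fun p : M × G => s p.1) :=
      hs.comp contMDiff_fst
    have h := P.form_pull_act hf hk
    have h' : (P.form.pull (fun p : M × G => s p.1) hf).gauge G.I Prod.snd hk =
        ((P.form.pull s hs).pull (M := M × G) Prod.fst contMDiff_fst).gauge G.I Prod.snd hk := by
      rw [OneForm.pull_pull]
    exact h.trans h'

/-- An isomorphism of trivial bundles with connection is given by a gauge transformation. -/
theorem exists_eq_trivialIso {α β : OneForm M.I M G.E}
    (φ : trivialConnection M α ⟶ trivialConnection M β) :
    ∃ (g : M → G) (hg : ContMDiff M.I G.I ∞ g) (h : β = α.gauge G.I g hg),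
      trivialIso g hg h = φ := by
  let σ : M → M × G := fun x => (x, 1)
  have hσ : ContMDiff M.I (M.I.prod G.I) ∞ σ := contMDiff_id.prodMk contMDiff_const
  -- By equivariance `φ` is determined by its values on the unit section: it is left multiplication
  -- by `k`. As `trivialIso g` multiplies by `g⁻¹`, the gauge transformation sought is `k⁻¹`.
  let k : M → G := fun x => (φ.toFun (σ x)).2
  have hk : ContMDiff M.I G.I ∞ k := contMDiff_snd.comp (φ.smooth.comp hσ)
  have hφσ : ∀ x, φ.toFun (σ x) = (x, k x) := fun x => Prod.ext (φ.proj_toFun (σ x)) rfl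
  have hφ : ∀ p : M × G, φ.toFun p = (p.1, k p.1 * p.2) := fun p => by
    have h1 := φ.equivariant (σ p.1) p.2
    have h2 : (trivialConnection M α).act (σ p.1) p.2 = p := Prod.ext rfl (one_mul p.2)
    rw [h2, hφσ] at h1
    exact h1
  -- Pulling `φ^*Θ = Θ'` back along the unit section yields `α = β · k`, hence `β = α · k⁻¹`.
  have h1 := congrArg (fun τ => OneForm.pull σ hσ τ) φ.pull_form
  have h2 : (trivialConnection M α).form.pull σ hσ = α := by
    refine (trivialConnection_pull_pair α contMDiff_id contMDiff_const).trans ?_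
    rw [gauge_one]
    exact OneForm.pull_id α
  have h3 : ((trivialConnection M β).form.pull φ.toFun φ.smooth).pull σ hσ = β.gauge G.I k hk := by
    let Θ : OneForm (M.I.prod G.I) (M × G) G.E := (trivialConnection M β).form
    let Φ : M × G → M × G := φ.toFun
    have hΦ : ContMDiff (M.I.prod G.I) (M.I.prod G.I) ∞ Φ := φ.smooth
    have h : (Θ.pull Φ hΦ).pull σ hσ = Θ.pull (fun x => Φ (σ x)) (hΦ.comp hσ) :=
      OneForm.pull_pull hΦ hσ Θ
    have hpk : ContMDiff M.I (M.I.prod G.I) ∞ (fun x => ((x, k x) : M × G)) :=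
      contMDiff_id.prodMk hk
    have h' : Θ.pull (fun x => Φ (σ x)) (hΦ.comp hσ) = Θ.pull (fun x => (x, k x)) hpk :=
      pull_congr Θ hφσ _ _
    refine h.trans (h'.trans ((trivialConnection_pull_pair β contMDiff_id hk).trans ?_))
    exact gauge_congr G.I (OneForm.pull_id β) (fun _ => rfl) _ _
  have h4 : α = β.gauge G.I k hk := h2.symm.trans (h1.symm.trans h3)
  refine ⟨fun x => (k x)⁻¹, hk.inv, ?_, Connection.Iso.ext fun p => ?_⟩
  · rw [h4, gauge_gauge]
    exact (gauge_one G.I β).symm.trans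
      (gauge_congr G.I rfl (fun x => (mul_inv_cancel _).symm) _ _)
  · have e : ((p.1, (k p.1)⁻¹⁻¹ * p.2) : M × G) = (p.1, k p.1 * p.2) := by rw [inv_inv]
    exact e.trans (hφ p).symm

instance : (BTriv.toConnection (G := G) M).Full where
  map_surjective φ := by
    obtain ⟨g, hg, h, e⟩ := exists_eq_trivialIso φ
    exact ⟨⟨g, hg, h⟩, e⟩

theorem trivialIso_injective {α β : OneForm M.I M G.E} {g g' : M → G} {hg : ContMDiff M.I G.I ∞ g}
    {hg' : ContMDiff M.I G.I ∞ g'} {h : β = α.gauge G.I g hg} {h' : β = α.gauge G.I g' hg'}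
    (e : trivialIso g hg h = trivialIso g' hg' h') (x : M) : g x = g' x := by
  have e1 := congrArg (fun φ : Connection.Iso (trivialConnection M α) (trivialConnection M β) =>
    (φ.toFun (x, (1 : G))).2) e
  have e2 : (g x)⁻¹ * 1 = (g' x)⁻¹ * 1 := e1
  exact inv_injective (mul_right_cancel e2)

instance : (BTriv.toConnection (G := G) M).Faithful where
  map_injective {_ _ g g'} e := BTriv.Hom.ext (trivialIso_injective (hg := BTriv.Hom.smooth g)
    (hg' := BTriv.Hom.smooth g') (h := BTriv.Hom.eq_gauge g) (h' := BTriv.Hom.eq_gauge g') e)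

theorem isEquivalence_toConnection (hM : ∀ P : PrincipalBundle G M, ∃ s : M → P.total,
    ContMDiff M.I P.total.I ∞ s ∧ ∀ x, P.proj.toFun (s x) = x) :
    (BTriv.toConnection (G := G) M).IsEquivalence where
  essSurj := ⟨fun P => by
    obtain ⟨s, hs, hsP⟩ := hM P.toPrincipalBundle
    exact ⟨⟨P.form.pull s hs⟩, ⟨(Groupoid.isoEquivHom _ _).symm (P.isoOfSection s hs hsP)⟩⟩⟩

end Sections

end GConn

end

noncomputable section

namespace GConn

/-! ### Compatible systems of connections are determined by their value at the identity -/

section Evaluation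

variable {G : Man} [Group G] [LieGroup G.I ∞ G] {M N : Man}

/-! ### Bundle maps are bijective on fibres, hence cartesian -/

namespace BundleMap

variable {f : N ⟶ M} {Q Q' : Connection G N} {P : Connection G M}

/-- An equivariant map between fibres respects the differences of points, and the action on the
target is free. -/
theorem injective_on_fibres (φ : BundleMap f Q P) {q q' : Q.total}
    (hq : Q.proj.toFun q = Q.proj.toFun q') (h : φ.toFun q = φ.toFun q') : q = q' := by
  obtain ⟨g, rfl⟩ := Q.exists_act_eq hq
  have h1 : P.act (φ.toFun q) 1 = P.act (φ.toFun q) g := by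
    rw [P.act_one, ← φ.equivariant, ← h]
  rw [← P.act_injective _ h1, Q.act_one]

theorem exists_toFun_eq (φ : BundleMap f Q P) (x : N) {p : P.total}
    (h : P.proj.toFun p = f.toFun x) :
    ∃ q, Q.proj.toFun q = x ∧ φ.toFun q = p := by
  obtain ⟨s, U, hx, hs⟩ := Q.exists_isLiftOn_of_mem (I' := N.I) contMDiff_id x
  have h1 : P.proj.toFun (φ.toFun (s x)) = P.proj.toFun p := by
    rw [φ.proj_toFun, hs.proj_eq x hx, h]
    rfl
  refine ⟨Q.act (s x) (P.translation (φ.toFun (s x)) p), ?_, ?_⟩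
  · rw [Q.proj_act, hs.proj_eq x hx]
    rfl
  · rw [φ.equivariant, P.act_translation h1]

/-- The factorization through the bundle map `φ` of another bundle map `χ` covering the same
map. -/
def liftFun (φ : BundleMap f Q P) (χ : BundleMap f Q' P) (q : Q'.total) : Q.total :=
  (φ.exists_toFun_eq (Q'.proj.toFun q) (χ.proj_toFun q)).choose

theorem proj_liftFun (φ : BundleMap f Q P) (χ : BundleMap f Q' P) (q : Q'.total) :
    Q.proj.toFun (φ.liftFun χ q) = Q'.proj.toFun q :=
  (φ.exists_toFun_eq (Q'.proj.toFun q) (χ.proj_toFun q)).choose_spec.1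

theorem toFun_liftFun (φ : BundleMap f Q P) (χ : BundleMap f Q' P) (q : Q'.total) :
    φ.toFun (φ.liftFun χ q) = χ.toFun q :=
  (φ.exists_toFun_eq (Q'.proj.toFun q) (χ.proj_toFun q)).choose_spec.2

theorem liftFun_eq (φ : BundleMap f Q P) (χ : BundleMap f Q' P) {q : Q'.total} {p : Q.total}
    (hp : Q.proj.toFun p = Q'.proj.toFun q) (h : φ.toFun p = χ.toFun q) :
    φ.liftFun χ q = p :=
  φ.injective_on_fibres ((φ.proj_liftFun χ q).trans hp.symm) ((φ.toFun_liftFun χ q).trans h.symm)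

/-- Locally the factorization is a smooth section `s` of `Q` moved by the translation from `φ ∘ s`
to `χ`, which is smooth. -/
theorem contMDiff_liftFun (φ : BundleMap f Q P) (χ : BundleMap f Q' P) :
    ContMDiff Q'.total.I Q.total.I ∞ (φ.liftFun χ) := fun q => by
  obtain ⟨s, U, hx, hs⟩ := Q.exists_isLiftOn_of_mem (I' := N.I) contMDiff_id (Q'.proj.toFun q)
  have hσ : ContMDiffAt Q'.total.I Q.total.I ∞ (fun y => s (Q'.proj.toFun y)) q :=
    (hs.smooth _ hx).comp q (Q'.proj.smooth q)
  have hU : ∀ᶠ y in nhds q, Q'.proj.toFun y ∈ U :=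
    Q'.proj.smooth.continuous.continuousAt (hs.isOpen.mem_nhds hx)
  have hproj : ∀ y, Q'.proj.toFun y ∈ U →
      P.proj.toFun (φ.toFun (s (Q'.proj.toFun y))) = P.proj.toFun (χ.toFun y) := fun y hy => by
    rw [φ.proj_toFun, χ.proj_toFun, hs.proj_eq _ hy]
    rfl
  have hφσ : ContMDiffAt Q'.total.I P.total.I ∞ (fun y => φ.toFun (s (Q'.proj.toFun y))) q :=
    (φ.smooth _).comp q hσ
  refine (Q.contMDiffAt_act hσ (P.contMDiffAt_translation hφσ (χ.smooth q)
    (hU.mono hproj))).congr_of_eventuallyEq ?_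
  filter_upwards [hU] with y hy
  refine φ.liftFun_eq χ ?_ ?_
  · rw [Q.proj_act, hs.proj_eq _ hy]
    rfl
  · rw [φ.equivariant, P.act_translation (hproj y hy)]

/-- Two bundle maps to the same connection covering the same map differ by an isomorphism. -/
def lift (φ : BundleMap f Q P) (χ : BundleMap f Q' P) : Q' ⟶ Q where
  toFun := φ.liftFun χ
  invFun := χ.liftFun φ
  left_inv q := χ.liftFun_eq φ (φ.proj_liftFun χ q).symm (φ.toFun_liftFun χ q).symm
  right_inv q := φ.liftFun_eq χ (χ.proj_liftFun φ q).symm (χ.toFun_liftFun φ q).symm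
  smooth := φ.contMDiff_liftFun χ
  smooth_inv := χ.contMDiff_liftFun φ
  proj_toFun := φ.proj_liftFun χ
  equivariant q g := φ.liftFun_eq χ
    (by rw [Q.proj_act, Q'.proj_act, φ.proj_liftFun])
    (by rw [φ.equivariant, χ.equivariant, φ.toFun_liftFun])
  pull_form := by
    rw [← φ.pull_form, OneForm.pull_pull φ.smooth (φ.contMDiff_liftFun χ), ← χ.pull_form]
    exact pull_congr _ (φ.toFun_liftFun χ) _ _

/-- The composition of a bundle map with an isomorphism of connections. -/
def compIso (φ : BundleMap f Q P) {P' : Connection G M} (a : P ⟶ P') : BundleMap f Q P' where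
  toFun q := a.toFun (φ.toFun q)
  smooth := a.smooth.comp φ.smooth
  proj_toFun q := by rw [a.proj_toFun, φ.proj_toFun]
  equivariant q g := by rw [φ.equivariant, a.equivariant]
  pull_form := by rw [← OneForm.pull_pull a.smooth φ.smooth, a.pull_form, φ.pull_form]

end BundleMap

/-- The map from a manifold over `M` to `id : M → M`. -/
def overTerminal (X : Over M) : X ⟶ Over.mk (𝟙 M) := Over.homMk X.hom

variable (G M) in
/-- The value of a compatible system of `G`-connections at `id : M → M`. -/
def BConn.eval : BConn G M ⥤ Connection G M where
  obj P := P.obj (Over.mk (𝟙 M))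
  map φ := φ.app (Over.mk (𝟙 M))
  map_id _ := rfl
  map_comp _ _ := rfl

theorem BConn.comp_overTerminal {X Y : Over M} (h : X ⟶ Y) (P : BConn G M)
    (p : (P.obj X).total) :
    (P.map (overTerminal Y)).toFun ((P.map h).toFun p) = (P.map (overTerminal X)).toFun p := by
  rw [← P.map_comp]
  have e : h ≫ overTerminal Y = overTerminal X := Over.mkIdTerminal.hom_ext _ _
  rw [e]

theorem BConn.map_overTerminal_id (P : BConn G M) (p : (P.obj (Over.mk (𝟙 M))).total) :
    (P.map (overTerminal (Over.mk (𝟙 M)))).toFun p = p := by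
  have e : overTerminal (Over.mk (𝟙 M)) = 𝟙 _ := Over.mkIdTerminal.hom_ext _ _
  rw [e, P.map_id]

/-- Naturality along `X ⟶ id` expresses the component at `X` through the one at `id`, as bundle maps
are injective on fibres. -/
instance : (BConn.eval G M).Faithful where
  map_injective {P' P φ χ} e := BConn.Iso.ext fun X => Connection.Iso.ext fun p => by
    refine (P.map (overTerminal X)).injective_on_fibres
      ((Connection.Iso.proj_toFun _ p).trans (Connection.Iso.proj_toFun _ p).symm) ?_
    refine (BConn.Iso.naturality φ (overTerminal X) p).symm.trans
      (Eq.trans ?_ (BConn.Iso.naturality χ (overTerminal X) p))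
    exact congrArg (fun a : P'.obj (Over.mk (𝟙 M)) ⟶ P.obj (Over.mk (𝟙 M)) =>
      a.toFun ((P'.map (overTerminal X)).toFun p)) e

/-- The component at `X` is the unique factorization through `P(X) → P(id)` of the given isomorphism
composed with `P'(X) → P'(id)`; uniqueness gives naturality. -/
instance : (BConn.eval G M).Full where
  map_surjective {P' P} a := by
    have hl : ∀ (X : Over M) (p : (P'.obj X).total), (P.map (overTerminal X)).toFun
        (((P.map (overTerminal X)).lift ((P'.map (overTerminal X)).compIso a)).toFun p) =
        a.toFun ((P'.map (overTerminal X)).toFun p) := fun X p =>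
      (P.map (overTerminal X)).toFun_liftFun ((P'.map (overTerminal X)).compIso a) p
    refine ⟨⟨fun X => (P.map (overTerminal X)).lift ((P'.map (overTerminal X)).compIso a),
      fun {X Y} h p => ?_⟩, Connection.Iso.ext fun p => ?_⟩
    · refine (P.map (overTerminal Y)).liftFun_eq ((P'.map (overTerminal Y)).compIso a) ?_ ?_
      · rw [(P.map h).proj_toFun, (P'.map h).proj_toFun, Connection.Iso.proj_toFun]
      · rw [P.comp_overTerminal, hl]
        exact congrArg a.toFun (P'.comp_overTerminal h p).symm
    · refine (P.map (overTerminal (Over.mk (𝟙 M)))).liftFun_eq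
        ((P'.map (overTerminal (Over.mk (𝟙 M)))).compIso a) (a.proj_toFun p) ?_
      exact (P.map_overTerminal_id (a.toFun p)).trans
        (congrArg a.toFun (P'.map_overTerminal_id p).symm)

instance : (BTriv.toBConn (G := G) M).Faithful where
  map_injective {α β g g'} e := by
    have e1 := congrArg (BConn.eval G M).map e
    refine BTriv.Hom.ext fun x => ?_
    have e2 := congrArg (fun a : Connection.Iso
      (trivialConnection M (α.form.pull (fun x => x) contMDiff_id))
      (trivialConnection M (β.form.pull (fun x => x) contMDiff_id)) =>
        (a.toFun (x, (1 : G))).2) e1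
    have e3 : (BTriv.Hom.toFun g x)⁻¹ * 1 = (BTriv.Hom.toFun g' x)⁻¹ * 1 := e2
    exact inv_injective (mul_right_cancel e3)

instance : (BTriv.toBConn (G := G) M).Full where
  map_surjective {α β} Ψ := by
    obtain ⟨g, hg, h, e⟩ := exists_eq_trivialIso ((BConn.eval G M).map Ψ)
    -- The evaluated forms are pullbacks along the identity, equal to `α` and `β` only
    -- propositionally.
    have h' : β.form = α.form.gauge G.I g hg := (OneForm.pull_id β.form).symm.trans
      (h.trans (gauge_congr G.I (OneForm.pull_id α.form) (fun _ => rfl) _ _))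
    exact ⟨⟨g, hg, h'⟩, (BConn.eval G M).map_injective e⟩

theorem isEquivalence_toBConn (hM : ∀ P : PrincipalBundle G M, ∃ s : M → P.total,
    ContMDiff M.I P.total.I ∞ s ∧ ∀ x, P.proj.toFun (s x) = x) :
    (BTriv.toBConn (G := G) M).IsEquivalence where
  essSurj := ⟨fun P => by
    obtain ⟨s, hs, hsP⟩ := hM (P.obj (Over.mk (𝟙 M))).toPrincipalBundle
    have a := (P.obj (Over.mk (𝟙 M))).isoOfSection s hs hsP
    -- The source of `a` is brought to the form of the value at `id` of the image system, so that
    -- `a` lifts along the full functor `BConn.eval`.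
    rw [← OneForm.pull_id ((P.obj (Over.mk (𝟙 M))).form.pull s hs)] at a
    obtain ⟨b, -⟩ := (BConn.eval G M).map_surjective
      (X := (BTriv.toBConn M).obj ⟨(P.obj (Over.mk (𝟙 M))).form.pull s hs⟩) (Y := P) a
    exact ⟨_, ⟨(Groupoid.isoEquivHom _ _).symm b⟩⟩⟩

end Evaluation

end GConn

end

theorem mainTheorem9 (G : Man) [Group G] [LieGroup G.I ∞ G] :
    (∀ (m : ℕ) (r : ℝ), 0 < r →
      (BTriv.toConnection (G := G) (Man.ball m r)).IsEquivalence ∧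
      (BTriv.toBConn (G := G) (Man.ball m r)).IsEquivalence) ∧
    IsWeakEquiv (Functor.whiskerRight (psi G) groupoidNerve) := by
  have h : ∀ (m : ℕ) (r : ℝ), 0 < r →
      (BTriv.toConnection (G := G) (Man.ball m r)).IsEquivalence ∧
      (BTriv.toBConn (G := G) (Man.ball m r)).IsEquivalence := fun _ _ hr =>
    ⟨isEquivalence_toConnection (PrincipalBundle.exists_smooth_section hr),
      isEquivalence_toBConn (PrincipalBundle.exists_smooth_section hr)⟩
  exact ⟨h, isWeakEquiv_of_isEquivalence (psi G) fun m r => (h m r.1 r.2).2⟩
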